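/- Let $G(n,p)$ denote the random graph on the vertex set $\{1,\dots,n\}$ in which each pair of distinct vertices is joined by an edge with probability $p$, independently of all other pairs. First-order (FO) sentences about graphs are built from the relation symbols $\sim$ (adjacency) and $=$, logical connectives, variables ranging over vertices, and the quantifiers $\forall,\exists$; the quantifier depth of a sentence is the number of nested quantifiers in a longest sequence of nested quantifiers. For a function $p=p(n)$, the random graph $G(n,p)$ obeys the FO zero-one $k$-law if for every FO sentence $\varphi$ of quantifier depth at most $k$ the probability that $G(n,p(n))$ satisfies $\varphi$ tends, as $n\to\infty$, either to $1$ or to $0$. **Theorem.** Let $\alpha>0$. The random graph $G(n,n^{-\alpha})$ does not obey the FO zero-one $3$-law if and only if $$\alpha\in\left\{1,\tfrac{7}{6},\tfrac{6}{5},\tfrac{5}{4},\tfrac{4}{3},\tfrac{3}{2},2\right\}.$$ -/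

import Mathlib

open FirstOrder Filter Topology MeasureTheory

/-- The quantifier depth of a first-order formula: the number of nested quantifiers in a longest
sequence of nested quantifiers. In Mathlib the primitive connectives are falsity, implication and
the universal quantifier; the other connectives are built from falsity and implication (and thus
have as depth the maximum of the depths of their parts), and `∃` is `¬ ∀ ¬`. -/
def FirstOrder.Language.BoundedFormula.quantifierDepth {L : Language} {β : Type*} :
    {m : ℕ} → L.BoundedFormula β m → ℕ
  | _, .falsum => 0
  | _, .equal _ _ => 0
  | _, .rel _ _ => 0
  | _, .imp f g => max f.quantifierDepth g.quantifierDepth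
  | _, .all f => f.quantifierDepth + 1

/-- `G ⊨ φ`: the first-order sentence `φ` in the language of graphs is true in the graph `G`. -/
def SimpleGraph.SatisfiesFO {V : Type*} (G : SimpleGraph V) (φ : Language.graph.Sentence) : Prop :=
  @Language.Sentence.Realize Language.graph V G.structure φ

/-- The probability that the binomial random graph `G(n, p)`, with vertex set `Fin n`, satisfies
the first-order sentence `φ`. -/
noncomputable def probSatisfiesFO (n : ℕ) (p : unitInterval) (φ : Language.graph.Sentence) : ℝ :=
  (SimpleGraph.binomialRandom (Fin n) p).real {G | G.SatisfiesFO φ}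

/-- `G(n, p(n))` obeys the FO zero-one `k`-law: every first-order sentence of quantifier depth
at most `k` is either asymptotically almost surely true or asymptotically almost surely false.
(Depth "at most `k`" and "exactly `k`" give the same notion, as the depth of a sentence can be
increased by conjoining a valid sentence of depth `k`.) -/
def ObeysFOZeroOneLaw (p : ℕ → unitInterval) (k : ℕ) : Prop :=
  ∀ φ : Language.graph.Sentence, φ.quantifierDepth ≤ k →
    Tendsto (fun n => probSatisfiesFO n (p n) φ) atTop (𝓝 1) ∨
    Tendsto (fun n => probSatisfiesFO n (p n) φ) atTop (𝓝 0)

/-- The edge probability `n ^ (-α)`, for `α > 0`. It lies in `[0, 1]` for every `n`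
(at `n = 0`, where it is irrelevant, it is `0`). -/
noncomputable def powEdgeProb (α : ℝ) (hα : 0 < α) (n : ℕ) : unitInterval :=
  ⟨(n : ℝ) ^ (-α), Real.rpow_nonneg n.cast_nonneg _, by
    rcases Nat.eq_zero_or_pos n with rfl | hn
    · simp [Real.zero_rpow (neg_ne_zero.mpr hα.ne')]
    · exact Real.rpow_le_one_of_one_le_of_nonpos (by exact_mod_cast hn) (by linarith)⟩

/-!
Two graphs with the same `graphType` satisfy the same sentences of depth at most three, by the
Ehrenfeucht–Fraïssé game, so a zero-one law follows from any property which holds asymptotically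
almost surely and determines the type.

For `α > 1`, graphs on at most seven vertices with at least as many edges as vertices do not
occur, and a tree with `m ≤ 6` edges occurs, then as a connected component, if `α * m < m + 1`, and
does not occur if `α * m > m + 1`.
Components on at most seven vertices determine the type, so the law holds unless
`α = (m + 1) / m`; at such a threshold, and likewise at `α = 1` for triangles, the number of copies
of a suitable graph has bounded mean and, by the second moment method, is positive with probability
bounded away from both `0` and `1`, and this event is definable with three nested quantifiers.

For `α < 1`, any two vertices have private neighbours and a common non-neighbour. If `α < 1 / 2`
they also have common neighbours. If `1 / 2 ≤ α < 1`, every vertex is adjacent and non-adjacent to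
vertices with which it has no common neighbour, and what remains of the type is whether all
vertices (`α < 2 / 3`) or only some of them (`2 / 3 ≤ α`) lie in triangles.
-/

namespace FOZeroOne

variable {V W : Type*}

section EhrenfeuchtFraisse

variable {G : SimpleGraph V} {H : SimpleGraph W} {k m : ℕ} {a : Fin m → V} {b : Fin m → W}

/-- Duplicator wins the `k`-round Ehrenfeucht–Fraïssé game on `G` and `H` from the position in
which the vertices `a` and `b` have been chosen. -/
def EFEquiv (G : SimpleGraph V) (H : SimpleGraph W) :
    ℕ → {m : ℕ} → (Fin m → V) → (Fin m → W) → Prop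
  | 0, _, a, b => ∀ i j, (a i = a j ↔ b i = b j) ∧ (G.Adj (a i) (a j) ↔ H.Adj (b i) (b j))
  | k + 1, m, a, b => EFEquiv G H 0 a b ∧
      (∀ x, ∃ y, EFEquiv G H k (Fin.snoc a x : Fin (m + 1) → V) (Fin.snoc b y)) ∧
      (∀ y, ∃ x, EFEquiv G H k (Fin.snoc a x : Fin (m + 1) → V) (Fin.snoc b y))

theorem efEquiv_zero_iff : EFEquiv G H 0 a b ↔
    ∀ i j, (a i = a j ↔ b i = b j) ∧ (G.Adj (a i) (a j) ↔ H.Adj (b i) (b j)) := by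
  rw [EFEquiv]

theorem efEquiv_succ_iff : EFEquiv G H (k + 1) a b ↔ EFEquiv G H 0 a b ∧
    (∀ x, ∃ y, EFEquiv G H k (Fin.snoc a x : Fin (m + 1) → V) (Fin.snoc b y)) ∧
    (∀ y, ∃ x, EFEquiv G H k (Fin.snoc a x : Fin (m + 1) → V) (Fin.snoc b y)) := by
  rw [efEquiv_zero_iff, EFEquiv, efEquiv_zero_iff]

theorem EFEquiv.zero (h : EFEquiv G H k a b) : EFEquiv G H 0 a b := by
  cases k with
  | zero => exact h
  | succ k => exact (efEquiv_succ_iff.1 h).1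

theorem EFEquiv.of_succ (h : EFEquiv G H (k + 1) a b) : EFEquiv G H k a b := by
  induction k generalizing m with
  | zero => exact h.zero
  | succ k ih =>
    obtain ⟨h₀, hx, hy⟩ := efEquiv_succ_iff.1 h
    exact efEquiv_succ_iff.2 ⟨h₀, fun x => (hx x).imp fun _ => ih, fun y => (hy y).imp fun _ => ih⟩

theorem snoc_comp_snoc {U : Type*} {l : ℕ} (c : Fin m → U) (f : Fin l → Fin m) (u : U) :
    (Fin.snoc c u : Fin (m + 1) → U) ∘
      (Fin.snoc (Fin.castSucc ∘ f) (Fin.last m) : Fin (l + 1) → Fin (m + 1)) =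
        Fin.snoc (c ∘ f) u := by
  funext i
  refine Fin.lastCases ?_ (fun i => ?_) i <;> simp

theorem EFEquiv.comp (h : EFEquiv G H k a b) {l : ℕ} (f : Fin l → Fin m) :
    EFEquiv G H k (a ∘ f) (b ∘ f) := by
  induction k generalizing m l with
  | zero => exact efEquiv_zero_iff.2 fun i j => efEquiv_zero_iff.1 h (f i) (f j)
  | succ k ih =>
    obtain ⟨h₀, hx, hy⟩ := efEquiv_succ_iff.1 h
    refine efEquiv_succ_iff.2 ⟨efEquiv_zero_iff.2 fun i j => efEquiv_zero_iff.1 h₀ (f i) (f j),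
      fun x => (hx x).imp fun y hxy => ?_, fun y => (hy y).imp fun x hxy => ?_⟩ <;>
    simpa only [snoc_comp_snoc] using ih hxy (Fin.snoc (Fin.castSucc ∘ f) (Fin.last m))

theorem efEquiv_zero_snoc (h : EFEquiv G H 0 a b) {x : V} {y : W}
    (hxy : ∀ i, (a i = x ↔ b i = y) ∧ (G.Adj (a i) x ↔ H.Adj (b i) y)) :
    EFEquiv G H 0 (Fin.snoc a x : Fin (m + 1) → V) (Fin.snoc b y : Fin (m + 1) → W) := by
  rw [efEquiv_zero_iff] at h ⊢
  intro i j
  refine Fin.lastCases ?_ (fun i => ?_) i <;> refine Fin.lastCases ?_ (fun j => ?_) j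
  · simp
  · simpa [eq_comm, SimpleGraph.adj_comm] using hxy j
  · simpa using hxy i
  · simpa using h i j

-- Spoiler gains nothing by choosing a vertex again, since Duplicator can repeat her answer.
theorem EFEquiv.succ_of_forall_ne (h : EFEquiv G H k a b)
    (hx : ∀ x, (∀ i, a i ≠ x) → ∃ y,
      EFEquiv G H k (Fin.snoc a x : Fin (m + 1) → V) (Fin.snoc b y : Fin (m + 1) → W))
    (hy : ∀ y, (∀ i, b i ≠ y) → ∃ x,
      EFEquiv G H k (Fin.snoc a x : Fin (m + 1) → V) (Fin.snoc b y : Fin (m + 1) → W)) :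
    EFEquiv G H (k + 1) a b := by
  have repeated (i : Fin m) : EFEquiv G H k (Fin.snoc a (a i) : Fin (m + 1) → V)
      (Fin.snoc b (b i) : Fin (m + 1) → W) := by
    simpa only [Fin.comp_snoc, Function.comp_id] using
      h.comp (Fin.snoc id i : Fin (m + 1) → Fin m)
  refine efEquiv_succ_iff.2 ⟨h.zero, fun x => ?_, fun y => ?_⟩
  · by_cases hax : ∃ i, a i = x
    · obtain ⟨i, rfl⟩ := hax
      exact ⟨b i, repeated i⟩
    · exact hx x (not_exists.1 hax)
  · by_cases hby : ∃ i, b i = y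
    · obtain ⟨i, rfl⟩ := hby
      exact ⟨a i, repeated i⟩
    · exact hy y (not_exists.1 hby)

theorem efEquiv_succ_of_forall_ne (h : EFEquiv G H 0 a b)
    (hx : ∀ x, (∀ i, a i ≠ x) → ∃ y,
      EFEquiv G H k (Fin.snoc a x : Fin (m + 1) → V) (Fin.snoc b y : Fin (m + 1) → W))
    (hy : ∀ y, (∀ i, b i ≠ y) → ∃ x,
      EFEquiv G H k (Fin.snoc a x : Fin (m + 1) → V) (Fin.snoc b y : Fin (m + 1) → W)) :
    EFEquiv G H (k + 1) a b := by
  induction k with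
  | zero => exact h.succ_of_forall_ne hx hy
  | succ k ih =>
    refine (ih (fun x hax => ?_) fun y hby => ?_).succ_of_forall_ne hx hy
    · exact (hx x hax).imp fun _ => EFEquiv.of_succ
    · exact (hy y hby).imp fun _ => EFEquiv.of_succ

theorem exists_eq_var (t : Language.graph.Term (Empty ⊕ Fin m)) :
    ∃ i, t = Language.Term.var (Sum.inr i) := by
  rcases t with (e | i) | ⟨f, -⟩
  · exact e.elim
  · exact ⟨i, rfl⟩
  · exact Empty.elim f

theorem EFEquiv.realize_iff (φ : Language.graph.BoundedFormula Empty m)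
    (hk : φ.quantifierDepth ≤ k) (h : EFEquiv G H k a b) :
    (@Language.BoundedFormula.Realize _ V G.structure _ _ φ default a ↔
      @Language.BoundedFormula.Realize _ W H.structure _ _ φ default b) := by
  let := G.structure
  let := H.structure
  induction φ generalizing k with
  | falsum => exact Iff.rfl
  | equal t₁ t₂ =>
    obtain ⟨i, rfl⟩ := exists_eq_var t₁
    obtain ⟨j, rfl⟩ := exists_eq_var t₂
    exact (efEquiv_zero_iff.1 h.zero i j).1
  | rel R ts =>
    cases R
    obtain ⟨i, hi⟩ := exists_eq_var (ts 0)
    obtain ⟨j, hj⟩ := exists_eq_var (ts 1)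
    change G.Adj ((ts 0).realize _) ((ts 1).realize _) ↔
      H.Adj ((ts 0).realize _) ((ts 1).realize _)
    rw [hi, hj]
    exact (efEquiv_zero_iff.1 h.zero i j).2
  | imp f g ihf ihg =>
    obtain ⟨hf, hg⟩ := max_le_iff.1 hk
    exact imp_congr (ihf hf h) (ihg hg h)
  | all f ih =>
    obtain ⟨k, rfl⟩ := Nat.exists_eq_add_of_lt (Nat.succ_le_iff.1 hk)
    obtain ⟨-, hx, hy⟩ := efEquiv_succ_iff.1 h
    refine ⟨fun hG y => ?_, fun hH x => ?_⟩
    · obtain ⟨x, hxy⟩ := hy y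
      exact (ih (Nat.le_add_right _ _) hxy).1 (hG x)
    · obtain ⟨y, hxy⟩ := hx x
      exact (ih (Nat.le_add_right _ _) hxy).2 (hH y)

theorem EFEquiv.satisfiesFO_iff
    (h : EFEquiv G H k (default : Fin 0 → V) (default : Fin 0 → W))
    {φ : Language.graph.Sentence} (hφ : φ.quantifierDepth ≤ k) :
    G.SatisfiesFO φ ↔ H.SatisfiesFO φ :=
  h.realize_iff φ hφ

end EhrenfeuchtFraisse

section Types

/-- The vertices `x` and `y` have a common neighbour. -/
def HasCommonNbr (G : SimpleGraph V) (x y : V) : Prop := ∃ z, G.Adj x z ∧ G.Adj y z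

/-- The vertex `x` has a neighbour other than `y` which is not adjacent to `y`. -/
def HasPrivateNbr (G : SimpleGraph V) (x y : V) : Prop := ∃ z, G.Adj x z ∧ ¬ G.Adj y z ∧ z ≠ y

/-- There is a vertex other than `x` and `y` which is adjacent to neither of them. -/
def HasCommonNonNbr (G : SimpleGraph V) (x y : V) : Prop :=
  ∃ z, ¬ G.Adj x z ∧ ¬ G.Adj y z ∧ z ≠ x ∧ z ≠ y

/-- The type of a pair of distinct vertices: it determines which first-order formulas of depth one
the pair satisfies. -/
def pairType (G : SimpleGraph V) (x y : V) : Prop × Prop × Prop × Prop × Prop :=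
  (G.Adj x y, HasCommonNbr G x y, HasPrivateNbr G x y, HasPrivateNbr G y x, HasCommonNonNbr G x y)

/-- The type of a vertex, the set of the types of the pairs in which it occurs first: it determines
which first-order formulas of depth two the vertex satisfies. -/
def vertexType (G : SimpleGraph V) (x : V) : Set (Prop × Prop × Prop × Prop × Prop) :=
  pairType G x '' {x}ᶜ

/-- The type of a graph, the set of the types of its vertices: it determines which first-order
sentences of depth three the graph satisfies. -/
def graphType (G : SimpleGraph V) : Set (Set (Prop × Prop × Prop × Prop × Prop)) :=
  Set.range (vertexType G)

variable {G : SimpleGraph V} {H : SimpleGraph W}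

theorem exists_adj_iff_of_pairType_eq {x x' : V} {y y' : W}
    (h : pairType G x x' = pairType H y y') {z : V} (hx : z ≠ x) (hx' : z ≠ x') :
    ∃ w, w ≠ y ∧ w ≠ y' ∧ (G.Adj x z ↔ H.Adj y w) ∧ (G.Adj x' z ↔ H.Adj y' w) := by
  simp only [pairType, Prod.mk.injEq, eq_iff_iff] at h
  obtain ⟨-, hcommon, hprivate, hprivate', hnon⟩ := h
  by_cases ha : G.Adj x z <;> by_cases hb : G.Adj x' z
  · obtain ⟨w, hw, hw'⟩ := hcommon.1 ⟨z, ha, hb⟩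
    exact ⟨w, hw.ne', hw'.ne', iff_of_true ha hw, iff_of_true hb hw'⟩
  · obtain ⟨w, hw, hw', hne⟩ := hprivate.1 ⟨z, ha, hb, hx'⟩
    exact ⟨w, hw.ne', hne, iff_of_true ha hw, iff_of_false hb hw'⟩
  · obtain ⟨w, hw, hw', hne⟩ := hprivate'.1 ⟨z, hb, ha, hx⟩
    exact ⟨w, hne, hw.ne', iff_of_false ha hw', iff_of_true hb hw⟩
  · obtain ⟨w, hw, hw', hne, hne'⟩ := hnon.1 ⟨z, ha, hb, hx, hx'⟩
    exact ⟨w, hne, hne', iff_of_false ha hw, iff_of_false hb hw'⟩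

theorem efEquiv_one_of_pairType_eq {x x' : V} {y y' : W} (h : pairType G x x' = pairType H y y')
    (hx : x ≠ x') (hy : y ≠ y') : EFEquiv G H 1 ![x, x'] ![y, y'] := by
  have h₀ : EFEquiv G H 0 ![x, x'] ![y, y'] := by
    have hadj : G.Adj x x' ↔ H.Adj y y' := iff_of_eq (congrArg Prod.fst h)
    refine efEquiv_zero_iff.2 fun i j => ?_
    fin_cases i <;> fin_cases j <;>
      simp [hx, hy, hx.symm, hy.symm, hadj, G.adj_comm x' x, H.adj_comm y' y]
  refine efEquiv_succ_of_forall_ne h₀ (fun z hz => ?_) fun w hw => ?_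
  · obtain ⟨w, hw, hw', ha, hb⟩ := exists_adj_iff_of_pairType_eq h (hz 0).symm (hz 1).symm
    exact ⟨w, efEquiv_zero_snoc h₀ (Fin.forall_fin_two.2
      ⟨⟨iff_of_false (hz 0) hw.symm, ha⟩, ⟨iff_of_false (hz 1) hw'.symm, hb⟩⟩)⟩
  · obtain ⟨z, hz, hz', ha, hb⟩ := exists_adj_iff_of_pairType_eq h.symm (hw 0).symm (hw 1).symm
    exact ⟨z, efEquiv_zero_snoc h₀ (Fin.forall_fin_two.2
      ⟨⟨iff_of_false hz.symm (hw 0), ha.symm⟩, ⟨iff_of_false hz'.symm (hw 1), hb.symm⟩⟩)⟩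

theorem snoc_default_eq {U : Type*} (u : U) : (Fin.snoc default u : Fin 1 → U) = ![u] := by
  funext i
  fin_cases i
  rfl

theorem snoc_vecCons_empty {U : Type*} (u v : U) : (Fin.snoc ![u] v : Fin 2 → U) = ![u, v] := by
  funext i
  fin_cases i <;> rfl

theorem efEquiv_two_of_vertexType_eq {x : V} {y : W} (h : vertexType G x = vertexType H y) :
    EFEquiv G H 2 ![x] ![y] := by
  refine efEquiv_succ_of_forall_ne (efEquiv_zero_iff.2 fun i j => by simp)
    (fun z hz => ?_) fun w hw => ?_ <;> simp only [snoc_vecCons_empty]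
  · obtain ⟨w, hw, hwz⟩ : pairType G x z ∈ vertexType H y := h ▸ ⟨z, (hz 0).symm, rfl⟩
    exact ⟨w, efEquiv_one_of_pairType_eq hwz.symm (hz 0) (Ne.symm hw)⟩
  · obtain ⟨z, hz, hwz⟩ : pairType H y w ∈ vertexType G x := h ▸ ⟨w, (hw 0).symm, rfl⟩
    exact ⟨z, efEquiv_one_of_pairType_eq hwz (Ne.symm hz) (hw 0)⟩

theorem efEquiv_three_of_graphType_eq (h : graphType G = graphType H) :
    EFEquiv G H 3 (default : Fin 0 → V) (default : Fin 0 → W) := by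
  refine efEquiv_succ_iff.2 ⟨efEquiv_zero_iff.2 fun i => i.elim0, fun x => ?_, fun y => ?_⟩ <;>
    simp only [snoc_default_eq]
  · obtain ⟨y, hy⟩ : vertexType G x ∈ graphType H := h ▸ Set.mem_range_self x
    exact ⟨y, efEquiv_two_of_vertexType_eq hy.symm⟩
  · obtain ⟨x, hx⟩ : vertexType H y ∈ graphType G := h ▸ Set.mem_range_self y
    exact ⟨x, efEquiv_two_of_vertexType_eq hx⟩

theorem satisfiesFO_iff_of_graphType_eq (h : graphType G = graphType H)
    {φ : Language.graph.Sentence} (hφ : φ.quantifierDepth ≤ 3) :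
    G.SatisfiesFO φ ↔ H.SatisfiesFO φ :=
  (efEquiv_three_of_graphType_eq h).satisfiesFO_iff hφ

end Types

section EdgeIndependence

open ProbabilityTheory Measure unitInterval
open scoped SimpleGraph

theorem probReal_not {Ω : Type*} [MeasurableSpace Ω] {μ : Measure Ω} [IsProbabilityMeasure μ]
    {A : Ω → Prop} (hA : MeasurableSet {ω | A ω}) : μ.real {ω | ¬ A ω} = 1 - μ.real {ω | A ω} :=
  probReal_compl_eq_one_sub hA

variable {p : I}

theorem map_edgeSet_binomialRandom [Countable V] :
    G(V, p).map SimpleGraph.edgeSet = setBernoulli Sym2.diagSetᶜ p := by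
  rw [SimpleGraph.binomialRandom, SimpleGraph.measurableEmbedding_edgeSet.map_comap]
  refine restrict_eq_self_of_ae_mem (setBernoulli_ae_subset.mono fun S hS => ?_)
  exact ⟨SimpleGraph.fromEdgeSet S, by
    simpa [← Set.compl_ofPred, Set.subset_compl_iff_disjoint_right] using hS⟩

theorem map_mem_edgeSet_binomialRandom [Countable V] :
    G(V, p).map (fun G e => e ∈ G.edgeSet) = infinitePi fun e : Sym2 V =>
      toNNReal p • dirac (¬ e.IsDiag) + toNNReal (σ p) • dirac False := by
  have hmem : (fun (S : Set (Sym2 V)) e => e ∈ S) ∘ (fun q : Sym2 V → Prop => {e | q e}) = id :=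
    rfl
  rw [← Function.comp_def (fun (S : Set (Sym2 V)) e => e ∈ S) SimpleGraph.edgeSet,
    ← map_map (by fun_prop) (by fun_prop), map_edgeSet_binomialRandom, setBernoulli_eq_map,
    map_map (by fun_prop) (by fun_prop), hmem, Measure.map_id]
  rfl

theorem map_mem_edgeSet_apply [Countable V] (e : Sym2 V) :
    G(V, p).map (fun G => e ∈ G.edgeSet) =
      toNNReal p • dirac (¬ e.IsDiag) + toNNReal (σ p) • dirac False := by
  rw [← infinitePi_map_eval (fun e : Sym2 V =>
      toNNReal p • dirac (¬ e.IsDiag) + toNNReal (σ p) • dirac False) e,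
    ← map_mem_edgeSet_binomialRandom, map_map (by fun_prop) (by fun_prop)]
  rfl

theorem iIndepFun_mem_edgeSet [Countable V] :
    iIndepFun (fun (e : Sym2 V) (G : SimpleGraph V) => e ∈ G.edgeSet) G(V, p) := by
  rw [iIndepFun_iff_map_fun_eq_infinitePi_map (by fun_prop), map_mem_edgeSet_binomialRandom]
  simp only [map_mem_edgeSet_apply]

theorem measureReal_mem_edgeSet [Countable V] {e : Sym2 V} (he : ¬ e.IsDiag) :
    G(V, p).real {G | e ∈ G.edgeSet} = p := by
  have hpre : {G : SimpleGraph V | e ∈ G.edgeSet} = (fun G => e ∈ G.edgeSet) ⁻¹' {True} := by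
    ext
    simp
  rw [hpre, ← map_measureReal_apply (by fun_prop) (MeasurableSet.singleton _),
    map_mem_edgeSet_apply, measureReal_def,
    Measure.add_apply, Measure.smul_apply, Measure.smul_apply]
  simp [he, ENNReal.smul_def]

instance [Finite V] : DiscreteMeasurableSpace (SimpleGraph V) := by
  have : MeasurableSingletonClass (SimpleGraph V) := by
    refine ⟨fun G => ?_⟩
    have : {G} = SimpleGraph.edgeSet ⁻¹' {G.edgeSet} := by ext; simp
    rw [this]
    exact SimpleGraph.measurable_edgeSet (measurableSet_singleton _)
  infer_instance

/-- The function `f` of a graph depends only on which elements of `D` are edges. -/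
def DependsOnEdges {β : Type*} (f : SimpleGraph V → β) (D : Set (Sym2 V)) : Prop :=
  ∀ ⦃G G'⦄, (∀ e ∈ D, e ∈ G.edgeSet ↔ e ∈ G'.edgeSet) → f G = f G'

theorem DependsOnEdges.comp {β γ : Type*} {f : SimpleGraph V → β} {D : Set (Sym2 V)}
    (hf : DependsOnEdges f D) (g : β → γ) : DependsOnEdges (g ∘ f) D :=
  fun _ _ h => congrArg g (hf h)

theorem DependsOnEdges.forall_mem {J : Type*} {A : J → SimpleGraph V → Prop}
    {D : J → Set (Sym2 V)} {s : Finset J} (hA : ∀ j ∈ s, DependsOnEdges (A j) (D j)) :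
    DependsOnEdges (fun G => ∀ j ∈ s, A j G) (⋃ j ∈ s, D j) := fun _ _ h =>
  propext (forall₂_congr fun j hj => iff_of_eq (hA j hj fun e he => h e (Set.mem_biUnion hj he)))

theorem dependsOnEdges_mem (e : Sym2 V) : DependsOnEdges (fun G => e ∈ G.edgeSet) {e} :=
  fun _ _ h => propext (h e rfl)

section Finite

variable [Finite V]

theorem DependsOnEdges.exists_eq_comp {β : Type*} {f : SimpleGraph V → β} {D : Set (Sym2 V)}
    (hf : DependsOnEdges f D) : ∃ φ : (D.toFinite.toFinset → Prop) → β,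
      f = φ ∘ fun G e => (e : Sym2 V) ∈ G.edgeSet := by
  refine ⟨fun q => f (.fromEdgeSet {e | ∃ he, q ⟨e, he⟩}), funext fun G => hf fun e he => ?_⟩
  simpa [he] using G.not_isDiag_of_mem_edgeSet

theorem DependsOnEdges.indepFun {β γ : Type*} [MeasurableSpace β] [MeasurableSpace γ]
    {f : SimpleGraph V → β} {g : SimpleGraph V → γ} {D E : Set (Sym2 V)}
    (hf : DependsOnEdges f D) (hg : DependsOnEdges g E) (hDE : Disjoint D E) :
    IndepFun f g G(V, p) := by
  obtain ⟨φ, rfl⟩ := hf.exists_eq_comp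
  obtain ⟨ψ, rfl⟩ := hg.exists_eq_comp
  refine (iIndepFun_mem_edgeSet.indepFun_finset _ _ ?_ (by fun_prop)).comp .of_discrete .of_discrete
  simpa using hDE

theorem iIndepFun_of_dependsOnEdges {J : Type*} {β : J → Type*} [∀ j, MeasurableSpace (β j)]
    {f : ∀ j, SimpleGraph V → β j} {D : J → Set (Sym2 V)} (hf : ∀ j, DependsOnEdges (f j) (D j))
    (hD : Pairwise (Function.onFun Disjoint D)) : iIndepFun f G(V, p) := by
  classical
  refine (iIndepFun_iff_measure_inter_preimage_eq_mul).2 fun s B hB => ?_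
  induction s using Finset.induction_on with
  | empty => simp
  | insert j s hj ih =>
    have hrest : DependsOnEdges (fun G => ∀ i ∈ s, f i G ∈ B i) (⋃ i ∈ s, D i) :=
      .forall_mem fun i _ => (hf i).comp (· ∈ B i)
    have hdisj : Disjoint (D j) (⋃ i ∈ s, D i) :=
      Set.disjoint_iUnion₂_right.2 fun i hi => hD (ne_of_mem_of_not_mem hi hj).symm
    have := ((hf j).indepFun (p := p) hrest hdisj).measure_inter_preimage_eq_mul
      (B j) {True} (hB j (s.mem_insert_self j)) (MeasurableSet.singleton _)
    have hpre : ⋂ i ∈ s, f i ⁻¹' B i = (fun G => ∀ i ∈ s, f i G ∈ B i) ⁻¹' {True} := by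
      ext
      simp
    rw [Finset.set_biInter_insert, Finset.prod_insert hj,
      ← ih fun i hi => hB i (Finset.mem_insert_of_mem hi), hpre]
    exact this

theorem measureReal_and_of_disjoint {A B : SimpleGraph V → Prop} {D E : Set (Sym2 V)}
    (hA : DependsOnEdges A D) (hB : DependsOnEdges B E) (hDE : Disjoint D E) :
    G(V, p).real {G | A G ∧ B G} = G(V, p).real {G | A G} * G(V, p).real {G | B G} := by
  have := (hA.indepFun (p := p) hB hDE).measure_inter_preimage_eq_mul {True} {True}
    (MeasurableSet.singleton _) (MeasurableSet.singleton _)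
  rw [measureReal_def, measureReal_def, measureReal_def, ← ENNReal.toReal_mul, Set.ofPred_and]
  simpa using congrArg ENNReal.toReal this

theorem measureReal_forall_mem {J : Type*} {A : J → SimpleGraph V → Prop} {D : J → Set (Sym2 V)}
    {s : Finset J} (hA : ∀ j ∈ s, DependsOnEdges (A j) (D j))
    (hD : (s : Set J).PairwiseDisjoint D) :
    G(V, p).real {G | ∀ j ∈ s, A j G} = ∏ j ∈ s, G(V, p).real {G | A j G} := by
  have hindep := iIndepFun_of_dependsOnEdges (p := p) (f := fun j : s => A j)
    (fun j => hA j j.2) fun i j hij => hD i.2 j.2 (Subtype.coe_ne_coe.2 hij)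
  have := hindep.meas_iInter (s := fun j : s => {G | A j G}) fun j =>
    ⟨{True}, MeasurableSet.singleton _, by ext; simp⟩
  simp only [measureReal_def, ← ENNReal.toReal_prod, ← Finset.prod_coe_sort s, ← this]
  congr 2
  ext
  simp

theorem integral_prod_of_pairwiseDisjoint {J : Type*} {f : J → SimpleGraph V → ℝ}
    {D : J → Set (Sym2 V)} {s : Finset J} (hf : ∀ j ∈ s, DependsOnEdges (f j) (D j))
    (hD : (s : Set J).PairwiseDisjoint D) :
    ∫ G, ∏ j ∈ s, f j G ∂G(V, p) = ∏ j ∈ s, ∫ G, f j G ∂G(V, p) := by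
  have hindep := iIndepFun_of_dependsOnEdges (p := p) (f := fun j : s => f j)
    (fun j => hf j j.2) fun i j hij => hD i.2 j.2 (Subtype.coe_ne_coe.2 hij)
  simp only [← Finset.prod_coe_sort s]
  exact hindep.integral_fun_prod_eq_prod_integral fun _ =>
    Measurable.of_discrete.aestronglyMeasurable

theorem measureReal_forall_mem_edgeSet_and_forall_notMem {E F : Finset (Sym2 V)}
    (hE : ∀ e ∈ E, ¬ e.IsDiag) (hF : ∀ e ∈ F, ¬ e.IsDiag) (hEF : Disjoint E F) :
    G(V, p).real {G | (∀ e ∈ E, e ∈ G.edgeSet) ∧ ∀ e ∈ F, e ∉ G.edgeSet} =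
      p ^ E.card * (1 - p) ^ F.card := by
  have hdisj (s : Finset (Sym2 V)) :
      (s : Set (Sym2 V)).PairwiseDisjoint fun e => ({e} : Set (Sym2 V)) :=
    fun _ _ _ _ hne => Set.disjoint_singleton.2 hne
  have hnot (e : Sym2 V) : DependsOnEdges (fun G => e ∉ G.edgeSet) {e} :=
    (dependsOnEdges_mem e).comp Not
  rw [measureReal_and_of_disjoint (.forall_mem fun e _ => dependsOnEdges_mem e)
      (.forall_mem fun e _ => hnot e)
      (by simpa [Set.disjoint_left, Finset.disjoint_left] using hEF),
    measureReal_forall_mem (fun e _ => dependsOnEdges_mem e) (hdisj E),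
    measureReal_forall_mem (fun e _ => hnot e) (hdisj F),
    Finset.prod_eq_pow_card fun e he => measureReal_mem_edgeSet (hE e he),
    Finset.prod_eq_pow_card fun e he => ?_]
  rw [probReal_not .of_discrete, measureReal_mem_edgeSet (hF e he)]

end Finite

end EdgeIndependence

section SecondMoment

open ProbabilityTheory

variable {Ω J : Type*} [MeasurableSpace Ω] {μ : Measure Ω}

theorem sq_integral_le_measureReal_mul_integral_sq [IsProbabilityMeasure μ] {X : Ω → ℝ}
    {A : Set Ω} (hX : MemLp X 2 μ) (hA : MeasurableSet A) (hXA : ∀ ω ∉ A, X ω = 0) :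
    (∫ ω, X ω ∂μ) ^ 2 ≤ μ.real A * ∫ ω, X ω ^ 2 ∂μ := by
  have hind : Integrable (A.indicator (1 : Ω → ℝ)) μ := (integrable_const 1).indicator hA
  have hsq (t : ℝ) : (fun ω => (A.indicator (1 : Ω → ℝ) ω * t - X ω) ^ 2) =
      fun ω => A.indicator (1 : Ω → ℝ) ω * (t * t) + X ω * (-2 * t) + X ω ^ 2 := by
    ext ω
    by_cases hω : ω ∈ A
    · simp only [hω, Set.indicator_of_mem, Pi.one_apply]
      ring
    · simp [hω, hXA ω hω]
  have hexpand (t : ℝ) : ∫ ω, (A.indicator (1 : Ω → ℝ) ω * t - X ω) ^ 2 ∂μ =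
      μ.real A * (t * t) + (-2 * ∫ ω, X ω ∂μ) * t + ∫ ω, X ω ^ 2 ∂μ := by
    have hind' := hind.mul_const (t * t)
    have hX' := (hX.integrable one_le_two).mul_const (-2 * t)
    rw [hsq, integral_add (by fun_prop) hX.integrable_sq, integral_add hind' hX',
      integral_mul_const, integral_mul_const, integral_indicator_one hA]
    ring
  have hdiscrim := discrim_le_zero fun t => (hexpand t).symm ▸ integral_nonneg fun ω => sq_nonneg _
  rw [discrim] at hdiscrim
  linarith

theorem measureReal_half_integral_le_abs_sub_le [IsProbabilityMeasure μ] {X : Ω → ℝ}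
    (hX : MemLp X 2 μ) (hpos : 0 < ∫ ω, X ω ∂μ) :
    μ.real {ω | (∫ ω, X ω ∂μ) / 2 ≤ |X ω - ∫ ω, X ω ∂μ|} ≤
      4 * ((∫ ω, X ω ^ 2 ∂μ) / (∫ ω, X ω ∂μ) ^ 2 - 1) := by
  refine (ENNReal.toReal_mono ENNReal.ofReal_ne_top
    (meas_ge_le_variance_div_sq hX (half_pos hpos))).trans_eq ?_
  rw [ENNReal.toReal_ofReal (div_nonneg (variance_nonneg X μ) (sq_nonneg _)), variance_eq_sub hX]
  simp only [Pi.pow_apply]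
  field_simp
  ring

variable [Fintype J]

/-- The number of events in a finite family which occur, as a real random variable. -/
noncomputable def eventCount (S : J → Set Ω) (ω : Ω) : ℝ := ∑ j, (S j).indicator 1 ω

omit [MeasurableSpace Ω] in
theorem eventCount_eq_card (S : J → Set Ω) (ω : Ω) :
    eventCount S ω = Nat.card {j // ω ∈ S j} := by
  classical
  simp only [eventCount, Set.indicator_apply, Pi.one_apply, Finset.sum_boole,
    Nat.card_eq_fintype_card, Fintype.card_subtype]

omit [MeasurableSpace Ω] in
theorem eventCount_eq_zero_of_forall_notMem {S : J → Set Ω} {ω : Ω} (h : ∀ j, ω ∉ S j) :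
    eventCount S ω = 0 := by
  simp [eventCount, h]

theorem integral_eventCount [IsFiniteMeasure μ] {S : J → Set Ω} (hS : ∀ j, MeasurableSet (S j)) :
    ∫ ω, eventCount S ω ∂μ = ∑ j, μ.real (S j) := by
  simp only [eventCount]
  rw [integral_finsetSum _ fun j _ => (integrable_const 1).indicator (hS j)]
  exact Finset.sum_congr rfl fun j _ => integral_indicator_one (hS j)

theorem integral_eventCount_sq [IsFiniteMeasure μ] {S : J → Set Ω}
    (hS : ∀ j, MeasurableSet (S j)) :
    ∫ ω, eventCount S ω ^ 2 ∂μ = ∑ i, ∑ j, μ.real (S i ∩ S j) := by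
  have hsq (ω : Ω) : eventCount S ω ^ 2 =
      eventCount (fun ij : J × J => S ij.1 ∩ S ij.2) ω := by
    simp only [eventCount, sq, Finset.sum_mul_sum, Fintype.sum_prod_type, Set.inter_indicator_one,
      Pi.mul_apply]
  simp only [hsq]
  rw [integral_eventCount (S := fun ij : J × J => S ij.1 ∩ S ij.2)
    fun ij => (hS ij.1).inter (hS ij.2), Fintype.sum_prod_type]

end SecondMoment

section Copies

open unitInterval
open scoped SimpleGraph

variable {p : I} {U : Type*}

theorem measureReal_le_edgeProb_pow [Finite V] (K : SimpleGraph V) :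
    G(V, p).real {G | K ≤ G} = p ^ K.edgeSet.ncard := by
  classical
  have := Fintype.ofFinite V
  have hprob := measureReal_forall_mem_edgeSet_and_forall_notMem (p := p) (E := K.edgeFinset)
    (F := ∅) (fun e he => K.not_isDiag_of_mem_edgeFinset he) (by simp) (by simp)
  rw [Finset.card_empty, pow_zero, mul_one, ← Set.ncard_coe_finset, K.coe_edgeFinset] at hprob
  rw [← hprob]
  congr 1
  ext G
  simpa using SimpleGraph.edgeSet_subset_edgeSet.symm.trans Set.subset_def.to_iff

theorem ncard_edgeSet_map (f : U ↪ V) (H : SimpleGraph U) :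
    (H.map f).edgeSet.ncard = H.edgeSet.ncard := by
  rw [SimpleGraph.edgeSet_map, Set.ncard_image_of_injective _ f.sym2Map.injective]

theorem isContained_iff_exists_map_le {H : SimpleGraph U} {G : SimpleGraph V} :
    H ⊑ G ↔ ∃ f : U ↪ V, H.map f ≤ G := by
  simp only [SimpleGraph.map_le_iff_le_comap]
  exact ⟨fun ⟨f⟩ => ⟨f.toEmbedding, fun _ _ h => f.toHom.map_adj h⟩,
    fun ⟨f, hf⟩ => ⟨⟨⟨f, fun h => hf h⟩, f.injective⟩⟩⟩

theorem measureReal_map_le [Finite V] (H : SimpleGraph U) (f : U ↪ V) :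
    G(V, p).real {G | H.map f ≤ G} = p ^ H.edgeSet.ncard := by
  rw [measureReal_le_edgeProb_pow, ncard_edgeSet_map]

theorem card_embedding_le_pow [Fintype U] [Fintype V] [Fintype (U ↪ V)] :
    Fintype.card (U ↪ V) ≤ Fintype.card V ^ Fintype.card U := by
  classical
  rw [Fintype.card_congr' rfl, Fintype.card_embedding_eq]
  exact Nat.descFactorial_le_pow _ _

open Classical in
theorem integral_eventCount_map_le [Fintype U] [Fintype V] (H : SimpleGraph U) :
    ∫ G, eventCount (fun f : U ↪ V => {G | H.map f ≤ G}) G ∂G(V, p) ≤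
      Fintype.card V ^ Fintype.card U * p ^ H.edgeSet.ncard := by
  rw [integral_eventCount fun _ => .of_discrete]
  simp only [measureReal_map_le, Finset.sum_const, Finset.card_univ, nsmul_eq_mul]
  gcongr
  · exact pow_nonneg p.2.1 _
  · exact_mod_cast card_embedding_le_pow

theorem measureReal_isContained_le [Fintype U] [Fintype V] (H : SimpleGraph U) :
    G(V, p).real {G | H ⊑ G} ≤ Fintype.card V ^ Fintype.card U * p ^ H.edgeSet.ncard := by
  classical
  refine le_trans ?_ (integral_eventCount_map_le (p := p) H)
  have hunion : {G : SimpleGraph V | H ⊑ G} = ⋃ f : U ↪ V, {G | H.map f ≤ G} := by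
    ext G
    simp [isContained_iff_exists_map_le]
  rw [hunion, integral_eventCount fun _ => .of_discrete]
  exact measureReal_iUnion_fintype_le _

theorem two_mul_measureReal_isContained_le [Fintype U] [Fintype V] {H : SimpleGraph U}
    (φ : H ≃g H) {i : U} (hi : φ i ≠ i) :
    2 * G(V, p).real {G | H ⊑ G} ≤ Fintype.card V ^ Fintype.card U * p ^ H.edgeSet.ncard := by
  classical
  refine le_trans ?_ (integral_eventCount_map_le (p := p) H)
  have hsub : {G : SimpleGraph V | H ⊑ G} ⊆
      {G | 2 ≤ eventCount (fun f : U ↪ V => {G | H.map f ≤ G}) G} := by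
    intro G hG
    obtain ⟨f, hf⟩ := isContained_iff_exists_map_le.1 hG
    have hφf : H.map (φ.toEmbedding.toEmbedding.trans f) ≤ G := by
      rw [SimpleGraph.map_le_iff_le_comap] at hf ⊢
      exact fun a b hab => hf (φ.map_adj_iff.2 hab)
    have hne : φ.toEmbedding.toEmbedding.trans f ≠ f := fun h =>
      hi (f.injective (DFunLike.congr_fun h i))
    have : Nontrivial {f : U ↪ V // H.map f ≤ G} :=
      ⟨⟨_, hφf⟩, ⟨f, hf⟩, fun h => hne (congrArg Subtype.val h)⟩
    rw [Set.mem_ofPred_eq, eventCount_eq_card]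
    exact_mod_cast Finite.one_lt_card (α := {f : U ↪ V // H.map f ≤ G})
  refine (mul_le_mul_of_nonneg_left (measureReal_mono hsub) zero_le_two).trans ?_
  exact mul_meas_ge_le_integral_of_nonneg
    (.of_forall fun G => by rw [eventCount_eq_card]; positivity) .of_finite 2

/-- `f` embeds `H` into `G` as a union of connected components of `G`. -/
def IsIsolatedCopy (H : SimpleGraph U) (f : U ↪ V) (G : SimpleGraph V) : Prop :=
  H.map f ≤ G ∧ ∀ i v, G.Adj (f i) v → ∃ j, H.Adj i j ∧ f j = v

theorem le_measureReal_isIsolatedCopy [Fintype U] [Fintype V] (H : SimpleGraph U) (f : U ↪ V) :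
    (p : ℝ) ^ H.edgeSet.ncard * (1 - p) ^ (Fintype.card U * Fintype.card V) ≤
      G(V, p).real {G | IsIsolatedCopy H f G} := by
  classical
  set F := ((Finset.univ : Finset (U × V)).image fun x => s(f x.1, x.2)).filter
    fun e => ¬ e.IsDiag ∧ e ∉ (H.map f).edgeFinset
  have hFcard : F.card ≤ Fintype.card U * Fintype.card V :=
    (Finset.card_filter_le _ _).trans (Finset.card_image_le.trans (by simp))
  have hprob := measureReal_forall_mem_edgeSet_and_forall_notMem (p := p)
    (E := (H.map f).edgeFinset) (F := F) (fun e he => (H.map f).not_isDiag_of_mem_edgeFinset he)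
    (fun e he => (Finset.mem_filter.1 he).2.1)
    (Finset.disjoint_left.2 fun e he he' => (Finset.mem_filter.1 he').2.2 he)
  rw [← Set.ncard_coe_finset, SimpleGraph.coe_edgeFinset, ncard_edgeSet_map] at hprob
  calc (p : ℝ) ^ H.edgeSet.ncard * (1 - p) ^ (Fintype.card U * Fintype.card V)
      ≤ p ^ H.edgeSet.ncard * (1 - p) ^ F.card :=
        mul_le_mul_of_nonneg_left
          (pow_le_pow_of_le_one (sub_nonneg.2 p.2.2) (sub_le_self 1 p.2.1) hFcard)
          (pow_nonneg p.2.1 _)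
    _ ≤ _ := hprob ▸ measureReal_mono fun G hG => ⟨?_, fun i v hv => ?_⟩
  · exact SimpleGraph.edgeSet_subset_edgeSet.1 fun e he =>
      hG.1 e (SimpleGraph.mem_edgeFinset.2 he)
  · by_contra hcon
    refine hG.2 s(f i, v) (Finset.mem_filter.2 ⟨Finset.mem_image.2 ⟨(i, v), by simp, rfl⟩,
      by simpa using hv.ne, fun hmem => hcon ?_⟩) hv
    rw [SimpleGraph.mem_edgeFinset, SimpleGraph.mem_edgeSet, SimpleGraph.map_adj] at hmem
    obtain ⟨a, b, hab, ha, rfl⟩ := hmem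
    exact ⟨b, f.injective ha ▸ hab, rfl⟩

theorem card_isIsolatedCopy_eq_eventCount [Fintype (U ↪ V)] (H : SimpleGraph U)
    (G : SimpleGraph V) : (Nat.card {f : U ↪ V // IsIsolatedCopy H f G} : ℝ) =
      eventCount (fun f : U ↪ V => {G | IsIsolatedCopy H f G}) G := by
  rw [eventCount_eq_card]
  simp only [Set.mem_ofPred_eq]

theorem descFactorial_mul_le_integral_card_isIsolatedCopy [Fintype U] [Fintype V]
    (H : SimpleGraph U) :
    (Fintype.card V).descFactorial (Fintype.card U) *
        ((p : ℝ) ^ H.edgeSet.ncard * (1 - p) ^ (Fintype.card U * Fintype.card V)) ≤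
      ∫ G, (Nat.card {f : U ↪ V // IsIsolatedCopy H f G} : ℝ) ∂G(V, p) := by
  classical
  simp only [card_isIsolatedCopy_eq_eventCount]
  rw [integral_eventCount fun _ => .of_discrete, ← Fintype.card_embedding_eq,
    ← Finset.card_univ, ← nsmul_eq_mul]
  exact Finset.card_nsmul_le_sum _ _ _ fun f _ => le_measureReal_isIsolatedCopy H f

theorem IsIsolatedCopy.range_subset {H : SimpleGraph U} {f g : U ↪ V} {G : SimpleGraph V}
    (hf : IsIsolatedCopy H f G) (hg : H.map g ≤ G) (hH : H.Preconnected) {i : U}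
    (hi : g i ∈ Set.range f) : Set.range g ⊆ Set.range f := by
  rintro _ ⟨j, rfl⟩
  obtain ⟨w⟩ := hH i j
  induction w with
  | nil => exact hi
  | cons hadj _ ih =>
    obtain ⟨k, hk⟩ := hi
    obtain ⟨l, -, hl⟩ := hf.2 k _ (hk ▸ hg (SimpleGraph.map_adj_apply.2 hadj))
    exact ih ⟨l, hl⟩

theorem card_filter_range_subset_le [Fintype U] [Fintype (U ↪ V)] (f : U ↪ V)
    [DecidablePred fun g : U ↪ V => Set.range g ⊆ Set.range f] :
    (Finset.univ.filter fun g : U ↪ V => Set.range g ⊆ Set.range f).card ≤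
      Fintype.card U ^ Fintype.card U := by
  classical
  have himage : (Finset.univ.filter fun g : U ↪ V => Set.range g ⊆ Set.range f).map
      ⟨(⇑), DFunLike.coe_injective⟩ ⊆ Finset.univ.image fun τ : U → U => f ∘ τ := by
    intro h hh
    obtain ⟨g, hg, rfl⟩ := Finset.mem_map.1 hh
    obtain ⟨τ, hτ⟩ := Set.range_subset_range_iff_exists_comp.1 (Finset.mem_filter.1 hg).2
    exact Finset.mem_image.2 ⟨τ, Finset.mem_univ _, hτ.symm⟩
  rw [← Fintype.card_fun, ← Finset.card_univ, ← Finset.card_map]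
  exact (Finset.card_le_card himage).trans Finset.card_image_le

theorem IsIsolatedCopy.exists_forall_notMem_range [Fintype U] [Finite V] {H : SimpleGraph U}
    {G : SimpleGraph V} (hH : H.Preconnected) (s : Finset V)
    (hs : s.card * Fintype.card U ^ Fintype.card U <
      Nat.card {f : U ↪ V // IsIsolatedCopy H f G}) :
    ∃ f, IsIsolatedCopy H f G ∧ ∀ x ∈ s, x ∉ Set.range f := by
  classical
  have := Fintype.ofFinite V
  by_contra! hmeet
  rw [Nat.card_eq_fintype_card, Fintype.card_subtype] at hs
  refine hs.not_ge ((Finset.card_le_card (t := s.biUnion fun x =>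
    Finset.univ.filter fun f => IsIsolatedCopy H f G ∧ x ∈ Set.range f) fun f hf => ?_).trans
    (Finset.card_biUnion_le_card_mul _ _ _ fun x _ => ?_))
  · obtain ⟨x, hx, hxf⟩ := hmeet f (Finset.mem_filter.1 hf).2
    exact Finset.mem_biUnion.2 ⟨x, hx, by simpa using ⟨(Finset.mem_filter.1 hf).2, hxf⟩⟩
  · obtain hempty | ⟨f, hf⟩ :=
      (Finset.univ.filter fun f => IsIsolatedCopy H f G ∧ x ∈ Set.range f).eq_empty_or_nonempty
    · rw [hempty, Finset.card_empty]
      exact Nat.zero_le _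
    obtain ⟨-, hfG, hxf⟩ := Finset.mem_filter.1 hf
    refine (Finset.card_le_card fun g hg => ?_).trans (card_filter_range_subset_le f)
    obtain ⟨-, hgG, i, rfl⟩ := Finset.mem_filter.1 hg
    simpa using hfG.range_subset hgG.1 hH hxf

theorem measureReal_isIsolatedCopy_and_le [Finite V] {H : SimpleGraph U} (hH : H.Preconnected)
    {f g : U ↪ V} (hfg : ¬ Set.range g ⊆ Set.range f) :
    G(V, p).real {G | IsIsolatedCopy H f G ∧ IsIsolatedCopy H g G} ≤
      ((p : ℝ) ^ H.edgeSet.ncard) ^ 2 := by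
  by_cases hmeet : ∃ i, g i ∈ Set.range f
  · obtain ⟨i, hi⟩ := hmeet
    have hempty : {G | IsIsolatedCopy H f G ∧ IsIsolatedCopy H g G} = ∅ :=
      Set.eq_empty_of_forall_notMem fun G hG => hfg (hG.1.range_subset hG.2.1 hH hi)
    simpa [hempty] using pow_nonneg (pow_nonneg p.2.1 _) 2
  have hdisj : Disjoint (H.map f) (H.map g) := by
    rw [SimpleGraph.disjoint_left]
    rintro x y hf hg
    obtain ⟨i, j, -, rfl, -⟩ := (SimpleGraph.map_adj _ _ _ _).1 hg
    obtain ⟨k, l, -, hk, -⟩ := (SimpleGraph.map_adj _ _ _ _).1 hf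
    exact hmeet ⟨i, k, hk⟩
  have hboth := measureReal_le_edgeProb_pow (p := p) (H.map f ⊔ H.map g)
  rw [SimpleGraph.edgeSet_sup, Set.ncard_union_eq (SimpleGraph.disjoint_edgeSet.2 hdisj),
    ncard_edgeSet_map, ncard_edgeSet_map, ← two_mul, mul_comm, pow_mul] at hboth
  exact hboth ▸ measureReal_mono fun G hG => sup_le hG.1.1 hG.2.1

theorem integral_card_isIsolatedCopy_sq_le [Fintype U] [Fintype V] {H : SimpleGraph U}
    (hH : H.Preconnected) :
    ∫ G, (Nat.card {f : U ↪ V // IsIsolatedCopy H f G} : ℝ) ^ 2 ∂G(V, p) ≤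
      (Fintype.card V ^ Fintype.card U * (p : ℝ) ^ H.edgeSet.ncard) ^ 2 +
        Fintype.card U ^ Fintype.card U *
          (Fintype.card V ^ Fintype.card U * (p : ℝ) ^ H.edgeSet.ncard) := by
  classical
  have hp : (0 : ℝ) ≤ p ^ H.edgeSet.ncard := pow_nonneg p.2.1 _
  have hpair (f g : U ↪ V) :
      G(V, p).real ({G | IsIsolatedCopy H f G} ∩ {G | IsIsolatedCopy H g G}) ≤
        ((p : ℝ) ^ H.edgeSet.ncard) ^ 2 +
          if Set.range g ⊆ Set.range f then (p : ℝ) ^ H.edgeSet.ncard else 0 := by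
    split_ifs with hfg
    · refine le_add_of_nonneg_of_le (by positivity) ?_
      exact (measureReal_mono fun G hG => hG.1.1).trans_eq (measureReal_map_le H f)
    · exact (measureReal_isIsolatedCopy_and_le hH hfg).trans_eq (add_zero _).symm
  have hcard : (Fintype.card (U ↪ V) : ℝ) ≤ (Fintype.card V : ℝ) ^ Fintype.card U :=
    mod_cast card_embedding_le_pow
  have hrange (f : U ↪ V) : ((Finset.univ.filter fun g : U ↪ V =>
      Set.range g ⊆ Set.range f).card : ℝ) ≤ (Fintype.card U : ℝ) ^ Fintype.card U :=
    mod_cast card_filter_range_subset_le f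
  simp only [card_isIsolatedCopy_eq_eventCount]
  rw [integral_eventCount_sq fun _ => .of_discrete]
  calc _ ≤ ∑ f : U ↪ V, ∑ g : U ↪ V, (((p : ℝ) ^ H.edgeSet.ncard) ^ 2 +
        if Set.range g ⊆ Set.range f then (p : ℝ) ^ H.edgeSet.ncard else 0) :=
        Finset.sum_le_sum fun f _ => Finset.sum_le_sum fun g _ => hpair f g
    _ ≤ ∑ f : U ↪ V, (Fintype.card V ^ Fintype.card U * ((p : ℝ) ^ H.edgeSet.ncard) ^ 2 +
        Fintype.card U ^ Fintype.card U * (p : ℝ) ^ H.edgeSet.ncard) := by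
        refine Finset.sum_le_sum fun f _ => ?_
        rw [Finset.sum_add_distrib, ← Finset.sum_filter, Finset.sum_const, Finset.sum_const,
          nsmul_eq_mul, nsmul_eq_mul, Finset.card_univ]
        gcongr
        exact hrange f
    _ ≤ Fintype.card V ^ Fintype.card U * (Fintype.card V ^ Fintype.card U *
          ((p : ℝ) ^ H.edgeSet.ncard) ^ 2 +
        Fintype.card U ^ Fintype.card U * (p : ℝ) ^ H.edgeSet.ncard) := by
        rw [Finset.sum_const, nsmul_eq_mul, Finset.card_univ]
        gcongr
    _ = _ := by ring

end Copies

section Triangles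

open unitInterval
open scoped SimpleGraph

variable {p : I} [DecidableEq V]

/-- The pairs of distinct elements of `s`, that is, the edges of the complete graph on `s`. -/
def cliqueEdges (s : Finset V) : Finset (Sym2 V) :=
  s.offDiag.image Sym2.mk.uncurry

theorem mem_cliqueEdges {s : Finset V} {x y : V} :
    s(x, y) ∈ cliqueEdges s ↔ x ∈ s ∧ y ∈ s ∧ x ≠ y := by
  simp only [cliqueEdges, Finset.mem_image, Finset.mem_offDiag, Prod.exists, Function.uncurry,
    Sym2.eq_iff]
  grind

theorem card_cliqueEdges (s : Finset V) : (cliqueEdges s).card = s.card.choose 2 :=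
  Sym2.card_image_offDiag s

theorem cliqueEdges_inter (s t : Finset V) :
    cliqueEdges s ∩ cliqueEdges t = cliqueEdges (s ∩ t) := by
  ext ⟨x, y⟩
  simp only [Finset.mem_inter, mem_cliqueEdges]
  tauto

theorem isClique_iff_forall_mem_cliqueEdges {G : SimpleGraph V} {s : Finset V} :
    G.IsClique s ↔ ∀ e ∈ cliqueEdges s, e ∈ G.edgeSet := by
  simp only [Sym2.forall, mem_cliqueEdges, SimpleGraph.mem_edgeSet, SimpleGraph.IsClique,
    Set.Pairwise, Finset.mem_coe]
  grind

theorem measureReal_isClique_and_isClique [Finite V] (s t : Finset V) :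
    G(V, p).real {G | G.IsClique s ∧ G.IsClique t} =
      p ^ (s.card.choose 2 + t.card.choose 2 - (s ∩ t).card.choose 2) := by
  have hdiag (s : Finset V) (e) (he : e ∈ cliqueEdges s) : ¬ e.IsDiag := by
    obtain ⟨x, y⟩ := e
    simpa using (mem_cliqueEdges.1 he).2.2
  have hprob := measureReal_forall_mem_edgeSet_and_forall_notMem (p := p)
    (E := cliqueEdges s ∪ cliqueEdges t) (F := ∅)
    (fun e he => (Finset.mem_union.1 he).elim (hdiag s e) (hdiag t e)) (by simp) (by simp)
  rw [Finset.card_union, cliqueEdges_inter, card_cliqueEdges, card_cliqueEdges, card_cliqueEdges,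
    Finset.card_empty, pow_zero, mul_one] at hprob
  rw [← hprob]
  congr 1
  ext G
  simp [isClique_iff_forall_mem_cliqueEdges, or_imp, forall_and]

omit [DecidableEq V] in
theorem measureReal_isClique [Finite V] (s : Finset V) :
    G(V, p).real {G | G.IsClique s} = p ^ s.card.choose 2 := by
  classical
  simpa using measureReal_isClique_and_isClique (p := p) s s

variable [Fintype V]

/-- The number of cliques on `k` vertices in `G`, as a count of the events that given sets of `k`
vertices are cliques. -/
noncomputable def cliqueCount (k : ℕ) (G : SimpleGraph V) : ℝ :=
  eventCount (fun s : {s : Finset V // s.card = k} => {G : SimpleGraph V | G.IsClique s.1}) G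

omit [DecidableEq V] in
theorem cliqueCount_eq_zero {k : ℕ} {G : SimpleGraph V} (h : ∀ s, ¬ G.IsNClique k s) :
    cliqueCount k G = 0 :=
  eventCount_eq_zero_of_forall_notMem fun s hs => h s ⟨hs, s.2⟩

omit [DecidableEq V] in
theorem integral_cliqueCount (k : ℕ) :
    ∫ G, cliqueCount k G ∂G(V, p) = (Fintype.card V).choose k * (p : ℝ) ^ k.choose 2 := by
  classical
  simp only [cliqueCount]
  rw [integral_eventCount fun _ => .of_discrete,
    Finset.sum_congr rfl fun s _ => (measureReal_isClique s.1).trans (by rw [s.2]),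
    Finset.sum_const, Finset.card_univ, Fintype.card_finset_len, nsmul_eq_mul]

theorem card_filter_card_inter_eq_two_le {s : Finset V} (hs : s.card = 3) :
    (Finset.univ.filter fun t : {t : Finset V // t.card = 3} => (s ∩ t.1).card = 2).card ≤
      3 * Fintype.card V := by
  have himage : (Finset.univ.filter fun t : {t : Finset V // t.card = 3} =>
      (s ∩ t.1).card = 2).map (.subtype _) ⊆
        (s ×ˢ Finset.univ).image fun x => insert x.2 (s.erase x.1) := by
    intro t ht
    obtain ⟨⟨t, ht⟩, hmem, rfl⟩ := Finset.mem_map.1 ht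
    have hinter : (s ∩ t).card = 2 := (Finset.mem_filter.1 hmem).2
    have hst := Finset.card_sdiff_add_card_inter s t
    have hts := Finset.card_sdiff_add_card_inter t s
    rw [Finset.inter_comm] at hts
    obtain ⟨x, hx⟩ := Finset.card_eq_one.1 (show (s \ t).card = 1 by lia)
    obtain ⟨y, hy⟩ := Finset.card_eq_one.1 (show (t \ s).card = 1 by lia)
    simp only [Finset.ext_iff, Finset.mem_sdiff, Finset.mem_singleton] at hx hy
    refine Finset.mem_image.2 ⟨(x, y), by simpa using ((hx x).2 rfl).1, ?_⟩
    ext z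
    simp only [Finset.mem_insert, Finset.mem_erase, Function.Embedding.subtype_apply]
    grind
  have hprod : (s ×ˢ (Finset.univ : Finset V)).card = 3 * Fintype.card V := by
    rw [Finset.card_product, hs, Finset.card_univ]
  rw [← hprod, ← Finset.card_map (.subtype _)]
  exact (Finset.card_le_card himage).trans Finset.card_image_le

omit [Fintype V] in
theorem measureReal_isClique_and_isClique_le [Finite V] (s t : {s : Finset V // s.card = 3}) :
    G(V, p).real {G | G.IsClique s.1 ∧ G.IsClique t.1} ≤
      (p : ℝ) ^ 6 + (if (s.1 ∩ t.1).card = 2 then (p : ℝ) ^ 5 else 0) +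
        if t = s then (p : ℝ) ^ 3 else 0 := by
  have hp : (0 : ℝ) ≤ p := p.2.1
  have hprob := measureReal_isClique_and_isClique (p := p) s.1 t.1
  rw [s.2, t.2] at hprob
  refine hprob.trans_le ?_
  obtain rfl | hst := eq_or_ne t s
  · rw [Finset.inter_self, t.2, if_pos rfl]
    exact le_add_of_nonneg_left (by positivity)
  have hlt : (s.1 ∩ t.1).card < 3 := by
    by_contra! hcard
    have hs := Finset.eq_of_subset_of_card_le Finset.inter_subset_left (s.2.trans_le hcard)
    have ht := Finset.eq_of_subset_of_card_le Finset.inter_subset_right (t.2.trans_le hcard)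
    exact hst (Subtype.ext (ht.symm.trans hs))
  rw [if_neg hst, add_zero]
  generalize (s.1 ∩ t.1).card = k at hlt ⊢
  interval_cases k <;> simp [Nat.choose, hp]

omit [DecidableEq V] in
theorem integral_cliqueCount_three_sq_le :
    ∫ G, cliqueCount 3 G ^ 2 ∂G(V, p) ≤
      ((Fintype.card V).choose 3 * (p : ℝ) ^ 3) ^ 2 +
        (3 * Fintype.card V * (p : ℝ) ^ 2 + 1) * ((Fintype.card V).choose 3 * (p : ℝ) ^ 3) := by
  classical
  have hp : (0 : ℝ) ≤ p := p.2.1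
  simp only [cliqueCount]
  rw [integral_eventCount_sq fun _ => .of_discrete]
  calc _ ≤ ∑ s : {s : Finset V // s.card = 3}, ∑ t : {t : Finset V // t.card = 3},
          ((p : ℝ) ^ 6 + (if (s.1 ∩ t.1).card = 2 then (p : ℝ) ^ 5 else 0) +
            if t = s then (p : ℝ) ^ 3 else 0) :=
        Finset.sum_le_sum fun s _ =>
          Finset.sum_le_sum fun t _ => measureReal_isClique_and_isClique_le s t
    _ ≤ ∑ s : {s : Finset V // s.card = 3},
          ((Fintype.card V).choose 3 * (p : ℝ) ^ 6 + 3 * Fintype.card V * (p : ℝ) ^ 5 + p ^ 3) := by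
        refine Finset.sum_le_sum fun s _ => ?_
        rw [Finset.sum_add_distrib, Finset.sum_add_distrib, ← Finset.sum_filter, Finset.sum_const,
          Finset.sum_const, nsmul_eq_mul, nsmul_eq_mul, Finset.sum_ite_eq', Finset.card_univ,
          Fintype.card_finset_len, if_pos (Finset.mem_univ s)]
        gcongr
        exact_mod_cast card_filter_card_inter_eq_two_le s.2
    _ = _ := by
        rw [Finset.sum_const, Finset.card_univ, Fintype.card_finset_len, nsmul_eq_mul]
        ring

end Triangles

section Asymptotics

theorem natCast_pow_mul_rpow_pow {α : ℝ} (m e : ℕ) {n : ℕ} (hn : 0 < n) :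
    (n : ℝ) ^ m * ((n : ℝ) ^ (-α)) ^ e = (n : ℝ) ^ (m - α * e) := by
  have hn' : (0 : ℝ) < n := Nat.cast_pos.2 hn
  rw [← Real.rpow_natCast, ← Real.rpow_mul_natCast hn'.le, ← Real.rpow_add hn', neg_mul,
    ← sub_eq_add_neg]

theorem tendsto_natCast_pow_mul_rpow_pow_zero {α : ℝ} {m e : ℕ} (h : m < α * e) :
    Tendsto (fun n : ℕ => (n : ℝ) ^ m * ((n : ℝ) ^ (-α)) ^ e) atTop (𝓝 0) := by
  refine ((tendsto_rpow_neg_atTop (sub_pos.2 h)).comp tendsto_natCast_atTop_atTop).congr' ?_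
  filter_upwards [eventually_gt_atTop 0] with n hn
  rw [natCast_pow_mul_rpow_pow m e hn, Function.comp_apply, neg_sub]

theorem tendsto_natCast_pow_mul_rpow_pow_atTop {α : ℝ} {m e : ℕ} (h : α * e < m) :
    Tendsto (fun n : ℕ => (n : ℝ) ^ m * ((n : ℝ) ^ (-α)) ^ e) atTop atTop := by
  refine ((tendsto_rpow_atTop (sub_pos.2 h)).comp tendsto_natCast_atTop_atTop).congr' ?_
  filter_upwards [eventually_gt_atTop 0] with n hn
  rw [natCast_pow_mul_rpow_pow m e hn, Function.comp_apply]

theorem natCast_pow_mul_rpow_pow_eq_one {α : ℝ} {m e : ℕ} (h : α * e = m) {n : ℕ} (hn : 0 < n) :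
    (n : ℝ) ^ m * ((n : ℝ) ^ (-α)) ^ e = 1 := by
  rw [natCast_pow_mul_rpow_pow m e hn, h, sub_self, Real.rpow_zero]

theorem tendsto_descFactorial_div_pow (m : ℕ) :
    Tendsto (fun n : ℕ => (n.descFactorial m : ℝ) / (n : ℝ) ^ m) atTop (𝓝 1) :=
  (Asymptotics.isEquivalent_iff_tendsto_one ((eventually_ne_atTop 0).mono fun _ hn =>
    pow_ne_zero m (Nat.cast_ne_zero.2 hn))).1 (isEquivalent_descFactorial m)

theorem tendsto_choose_div_pow (k : ℕ) :
    Tendsto (fun n : ℕ => (n.choose k : ℝ) / (n : ℝ) ^ k) atTop (𝓝 (1 / k.factorial)) := by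
  refine ((tendsto_descFactorial_div_pow k).div_const (k.factorial : ℝ)).congr fun n => ?_
  rw [Nat.descFactorial_eq_factorial_mul_choose]
  push_cast
  field_simp

theorem tendsto_one_sub_rpow_pow {α : ℝ} (hα : 1 < α) (m : ℕ) :
    Tendsto (fun n : ℕ => (1 - (n : ℝ) ^ (-α)) ^ (m * n)) atTop (𝓝 1) := by
  have hp (n : ℕ) : (n : ℝ) ^ (-α) ∈ Set.Icc 0 1 :=
    (powEdgeProb α (zero_lt_one.trans hα) n).2
  have hzero : Tendsto (fun n : ℕ => (n : ℝ) * (n : ℝ) ^ (-α)) atTop (𝓝 0) := by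
    simpa using tendsto_natCast_pow_mul_rpow_pow_zero (α := α) (m := 1) (e := 1) (by simpa)
  have hlower : Tendsto (fun n : ℕ => 1 - m * ((n : ℝ) * (n : ℝ) ^ (-α))) atTop (𝓝 1) := by
    simpa using (hzero.const_mul (m : ℝ)).const_sub 1
  refine tendsto_of_tendsto_of_tendsto_of_le_of_le hlower tendsto_const_nhds (fun n => ?_)
    fun n => pow_le_one₀ (sub_nonneg.2 (hp n).2) (sub_le_self 1 (hp n).1)
  have hbernoulli := one_add_mul_le_pow (a := -(n : ℝ) ^ (-α)) (by linarith [(hp n).2]) (m * n)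
  rw [← sub_eq_add_neg] at hbernoulli
  refine le_trans (le_of_eq ?_) hbernoulli
  push_cast
  ring

end Asymptotics

section AlmostSurely

open scoped SimpleGraph

variable {p : ℕ → unitInterval} {A B : ∀ n, SimpleGraph (Fin n) → Prop}

/-- The property `A` holds asymptotically almost surely in `G(n, p n)`. -/
def AAS (p : ℕ → unitInterval) (A : ∀ n, SimpleGraph (Fin n) → Prop) : Prop :=
  Tendsto (fun n => G(Fin n, p n).real {G | ¬ A n G}) atTop (𝓝 0)

theorem AAS.of_le {b : ℕ → ℝ} (h : ∀ᶠ n in atTop, G(Fin n, p n).real {G | ¬ A n G} ≤ b n)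
    (hb : Tendsto b atTop (𝓝 0)) : AAS p A :=
  squeeze_zero' (.of_forall fun _ => measureReal_nonneg) h hb

theorem AAS.mono (h : AAS p A) (hAB : ∀ᶠ n in atTop, ∀ G, A n G → B n G) : AAS p B :=
  .of_le (hAB.mono fun n hn => measureReal_mono fun G => mt (hn G)) h

theorem AAS.forall_mem {J : Type*} {s : Finset J} {C : J → ∀ n, SimpleGraph (Fin n) → Prop}
    (h : ∀ j ∈ s, AAS p (C j)) : AAS p fun n G => ∀ j ∈ s, C j n G := by
  refine .of_le (b := fun n => ∑ j ∈ s, G(Fin n, p n).real {G | ¬ C j n G}) (.of_forall fun n => ?_)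
    (by simpa using tendsto_finsetSum s h)
  have hunion : {G : SimpleGraph (Fin n) | ¬ ∀ j ∈ s, C j n G} = ⋃ j ∈ s, {G | ¬ C j n G} := by
    ext
    simp
  exact hunion ▸ measureReal_biUnion_finset_le _ _

theorem AAS.forall {J : Type*} [Finite J] {C : J → ∀ n, SimpleGraph (Fin n) → Prop}
    (h : ∀ j, AAS p (C j)) : AAS p fun n G => ∀ j, C j n G := by
  have := Fintype.ofFinite J
  simpa using AAS.forall_mem (s := Finset.univ) fun j _ => h j

theorem AAS.and (hA : AAS p A) (hB : AAS p B) : AAS p fun n G => A n G ∧ B n G := by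
  simpa using AAS.forall (C := fun b : Bool => bif b then B else A)
    (Bool.forall_bool.2 ⟨hA, hB⟩)

theorem AAS.imp {P : Prop} (h : P → AAS p A) : AAS p fun n G => P → A n G := by
  by_cases hP : P
  · simpa [hP] using h hP
  · simp [hP, AAS]

theorem AAS.tendsto_one (h : AAS p A) :
    Tendsto (fun n => G(Fin n, p n).real {G | A n G}) atTop (𝓝 1) := by
  have hcompl (n : ℕ) : G(Fin n, p n).real {G | A n G} = 1 - G(Fin n, p n).real {G | ¬ A n G} := by
    rw [probReal_not .of_discrete, sub_sub_cancel]
  simpa [hcompl] using h.const_sub 1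

theorem obeysFOZeroOneLaw_of_aas (hA : AAS p A)
    (h : ∀ n m G H, A n G → A m H → graphType G ⊆ graphType H) : ObeysFOZeroOneLaw p 3 := by
  intro φ hφ
  by_cases hex : ∃ n G, A n G ∧ G.SatisfiesFO φ
  · obtain ⟨m, H, hH, hHφ⟩ := hex
    exact .inl (hA.mono (B := fun n G => G.SatisfiesFO φ) (.of_forall fun n G hG =>
      (satisfiesFO_iff_of_graphType_eq
        ((h _ _ _ _ hG hH).antisymm (h _ _ _ _ hH hG)) hφ).2 hHφ)).tendsto_one
  · have hnot := hA.mono (B := fun n G => ¬ G.SatisfiesFO φ)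
      (.of_forall fun n G hG hGφ => hex ⟨n, G, hG, hGφ⟩)
    exact .inr (by simpa only [AAS, not_not, probSatisfiesFO] using hnot)

theorem not_obeysFOZeroOneLaw_of_bounds {k : ℕ} {φ : Language.graph.Sentence}
    (hφ : φ.quantifierDepth ≤ k) {b c : ℝ} (hb : 0 < b) (hc : c < 1)
    (hlower : ∀ᶠ n in atTop, b ≤ probSatisfiesFO n (p n) φ)
    (hupper : ∀ᶠ n in atTop, probSatisfiesFO n (p n) φ ≤ c) : ¬ ObeysFOZeroOneLaw p k := fun h =>
  (h φ hφ).elim (fun h => (le_of_tendsto h hupper).not_gt hc) fun h =>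
    (ge_of_tendsto h hlower).not_gt hb

theorem aas_abs_sub_integral_lt {X : ∀ n, SimpleGraph (Fin n) → ℝ} {b : ℕ → ℝ}
    (hpos : ∀ᶠ n in atTop, 0 < ∫ G, X n G ∂G(Fin n, p n))
    (hsq : ∀ᶠ n in atTop,
      ∫ G, X n G ^ 2 ∂G(Fin n, p n) ≤ b n * (∫ G, X n G ∂G(Fin n, p n)) ^ 2)
    (hb : Tendsto b atTop (𝓝 1)) :
    AAS p fun n G => |X n G - ∫ G, X n G ∂G(Fin n, p n)| < (∫ G, X n G ∂G(Fin n, p n)) / 2 := by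
  refine .of_le (b := fun n => 4 * (b n - 1)) ?_ (by simpa using (hb.sub_const 1).const_mul 4)
  filter_upwards [hpos, hsq] with n hposn hsqn
  simp only [not_lt]
  refine (measureReal_half_integral_le_abs_sub_le .of_discrete hposn).trans ?_
  gcongr
  exact (div_le_iff₀ (pow_pos hposn 2)).2 hsqn

end AlmostSurely

section SparseCopies

open scoped SimpleGraph

variable {α : ℝ} {m : ℕ} {H : SimpleGraph (Fin m)}

theorem aas_not_isContained (hα : 0 < α) (h : m < α * H.edgeSet.ncard) :
    AAS (powEdgeProb α hα) fun _ G => ¬ H ⊑ G := by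
  refine .of_le (.of_forall fun n => ?_) (tendsto_natCast_pow_mul_rpow_pow_zero h)
  simpa [powEdgeProb] using measureReal_isContained_le (V := Fin n) (p := powEdgeProb α hα n) H

/-- The part of the expected number of isolated copies of a graph on `m` vertices in
`G(n, n ^ (-α))` which is due to the injectivity and the isolation of the copies. -/
noncomputable def isolationFactor (α : ℝ) (m n : ℕ) : ℝ :=
  n.descFactorial m / (n : ℝ) ^ m * (1 - (n : ℝ) ^ (-α)) ^ (m * n)

theorem tendsto_isolationFactor (hα : 1 < α) (m : ℕ) :
    Tendsto (isolationFactor α m) atTop (𝓝 1) := by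
  rw [← mul_one (1 : ℝ)]
  exact (tendsto_descFactorial_div_pow m).mul (tendsto_one_sub_rpow_pow hα m)

theorem isolationFactor_mul_le_integral_card_isIsolatedCopy (hα : 0 < α) (H : SimpleGraph (Fin m))
    {n : ℕ} (hn : 0 < n) :
    isolationFactor α m n * ((n : ℝ) ^ m * ((n : ℝ) ^ (-α)) ^ H.edgeSet.ncard) ≤
      ∫ G, (Nat.card {f : Fin m ↪ Fin n // IsIsolatedCopy H f G} : ℝ)
        ∂G(Fin n, powEdgeProb α hα n) := by
  have hn' : (n : ℝ) ^ m ≠ 0 := by positivity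
  refine le_of_eq_of_le ?_ (descFactorial_mul_le_integral_card_isIsolatedCopy H)
  simp only [isolationFactor, powEdgeProb, Fintype.card_fin]
  field_simp

theorem aas_lt_card_isIsolatedCopy (hα : 1 < α) (hH : H.Preconnected)
    (h : α * H.edgeSet.ncard < m) (k : ℕ) :
    AAS (powEdgeProb α (zero_lt_one.trans hα)) fun n G =>
      k < Nat.card {f : Fin m ↪ Fin n // IsIsolatedCopy H f G} := by
  set r := isolationFactor α m
  set M : ℕ → ℝ := fun n => (n : ℝ) ^ m * ((n : ℝ) ^ (-α)) ^ H.edgeSet.ncard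
  have hM : Tendsto M atTop atTop := tendsto_natCast_pow_mul_rpow_pow_atTop h
  have hr : Tendsto r atTop (𝓝 1) := tendsto_isolationFactor hα m
  have hrM : Tendsto (fun n => r n * M n) atTop atTop := hr.pos_mul_atTop one_pos hM
  have hmean {n : ℕ} (hn : 0 < n) :=
    isolationFactor_mul_le_integral_card_isIsolatedCopy (zero_lt_one.trans hα) H hn
  have hb : Tendsto (fun n => (1 + (m : ℝ) ^ m / M n) / r n ^ 2) atTop (𝓝 1) := by
    simpa [Pi.div_def] using
      ((hM.const_div_atTop ((m : ℝ) ^ m)).const_add 1).div (hr.pow 2) (by simp)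
  have hconc := aas_abs_sub_integral_lt (p := powEdgeProb α (zero_lt_one.trans hα))
    (X := fun n G => (Nat.card {f : Fin m ↪ Fin n // IsIsolatedCopy H f G} : ℝ)) ?_ ?_ hb
  · refine hconc.mono ?_
    filter_upwards [eventually_gt_atTop 0, hrM.eventually_gt_atTop (2 * k : ℝ)] with n hn hk G hG
    have hcount := hk.trans_le (hmean hn)
    exact_mod_cast (by linarith [(abs_lt.1 hG).1] :
      (k : ℝ) < Nat.card {f : Fin m ↪ Fin n // IsIsolatedCopy H f G})
  · filter_upwards [eventually_gt_atTop 0, hrM.eventually_gt_atTop 0] with n hn hpos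
    exact hpos.trans_le (hmean hn)
  · filter_upwards [eventually_gt_atTop 0, hM.eventually_gt_atTop 0,
      hr.eventually_const_lt one_pos] with n hn hMpos hrpos
    refine (integral_card_isIsolatedCopy_sq_le hH).trans ?_
    calc _ = (1 + (m : ℝ) ^ m / M n) / r n ^ 2 * (r n * M n) ^ 2 := by
          simp only [M, powEdgeProb, Fintype.card_fin] at hMpos ⊢
          field_simp
      _ ≤ _ := by
          gcongr
          exact hmean hn

theorem exists_eventually_le_measureReal_isIsolatedCopy (hα : 1 < α) (hH : H.Preconnected)
    (h : α * H.edgeSet.ncard = m) : ∃ c > 0, ∀ᶠ n in atTop,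
      c ≤ G(Fin n, powEdgeProb α (zero_lt_one.trans hα) n).real
        {G | ∃ f, IsIsolatedCopy H f G} := by
  have hr := (tendsto_isolationFactor hα m).eventually_const_lt (by norm_num : (1 / 2 : ℝ) < 1)
  refine ⟨1 / 4 / (1 + (m : ℝ) ^ m), by positivity, ?_⟩
  filter_upwards [hr, eventually_gt_atTop 0] with n hrn hn
  have hM := natCast_pow_mul_rpow_pow_eq_one h hn
  have hmean := isolationFactor_mul_le_integral_card_isIsolatedCopy (zero_lt_one.trans hα) H hn
  have hsq := integral_card_isIsolatedCopy_sq_le (V := Fin n)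
    (p := powEdgeProb α (zero_lt_one.trans hα) n) hH
  simp only [powEdgeProb, Fintype.card_fin] at hsq
  rw [hM] at hmean hsq
  have hmoment := sq_integral_le_measureReal_mul_integral_sq
    (μ := G(Fin n, powEdgeProb α (zero_lt_one.trans hα) n)) (A := {G | ∃ f, IsIsolatedCopy H f G})
    (X := fun G => (Nat.card {f : Fin m ↪ Fin n // IsIsolatedCopy H f G} : ℝ))
    .of_discrete .of_discrete fun G hG => by
      have : IsEmpty {f : Fin m ↪ Fin n // IsIsolatedCopy H f G} := ⟨fun f => hG ⟨f.1, f.2⟩⟩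
      simp
  rw [div_le_iff₀ (by positivity)]
  calc (1 / 4 : ℝ) = (1 / 2) ^ 2 := by norm_num
    _ ≤ _ := pow_le_pow_left₀ (by norm_num) (hrn.le.trans (by simpa using hmean)) 2
    _ ≤ _ := hmoment
    _ ≤ _ := by
      gcongr
      simpa [powEdgeProb] using hsq

end SparseCopies

section Girth

open scoped SimpleGraph

variable {G : SimpleGraph V} {x y z : V}

theorem notMem_support_of_egirth {w : G.Walk x z} {k : ℕ} (hG : (k + 2 : ℕ) ≤ G.egirth)
    (hw : w.IsPath) (hlen : w.length ≤ k) (h : G.Adj y x) (hy : y ≠ w.snd) : y ∉ w.support := by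
  classical
  intro hmem
  have hedge : s(y, x) ∉ (w.takeUntil y hmem).edges := fun he =>
    hy (hw.eq_snd_of_mem_edges (Sym2.eq_swap ▸ w.edges_takeUntil_subset_edges hmem he))
  have hcycle := hG.trans (SimpleGraph.egirth_le_length
    ((SimpleGraph.Walk.cons_isCycle_iff _ h).2 ⟨hw.takeUntil hmem, hedge⟩))
  rw [SimpleGraph.Walk.length_cons, Nat.cast_le] at hcycle
  have := w.length_takeUntil_le_length hmem
  lia

/-- Some path of length `k` in `G` has `s(x, y)` as its first edge. -/
def StartsPath (G : SimpleGraph V) (k : ℕ) (x y : V) : Prop :=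
  ∃ z, ∃ w : G.Walk x z, w.IsPath ∧ w.length = k ∧ w.snd = y

theorem startsPath_one (h : G.Adj x y) : StartsPath G 1 x y :=
  ⟨y, h.toWalk, SimpleGraph.Walk.IsPath.of_adj h, rfl, rfl⟩

theorem StartsPath.cons {k : ℕ} (hG : (k + 2 : ℕ) ≤ G.egirth) (h : StartsPath G k x y)
    (hzx : G.Adj z x) (hzy : z ≠ y) : StartsPath G (k + 1) z x := by
  obtain ⟨v, w, hw, rfl, rfl⟩ := h
  exact ⟨v, w.cons hzx, hw.cons (notMem_support_of_egirth hG hw le_rfl hzx hzy), rfl, by simp⟩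

theorem StartsPath.isContained {k : ℕ} (h : StartsPath G k x y) :
    SimpleGraph.pathGraph (k + 1) ⊑ G := by
  obtain ⟨v, w, hw, rfl, -⟩ := h
  exact hw.isContained_pathGraph

theorem not_adj_of_adj_of_adj (hG : 4 ≤ G.egirth) (hxy : G.Adj x y) (hyz : G.Adj y z) :
    ¬ G.Adj x z := by
  intro hxz
  have hw : (hyz.toWalk.cons hxy).IsPath := by simp [hxy.ne, hyz.ne, hxz.ne]
  exact notMem_support_of_egirth (k := 2) hG hw le_rfl hxz.symm (by simpa using hyz.ne') (by simp)

theorem eq_of_adj_of_adj (hG : 5 ≤ G.egirth) (hxz : x ≠ z) {y' : V} (hxy : G.Adj x y)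
    (hyz : G.Adj y z) (hxy' : G.Adj x y') (hyz' : G.Adj y' z) : y = y' := by
  by_contra hyy'
  have hw : ((hyz.toWalk.cons hxy).cons hxy'.symm).IsPath := by
    simp [hxy.ne, hyz.ne, hxz, hxy'.ne', Ne.symm hyy', hyz'.ne]
  exact notMem_support_of_egirth (k := 3) hG hw le_rfl hyz'.symm (by simpa using hxz.symm) (by simp)

end Girth

section LocalTypes

variable {G : SimpleGraph V} {H : SimpleGraph W} {x y z : V}

/-- The vertex `x` has a neighbour of degree at least two. -/
def HasInnerNbr (G : SimpleGraph V) (x : V) : Prop := ∃ y, G.Adj x y ∧ HasPrivateNbr G y x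

/-- The vertex `x` has a neighbour which has no further neighbours (in a triangle-free graph). -/
def HasLeafNbr (G : SimpleGraph V) (x : V) : Prop := ∃ y, G.Adj x y ∧ ¬ HasPrivateNbr G y x

/-- A vertex at distance two from `x` has degree at least two. -/
def HasInnerSecondNbr (G : SimpleGraph V) (x : V) : Prop :=
  ∃ y, y ≠ x ∧ ¬ G.Adj x y ∧ HasCommonNbr G x y ∧ HasPrivateNbr G y x

/-- A vertex at distance two from `x` has no neighbours which are not neighbours of `x`. -/
def HasLeafSecondNbr (G : SimpleGraph V) (x : V) : Prop :=
  ∃ y, y ≠ x ∧ ¬ G.Adj x y ∧ HasCommonNbr G x y ∧ ¬ HasPrivateNbr G y x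

/-- The vertex `x` has degree at least two. -/
def HasTwoNbrs (G : SimpleGraph V) (x : V) : Prop := ∃ y z, y ≠ z ∧ G.Adj x y ∧ G.Adj x z

/-- The properties of the neighbourhood of radius three of `x` which determine the type of `x` in
a sparse graph. -/
def localType (G : SimpleGraph V) (x : V) : Prop × Prop × Prop × Prop × Prop :=
  (HasInnerNbr G x, HasLeafNbr G x, HasInnerSecondNbr G x, HasLeafSecondNbr G x, HasTwoNbrs G x)

section Decidable

variable [Fintype V] [DecidableEq V] [DecidableRel G.Adj]

instance : Decidable (HasCommonNbr G x y) := inferInstanceAs (Decidable (∃ _, _))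

instance : Decidable (HasPrivateNbr G x y) := inferInstanceAs (Decidable (∃ _, _))

instance : Decidable (HasInnerNbr G x) := inferInstanceAs (Decidable (∃ _, _))

instance : Decidable (HasLeafNbr G x) := inferInstanceAs (Decidable (∃ _, _))

instance : Decidable (HasInnerSecondNbr G x) := inferInstanceAs (Decidable (∃ _, _))

instance : Decidable (HasLeafSecondNbr G x) := inferInstanceAs (Decidable (∃ _, _))

instance : Decidable (HasTwoNbrs G x) := inferInstanceAs (Decidable (∃ _, _))

end Decidable

theorem hasInnerNbr_iff :
    HasInnerNbr G x ↔ HasInnerSecondNbr G x ∨ HasLeafSecondNbr G x := by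
  constructor
  · rintro ⟨y, hxy, z, hyz, hxz, hzx⟩
    by_cases hz : HasPrivateNbr G z x
    · exact .inl ⟨z, hzx, hxz, ⟨y, hxy, hyz.symm⟩, hz⟩
    · exact .inr ⟨z, hzx, hxz, ⟨y, hxy, hyz.symm⟩, hz⟩
  · rintro (⟨z, hzx, hxz, ⟨y, hxy, hzy⟩, -⟩ | ⟨z, hzx, hxz, ⟨y, hxy, hzy⟩, -⟩) <;>
      exact ⟨y, hxy, z, hzy.symm, hxz, hzx⟩

theorem exists_adj_iff : (∃ y, G.Adj x y) ↔ HasInnerNbr G x ∨ HasLeafNbr G x := by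
  simp only [HasInnerNbr, HasLeafNbr, ← exists_or, ← and_or_left, em, and_true]

theorem HasInnerNbr.hasTwoNbrs (h : HasInnerNbr G x) (h' : HasLeafNbr G x) : HasTwoNbrs G x := by
  obtain ⟨y, hxy, hy⟩ := h
  obtain ⟨z, hxz, hz⟩ := h'
  exact ⟨y, z, fun hyz => hz (hyz ▸ hy), hxy, hxz⟩

theorem HasTwoNbrs.exists_adj (h : HasTwoNbrs G x) : ∃ y, G.Adj x y :=
  h.imp fun _ ⟨_, _, hy, _⟩ => hy

theorem HasTwoNbrs.exists_adj_ne (h : HasTwoNbrs G x) (y : V) : ∃ z, G.Adj x z ∧ z ≠ y := by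
  obtain ⟨u, v, huv, hu, hv⟩ := h
  by_cases huy : u = y
  · exact ⟨v, hv, huy ▸ huv.symm⟩
  · exact ⟨u, hu, huy⟩

theorem hasPrivateNbr_iff (hG : 4 ≤ G.egirth) (hxy : G.Adj x y) :
    HasPrivateNbr G x y ↔ HasTwoNbrs G x :=
  ⟨fun ⟨z, hxz, _, hzy⟩ => ⟨z, y, hzy, hxz, hxy⟩, fun h =>
    let ⟨z, hxz, hzy⟩ := h.exists_adj_ne y
    ⟨z, hxz, not_adj_of_adj_of_adj hG hxy.symm hxz, hzy⟩⟩

end LocalTypes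

section ParentGraphs

open scoped SimpleGraph

variable {m : ℕ} {π : Fin m → Fin (m + 1)}

/-- The graph on `Fin (m + 1)` in which `i + 1` is joined to its parent `π i`, for all `i < m`. It
is a tree rooted at `0` if parents precede their children. -/
def parentGraph (π : Fin m → Fin (m + 1)) : SimpleGraph (Fin (m + 1)) :=
  .fromRel fun a b => ∃ i : Fin m, a = i.succ ∧ b = π i

instance : DecidableRel (parentGraph π).Adj := fun _ _ =>
  decidable_of_iff _ (SimpleGraph.fromRel_adj _ _ _).symm

theorem edgeSet_parentGraph_subset :
    (parentGraph π).edgeSet ⊆ Set.range fun i => s(i.succ, π i) := by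
  intro e
  induction e with | _ a b
  rintro ⟨-, ⟨i, rfl, rfl⟩ | ⟨i, rfl, rfl⟩⟩
  exacts [⟨i, rfl⟩, ⟨i, Sym2.eq_swap⟩]

theorem parentGraph_preconnected (hπ : ∀ i, π i ≤ i.castSucc) :
    (parentGraph π).Preconnected := by
  have hreach (a : Fin (m + 1)) : (parentGraph π).Reachable 0 a := by
    induction a using WellFoundedLT.induction with | ind a ih
    obtain rfl | ⟨i, rfl⟩ := a.eq_zero_or_eq_succ
    · rfl
    have hlt : π i < i.succ := (hπ i).trans_lt i.castSucc_lt_succ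
    have hadj : (parentGraph π).Adj (π i) i.succ :=
      (SimpleGraph.fromRel_adj ..).2 ⟨hlt.ne, .inr ⟨i, rfl, rfl⟩⟩
    exact (ih _ hlt).trans hadj.reachable
  exact fun a b => (hreach a).symm.trans (hreach b)

theorem ncard_edgeSet_parentGraph (hπ : ∀ i, π i ≤ i.castSucc) :
    (parentGraph π).edgeSet.ncard = m := by
  refine le_antisymm ?_ ?_
  · refine (Set.ncard_le_ncard edgeSet_parentGraph_subset).trans ?_
    rw [← Set.image_univ]
    simpa using Set.ncard_image_le (s := Set.univ) (f := fun i => s(i.succ, π i))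
  · have := SimpleGraph.Connected.card_vert_le_card_edgeSet_add_one
      ⟨parentGraph_preconnected hπ⟩
    simpa only [Nat.card_fin, Nat.card_coe_set_eq, add_le_add_iff_right] using this

theorem pathGraph_eq_parentGraph (m : ℕ) :
    SimpleGraph.pathGraph (m + 1) = parentGraph (Fin.castSucc : Fin m → Fin (m + 1)) := by
  ext a b
  rw [SimpleGraph.pathGraph_adj, parentGraph, SimpleGraph.fromRel_adj]
  constructor
  · rintro (h | h)
    · refine ⟨by lia, .inr ⟨⟨a, by lia⟩, by ext; simp [h], rfl⟩⟩
    · refine ⟨by lia, .inl ⟨⟨b, by lia⟩, by ext; simp [h], rfl⟩⟩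
  · rintro ⟨-, ⟨i, rfl, rfl⟩ | ⟨i, rfl, rfl⟩⟩ <;> simp

theorem ncard_edgeSet_pathGraph (m : ℕ) : (SimpleGraph.pathGraph (m + 1)).edgeSet.ncard = m := by
  rw [pathGraph_eq_parentGraph, ncard_edgeSet_parentGraph fun _ => le_rfl]

end ParentGraphs

section IsolatedCopies

variable {U : Type*} {T : SimpleGraph U} {G : SimpleGraph V} {f : U ↪ V}

theorem IsIsolatedCopy.adj_iff (hf : IsIsolatedCopy T f G) {i : U} {v : V} :
    G.Adj (f i) v ↔ ∃ j, T.Adj i j ∧ f j = v := by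
  refine ⟨hf.2 i v, ?_⟩
  rintro ⟨j, hij, rfl⟩
  exact hf.1 ((SimpleGraph.map_adj_apply).2 hij)

theorem IsIsolatedCopy.exists_adj_and_iff (hf : IsIsolatedCopy T f G) {i : U} {P : V → Prop} :
    (∃ v, G.Adj (f i) v ∧ P v) ↔ ∃ j, T.Adj i j ∧ P (f j) := by
  simp only [hf.adj_iff]
  exact ⟨fun ⟨_, ⟨j, hij, hj⟩, hP⟩ => ⟨j, hij, hj ▸ hP⟩, fun ⟨j, hij, hP⟩ => ⟨_, ⟨j, hij, rfl⟩, hP⟩⟩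

theorem IsIsolatedCopy.adj_apply_iff (hf : IsIsolatedCopy T f G) {i j : U} :
    G.Adj (f i) (f j) ↔ T.Adj i j := by
  simp [hf.adj_iff]

theorem IsIsolatedCopy.not_adj_of_notMem_range (hf : IsIsolatedCopy T f G) {v : V}
    (hv : v ∉ Set.range f) (i : U) : ¬ G.Adj v (f i) := fun h =>
  let ⟨j, _, hj⟩ := hf.2 i v h.symm
  hv ⟨j, hj⟩

theorem IsIsolatedCopy.not_hasCommonNbr_of_notMem_range (hf : IsIsolatedCopy T f G) {v : V}
    (hv : v ∉ Set.range f) (i : U) : ¬ HasCommonNbr G v (f i) := by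
  rintro ⟨w, hvw, hw⟩
  obtain ⟨j, -, rfl⟩ := hf.2 i w hw
  exact hf.not_adj_of_notMem_range hv j hvw

theorem IsIsolatedCopy.hasPrivateNbr_iff (hf : IsIsolatedCopy T f G) {i j : U} :
    HasPrivateNbr G (f i) (f j) ↔ HasPrivateNbr T i j := by
  simp only [HasPrivateNbr, hf.exists_adj_and_iff, hf.adj_apply_iff, ne_eq, f.apply_eq_iff_eq]

theorem exists_hasCommonNbr_and_iff {x : V} {P : V → Prop} :
    (∃ y, y ≠ x ∧ ¬ G.Adj x y ∧ HasCommonNbr G x y ∧ P y) ↔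
      ∃ w, G.Adj x w ∧ ∃ y, G.Adj w y ∧ y ≠ x ∧ ¬ G.Adj x y ∧ P y :=
  ⟨fun ⟨y, hyx, hxy, ⟨w, hxw, hyw⟩, hy⟩ => ⟨w, hxw, y, hyw.symm, hyx, hxy, hy⟩,
    fun ⟨w, hxw, y, hwy, hyx, hxy, hy⟩ => ⟨y, hyx, hxy, ⟨w, hxw, hwy.symm⟩, hy⟩⟩

theorem hasTwoNbrs_iff {x : V} :
    HasTwoNbrs G x ↔ ∃ y, G.Adj x y ∧ ∃ z, G.Adj x z ∧ y ≠ z :=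
  ⟨fun ⟨y, z, hyz, hy, hz⟩ => ⟨y, hy, z, hz, hyz⟩, fun ⟨y, hy, z, hz, hyz⟩ => ⟨y, z, hyz, hy, hz⟩⟩

theorem IsIsolatedCopy.localType_eq (hf : IsIsolatedCopy T f G) (i : U) :
    localType G (f i) = localType T i := by
  simp only [localType, HasInnerNbr, HasLeafNbr, HasInnerSecondNbr, HasLeafSecondNbr,
    hasTwoNbrs_iff, exists_hasCommonNbr_and_iff, hf.exists_adj_and_iff, hf.adj_apply_iff,
    hf.hasPrivateNbr_iff, ne_eq, f.apply_eq_iff_eq]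

end IsolatedCopies

section SparseTypical

open scoped SimpleGraph

variable {α : ℝ} {G : SimpleGraph V} {H : SimpleGraph W} {x y : V}

/-- The graph `G` behaves as the random graph `G(n, n ^ (-α))` is expected to for `α > 1`, as far
as subgraphs on at most seven vertices are concerned: those which are too dense do not occur, and
the connected ones which are not dense enough to be excluded or to be at a threshold occur as
isolated copies away from any two given vertices. -/
structure SparseTypical (α : ℝ) (G : SimpleGraph V) : Prop where
  not_isContained : ∀ k ≤ 7, ∀ T : SimpleGraph (Fin k), k < α * T.edgeSet.ncard → ¬ T ⊑ G
  exists_isIsolatedCopy : ∀ k ≤ 7, ∀ T : SimpleGraph (Fin k), T.Preconnected →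
    α * T.edgeSet.ncard < k → ∀ s : Finset V, s.card ≤ 2 →
      ∃ f, IsIsolatedCopy T f G ∧ ∀ x ∈ s, x ∉ Set.range f

theorem aas_sparseTypical (hα : 1 < α) :
    AAS (powEdgeProb α (zero_lt_one.trans hα)) fun _ G => SparseTypical α G := by
  have hdense : AAS (powEdgeProb α (zero_lt_one.trans hα)) fun n G =>
      ∀ k ∈ Finset.Iic 7, ∀ T : SimpleGraph (Fin k), k < α * T.edgeSet.ncard → ¬ T ⊑ G :=
    .forall_mem fun k _ => .forall fun T => .imp fun h => aas_not_isContained _ h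
  have hsparse : AAS (powEdgeProb α (zero_lt_one.trans hα)) fun n G =>
      ∀ k ∈ Finset.Iic 7, ∀ T : SimpleGraph (Fin k), T.Preconnected →
        α * T.edgeSet.ncard < k →
          2 * k ^ k < Nat.card {f : Fin k ↪ Fin n // IsIsolatedCopy T f G} :=
    .forall_mem fun k _ => .forall fun T => .imp fun hT => .imp fun h =>
      aas_lt_card_isIsolatedCopy hα hT h _
  refine (hdense.and hsparse).mono (.of_forall fun n G ⟨hG, hG'⟩ =>
    ⟨fun k hk => hG k (Finset.mem_Iic.2 hk), fun k hk T hT h s hs => ?_⟩)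
  have hcard := (Nat.mul_le_mul_right (k ^ k) hs).trans_lt (hG' k (Finset.mem_Iic.2 hk) T hT h)
  exact IsIsolatedCopy.exists_forall_notMem_range hT s (by simpa only [Fintype.card_fin])

theorem ncard_edgeSet_cycleGraph (n : ℕ) :
    (SimpleGraph.cycleGraph (n + 3)).edgeSet.ncard = n + 3 := by
  have h := (SimpleGraph.cycleGraph (n + 3)).sum_degrees_eq_twice_card_edges
  rw [Finset.sum_congr rfl fun v _ => SimpleGraph.cycleGraph_degree_three_le] at h
  rw [Finset.sum_const, Finset.card_univ, Fintype.card_fin, smul_eq_mul] at h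
  rw [Set.ncard_eq_toFinset_card']
  change (SimpleGraph.cycleGraph (n + 3)).edgeFinset.card = n + 3
  lia

theorem SparseTypical.le_egirth (hG : SparseTypical α G) (hα : 1 < α) : 8 ≤ G.egirth := by
  refine SimpleGraph.le_egirth.2 fun v w hw => ?_
  by_contra! hlen
  have hlen : w.length ≤ 7 := by exact Order.lt_add_one_iff.1 (by exact_mod_cast hlen)
  obtain ⟨k, hk⟩ := Nat.exists_eq_add_of_le' hw.three_le_length
  refine hG.not_isContained _ (hk ▸ hlen) (SimpleGraph.cycleGraph (k + 3)) ?_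
    ((SimpleGraph.cycleGraph_isContained_iff (by lia)).2 ⟨v, w, hw, hk⟩)
  rw [ncard_edgeSet_cycleGraph]
  exact lt_mul_of_one_lt_left (by positivity) hα

theorem SparseTypical.exists_isolated (hG : SparseTypical α G) (x y : V) :
    ∃ z, z ≠ x ∧ z ≠ y ∧ ∀ v, ¬ G.Adj z v := by
  classical
  obtain ⟨f, hf, hxy⟩ := hG.exists_isIsolatedCopy 1 (by norm_num) ⊥
    (SimpleGraph.Preconnected.of_subsingleton) (by simp) {x, y} Finset.card_le_two
  exact ⟨f 0, fun h => hxy x (by simp) ⟨0, h⟩, fun h => hxy y (by simp) ⟨0, h⟩,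
    by simp [hf.adj_iff]⟩

theorem SparseTypical.hasCommonNonNbr (hG : SparseTypical α G) (x y : V) :
    HasCommonNonNbr G x y :=
  let ⟨z, hzx, hzy, hz⟩ := hG.exists_isolated x y
  ⟨z, fun h => hz x h.symm, fun h => hz y h.symm, hzx, hzy⟩

theorem SparseTypical.exists_far_of_adj (hG : SparseTypical α G) (hα : α < 2) (x : V) :
    ∃ y, y ≠ x ∧ ¬ G.Adj x y ∧ ¬ HasCommonNbr G x y ∧ ∃ z, G.Adj y z := by
  obtain ⟨f, hf, hx⟩ := hG.exists_isIsolatedCopy 2 (by norm_num) (SimpleGraph.pathGraph 2)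
    (SimpleGraph.pathGraph_preconnected 2) (by simpa [ncard_edgeSet_pathGraph 1]) {x} (by simp)
  replace hx := hx x (by simp)
  exact ⟨f 0, fun h => hx ⟨0, h⟩, hf.not_adj_of_notMem_range hx 0,
    hf.not_hasCommonNbr_of_notMem_range hx 0, f 1,
    hf.adj_apply_iff.2 (by simp [SimpleGraph.pathGraph_two_eq_top])⟩

theorem SparseTypical.exists_far_of_not_adj (hG : SparseTypical α G) (x : V) :
    ∃ y, y ≠ x ∧ ¬ G.Adj x y ∧ ¬ HasCommonNbr G x y ∧ ¬ ∃ z, G.Adj y z := by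
  obtain ⟨y, hyx, -, hy⟩ := hG.exists_isolated x x
  exact ⟨y, hyx, fun h => hy x h.symm, fun ⟨z, _, hz⟩ => hy z hz, fun ⟨z, hz⟩ => hy z hz⟩

theorem SparseTypical.le_two_of_adj (hG : SparseTypical α G) (h : G.Adj x y) : α ≤ 2 := by
  by_contra! hα
  exact hG.not_isContained 2 (by norm_num) (SimpleGraph.pathGraph 2)
    (by simpa [ncard_edgeSet_pathGraph 1]) (startsPath_one h).isContained

theorem SparseTypical.pairType_of_adj (hG : SparseTypical α G) (hα : 1 < α) (h : G.Adj x y) :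
    pairType G x y = (True, False, HasTwoNbrs G x, HasPrivateNbr G y x, True) := by
  have hgirth : 4 ≤ G.egirth := le_trans (by norm_num) (hG.le_egirth hα)
  have hcommon : ¬ HasCommonNbr G x y := fun ⟨z, hxz, hyz⟩ =>
    not_adj_of_adj_of_adj hgirth h hyz hxz
  simp [pairType, h, hcommon, hasPrivateNbr_iff hgirth h, hG.hasCommonNonNbr]

theorem SparseTypical.pairType_of_hasCommonNbr (hG : SparseTypical α G) (hα : 1 < α) (hyx : y ≠ x)
    (h : HasCommonNbr G x y) :
    pairType G x y = (False, True, HasTwoNbrs G x, HasPrivateNbr G y x, True) := by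
  have hgirth := hG.le_egirth hα
  obtain ⟨w, hxw, hyw⟩ := h
  have hxy : ¬ G.Adj x y := not_adj_of_adj_of_adj (le_trans (by norm_num) hgirth) hxw hyw.symm
  have htwo : HasPrivateNbr G x y ↔ HasTwoNbrs G x := by
    refine ⟨fun ⟨z, hxz, hyz, _⟩ => ⟨z, w, fun hzw => hyz (hzw ▸ hyw), hxz, hxw⟩,
      fun h => ?_⟩
    obtain ⟨z, hxz, hzw⟩ := h.exists_adj_ne w
    refine ⟨z, hxz, fun hyz => hzw ?_, fun hzy => hxy (hzy ▸ hxz)⟩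
    exact eq_of_adj_of_adj (le_trans (by norm_num) hgirth) hyx.symm hxz hyz.symm hxw hyw.symm
  simp [pairType, hxy, show HasCommonNbr G x y from ⟨w, hxw, hyw⟩, htwo, hG.hasCommonNonNbr]

theorem SparseTypical.pairType_of_not_hasCommonNbr (hG : SparseTypical α G) (hxy : ¬ G.Adj x y)
    (h : ¬ HasCommonNbr G x y) :
    pairType G x y = (False, False, ∃ z, G.Adj x z, ∃ z, G.Adj y z, True) := by
  have hprivate {u v : V} (huv : ¬ G.Adj u v) (h : ¬ HasCommonNbr G u v) :
      HasPrivateNbr G u v ↔ ∃ z, G.Adj u z :=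
    ⟨fun ⟨z, hz, _⟩ => ⟨z, hz⟩, fun ⟨z, hz⟩ =>
      ⟨z, hz, fun hvz => h ⟨z, hz, hvz⟩, fun hzv => huv (hzv ▸ hz)⟩⟩
  have h' : ¬ HasCommonNbr G y x := fun ⟨z, hyz, hxz⟩ => h ⟨z, hxz, hyz⟩
  simp [pairType, hxy, h, hprivate hxy h, hprivate (fun h => hxy h.symm) h', hG.hasCommonNonNbr]

theorem SparseTypical.vertexType_subset (hG : SparseTypical α G) (hH : SparseTypical α H)
    (hα : 1 < α) (hα' : α ≠ 2) {y : W} (h : localType G x = localType H y) :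
    vertexType G x ⊆ vertexType H y := by
  have hadj : (∃ z, G.Adj x z) = ∃ z, H.Adj y z := by
    simp only [exists_adj_iff, eq_iff_iff]
    grind [localType]
  simp only [localType, Prod.mk.injEq] at h
  obtain ⟨hinner, hleaf, hinner', hleaf', htwo⟩ := h
  rintro _ ⟨z, hzx : z ≠ x, rfl⟩
  by_cases hxz : G.Adj x z
  · obtain ⟨w, hyw, hw⟩ : ∃ w, H.Adj y w ∧ (HasPrivateNbr H w y ↔ HasPrivateNbr G z x) := by
      by_cases hz : HasPrivateNbr G z x
      · simpa only [hz, iff_true, HasInnerNbr] using hinner.mp ⟨z, hxz, hz⟩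
      · simpa only [hz, iff_false, HasLeafNbr] using hleaf.mp ⟨z, hxz, hz⟩
    exact ⟨w, hyw.ne', by rw [hG.pairType_of_adj hα hxz, hH.pairType_of_adj hα hyw, htwo, hw]⟩
  by_cases hcommon : HasCommonNbr G x z
  · obtain ⟨w, hwy, -, hyw, hw⟩ : ∃ w, w ≠ y ∧ ¬ H.Adj y w ∧ HasCommonNbr H y w ∧
        (HasPrivateNbr H w y ↔ HasPrivateNbr G z x) := by
      by_cases hz : HasPrivateNbr G z x
      · simpa only [hz, iff_true, HasInnerSecondNbr] using
          hinner'.mp ⟨z, hzx, hxz, hcommon, hz⟩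
      · simpa only [hz, iff_false, HasLeafSecondNbr] using
          hleaf'.mp ⟨z, hzx, hxz, hcommon, hz⟩
    exact ⟨w, hwy, by rw [hG.pairType_of_hasCommonNbr hα hzx hcommon,
      hH.pairType_of_hasCommonNbr hα hwy hyw, htwo, hw]⟩
  obtain ⟨w, hwy, hyw, hyw', hw⟩ : ∃ w, w ≠ y ∧ ¬ H.Adj y w ∧ ¬ HasCommonNbr H y w ∧
      ((∃ v, H.Adj w v) ↔ ∃ v, G.Adj z v) := by
    by_cases hz : ∃ v, G.Adj z v
    · simpa only [hz, iff_true] using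
        hH.exists_far_of_adj ((hG.le_two_of_adj hz.choose_spec).lt_of_ne hα') y
    · simpa only [hz, iff_false] using hH.exists_far_of_not_adj y
  exact ⟨w, hwy, by rw [hG.pairType_of_not_hasCommonNbr hxz hcommon,
    hH.pairType_of_not_hasCommonNbr hyw hyw', hadj, hw]⟩

theorem SparseTypical.vertexType_eq (hG : SparseTypical α G) (hH : SparseTypical α H)
    (hα : 1 < α) (hα' : α ≠ 2) {y : W} (h : localType G x = localType H y) :
    vertexType G x = vertexType H y :=
  (hG.vertexType_subset hH hα hα' h).antisymm (hH.vertexType_subset hG hα hα' h.symm)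

end SparseTypical

section SmallTrees

variable {G : SimpleGraph V} {x : V}

/-- The parent functions of the paths on at most seven vertices, a spider and a caterpillar. Every
value of `localType` is attained at some vertex of one of these trees. -/
def witnessTrees : List (Σ m, Fin m → Fin (m + 1)) :=
  [⟨0, Fin.castSucc⟩, ⟨1, Fin.castSucc⟩, ⟨2, Fin.castSucc⟩, ⟨3, Fin.castSucc⟩, ⟨4, Fin.castSucc⟩,
    ⟨5, Fin.castSucc⟩, ⟨6, Fin.castSucc⟩, ⟨4, ![0, 1, 1, 3]⟩, ⟨5, ![0, 1, 2, 3, 2]⟩]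

theorem exists_mem_witnessTrees : ∀ i l s s' t : Bool, i = (s || s') → (i && l → t) →
    (t → i || l) → ∃ T ∈ witnessTrees, ∃ r, (decide (HasInnerNbr (parentGraph T.2) r),
      decide (HasLeafNbr (parentGraph T.2) r), decide (HasInnerSecondNbr (parentGraph T.2) r),
      decide (HasLeafSecondNbr (parentGraph T.2) r), decide (HasTwoNbrs (parentGraph T.2) r)) =
        (i, l, s, s', t) := by
  decide +kernel

theorem witnessTrees_spec : ∀ T ∈ witnessTrees, T.1 ≤ 6 ∧ ∀ i, T.2 i ≤ i.castSucc := by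
  decide

theorem exists_mem_witnessTrees_localType_eq (G : SimpleGraph V) (x : V) :
    ∃ T ∈ witnessTrees, ∃ r, localType (parentGraph T.2) r = localType G x := by
  classical
  obtain ⟨T, hT, r, h⟩ := exists_mem_witnessTrees (decide (HasInnerNbr G x))
    (decide (HasLeafNbr G x)) (decide (HasInnerSecondNbr G x)) (decide (HasLeafSecondNbr G x))
    (decide (HasTwoNbrs G x)) (by simp [hasInnerNbr_iff])
    (by simpa using fun h h' => HasInnerNbr.hasTwoNbrs h h')
    (by simpa [← exists_adj_iff] using HasTwoNbrs.exists_adj)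
  exact ⟨T, hT, r, by simpa [localType] using h⟩

end SmallTrees

section Components

open scoped SimpleGraph

variable {G : SimpleGraph V}

theorem exists_preconnected_finset (G : SimpleGraph V) (x : V) (k : ℕ) :
    ∃ S : Finset V, x ∈ S ∧ (G.induce (S : Set V)).Preconnected ∧
      (S.card = k + 1 ∨ S.card ≤ k ∧ ∀ u ∈ S, ∀ v, G.Adj u v → v ∈ S) := by
  classical
  induction k with
  | zero =>
    refine ⟨{x}, by simp, ?_, .inl (by simp)⟩
    rw [Finset.coe_singleton]
    exact .of_subsingleton
  | succ k ih =>
    obtain ⟨S, hx, hS, hcard | ⟨hcard, hclosed⟩⟩ := ih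
    swap
    · exact ⟨S, hx, hS, .inr ⟨by lia, hclosed⟩⟩
    by_cases hclosed : ∀ u ∈ S, ∀ v, G.Adj u v → v ∈ S
    · exact ⟨S, hx, hS, .inr ⟨by lia, hclosed⟩⟩
    push Not at hclosed
    obtain ⟨u, hu, v, huv, hv⟩ := hclosed
    refine ⟨S ∪ {u, v}, by simp [hx], ?_, .inl ?_⟩
    · rw [Finset.coe_union, Finset.coe_pair]
      have hpair := (SimpleGraph.induce_pair_connected_of_adj huv).preconnected
      exact (SimpleGraph.induce_union_connected hS hpair ⟨u, by simpa, by simp⟩).preconnected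
    · rw [Finset.union_insert, ← Finset.insert_union, Finset.insert_eq_of_mem hu,
        Finset.union_singleton, Finset.card_insert_of_notMem hv, hcard]

/-- Either the component of `x` has at most `k` vertices, or it contains a connected graph on
`k + 1` vertices. -/
theorem exists_preconnected_map_le (G : SimpleGraph V) (x : V) (k : ℕ) :
    ∃ m, ∃ T : SimpleGraph (Fin m), ∃ f : Fin m ↪ V, ∃ i, f i = x ∧ T.Preconnected ∧ T.map f ≤ G ∧
      (m = k + 1 ∨ m ≤ k ∧ IsIsolatedCopy T f G) := by
  obtain ⟨S, hx, hS, hcard⟩ := exists_preconnected_finset G x k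
  set f : Fin S.card ↪ V := S.equivFin.symm.toEmbedding.trans (.subtype _) with hf
  have hfS {v : V} (hv : v ∈ S) : f (S.equivFin ⟨v, hv⟩) = v := by simp [hf]
  have hmap : (G.comap f).map f ≤ G := SimpleGraph.map_comap_le f G
  refine ⟨S.card, G.comap f, f, S.equivFin ⟨x, hx⟩, hfS hx, ?_, hmap,
    hcard.imp_right fun ⟨hcard, hclosed⟩ => ⟨hcard, hmap, fun i v hiv => ?_⟩⟩
  · exact (SimpleGraph.Iso.comap S.equivFin.symm (G.induce (S : Set V))).preconnected_iff.2 hS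
  · have hv := hclosed _ (S.equivFin.symm i).2 v hiv
    exact ⟨S.equivFin ⟨v, hv⟩, by simpa [hfS hv] using hiv, hfS hv⟩

end Components

section ZeroOneLaw

variable {α : ℝ} {G : SimpleGraph V} {H : SimpleGraph W}

theorem le_ncard_edgeSet_add_one {m : ℕ} {T : SimpleGraph (Fin m)} (hT : T.Preconnected) :
    m ≤ T.edgeSet.ncard + 1 := by
  rcases Nat.eq_zero_or_pos m with rfl | hm
  · simp
  have : NeZero m := ⟨hm.ne'⟩
  simpa only [Nat.card_fin, Nat.card_coe_set_eq] using
    SimpleGraph.Connected.card_vert_le_card_edgeSet_add_one ⟨hT⟩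

theorem exists_localType_eq_of_lt (hα : 0 < α) (hα' : α < 7 / 6) (G : SimpleGraph V) (x : V) :
    ∃ k ≤ 7, ∃ T : SimpleGraph (Fin k), T.Preconnected ∧ α * T.edgeSet.ncard < k ∧
      ∃ i, localType T i = localType G x := by
  obtain ⟨⟨m, π⟩, hT, r, hr⟩ := exists_mem_witnessTrees_localType_eq G x
  obtain ⟨hm : m ≤ 6, hπ⟩ := witnessTrees_spec _ hT
  refine ⟨m + 1, by lia, parentGraph π, parentGraph_preconnected hπ, ?_, r, hr⟩
  have hm' : (m : ℝ) ≤ 6 := by exact_mod_cast hm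
  rw [ncard_edgeSet_parentGraph hπ]
  push_cast
  nlinarith

theorem SparseTypical.exists_localType_eq_of_gt (hG : SparseTypical α G) (hα : 7 / 6 < α)
    (hne : ∀ m ≤ 6, α * m ≠ (m + 1 : ℕ)) (x : V) :
    ∃ k ≤ 7, ∃ T : SimpleGraph (Fin k), T.Preconnected ∧ α * T.edgeSet.ncard < k ∧
      ∃ i, localType T i = localType G x := by
  obtain ⟨k, T, f, i, rfl, hT, hf, hk⟩ := exists_preconnected_map_le G x 6
  have hedges := le_ncard_edgeSet_add_one hT
  have hsparse : α * T.edgeSet.ncard ≤ k := by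
    by_contra! h
    exact hG.not_isContained k (by lia) T h (isContained_iff_exists_map_le.2 ⟨f, hf⟩)
  obtain rfl | ⟨hk, hiso⟩ := hk
  · have : (6 : ℝ) ≤ T.edgeSet.ncard := by exact_mod_cast Nat.le_of_succ_le_succ hedges
    push_cast at hsparse
    nlinarith
  refine ⟨k, by lia, T, hT, hsparse.lt_of_ne fun h => ?_, i, (hiso.localType_eq i).symm⟩
  have hpos : (0 : ℝ) < k := by exact_mod_cast i.pos
  have hlt : (T.edgeSet.ncard : ℝ) < k := by nlinarith
  have hcard : k = T.edgeSet.ncard + 1 :=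
    hedges.antisymm (Order.add_one_le_iff.2 (by exact_mod_cast hlt))
  exact hne T.edgeSet.ncard (by lia) (hcard ▸ h)

theorem SparseTypical.graphType_subset (hG : SparseTypical α G) (hH : SparseTypical α H)
    (hα : 1 < α) (hne : ∀ m ≤ 6, α * m ≠ (m + 1 : ℕ)) : graphType G ⊆ graphType H := by
  rintro _ ⟨x, rfl⟩
  obtain ⟨k, hk, T, hT, hlt, i, hi⟩ : ∃ k ≤ 7, ∃ T : SimpleGraph (Fin k), T.Preconnected ∧
      α * T.edgeSet.ncard < k ∧ ∃ i, localType T i = localType G x := by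
    rcases lt_or_gt_of_ne (show α ≠ 7 / 6 from fun h => hne 6 le_rfl (by norm_num [h])) with h | h
    · exact exists_localType_eq_of_lt (by linarith) h G x
    · exact hG.exists_localType_eq_of_gt h hne x
  obtain ⟨g, hg, -⟩ := hH.exists_isIsolatedCopy k hk T hT hlt ∅ (by simp)
  exact ⟨g i, hH.vertexType_eq hG hα (fun h => hne 1 (by norm_num) (by norm_num [h]))
    ((hg.localType_eq i).trans hi)⟩

theorem obeysFOZeroOneLaw_of_one_lt (hα : 1 < α) (hne : ∀ m ≤ 6, α * m ≠ (m + 1 : ℕ)) :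
    ObeysFOZeroOneLaw (powEdgeProb α (zero_lt_one.trans hα)) 3 :=
  obeysFOZeroOneLaw_of_aas (aas_sparseTypical hα) fun _ _ _ _ hG hH =>
    hG.graphType_subset hH hα hne

end ZeroOneLaw

section Formulas

open Language

variable {k : ℕ}

/-- The formula `φ` of the language of graphs holds in `G` for the vertices `a`. -/
def Sat (G : SimpleGraph V) (φ : Language.graph.BoundedFormula Empty k) (a : Fin k → V) : Prop :=
  @BoundedFormula.Realize _ V G.structure _ _ φ default a

/-- The formula `xᵢ ∼ xⱼ`. -/
def adjFormula (i j : Fin k) : Language.graph.BoundedFormula Empty k :=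
  adj.boundedFormula₂ (Term.var (Sum.inr i)) (Term.var (Sum.inr j))

/-- The formula `xᵢ = xⱼ`. -/
def eqFormula (i j : Fin k) : Language.graph.BoundedFormula Empty k :=
  .equal (Term.var (Sum.inr i)) (Term.var (Sum.inr j))

/-- The formula defining `HasPrivateNbr`. -/
def privateNbrFormula (i j : Fin k) : Language.graph.BoundedFormula Empty k :=
  (adjFormula i.castSucc (Fin.last k) ⊓ ((adjFormula j.castSucc (Fin.last k)).not ⊓
    (eqFormula (Fin.last k) j.castSucc).not)).ex

/-- The formula defining `HasCommonNbr`. -/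
def commonNbrFormula (i j : Fin k) : Language.graph.BoundedFormula Empty k :=
  (adjFormula i.castSucc (Fin.last k) ⊓ adjFormula j.castSucc (Fin.last k)).ex

/-- The formula defining the vertices of positive degree. -/
def nbrFormula (i : Fin k) : Language.graph.BoundedFormula Empty k :=
  (adjFormula i.castSucc (Fin.last k)).ex

/-- The formula defining the vertices which lie in triangles. -/
def triangleFormula (i : Fin k) : Language.graph.BoundedFormula Empty k :=
  (adjFormula i.castSucc (Fin.last k) ⊓ commonNbrFormula i.castSucc (Fin.last k)).ex

/-- The formula defining `HasLeafNbr`. -/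
def leafNbrFormula (i : Fin k) : Language.graph.BoundedFormula Empty k :=
  (adjFormula i.castSucc (Fin.last k) ⊓ (privateNbrFormula (Fin.last k) i.castSucc).not).ex

/-- The formula defining `HasInnerSecondNbr`. -/
def innerSecondNbrFormula (i : Fin k) : Language.graph.BoundedFormula Empty k :=
  ((eqFormula (Fin.last k) i.castSucc).not ⊓ ((adjFormula i.castSucc (Fin.last k)).not ⊓
    (commonNbrFormula i.castSucc (Fin.last k) ⊓ privateNbrFormula (Fin.last k) i.castSucc))).ex

/-- The formula defining `HasLeafSecondNbr`. -/
def leafSecondNbrFormula (i : Fin k) : Language.graph.BoundedFormula Empty k :=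
  ((eqFormula (Fin.last k) i.castSucc).not ⊓ ((adjFormula i.castSucc (Fin.last k)).not ⊓
    (commonNbrFormula i.castSucc (Fin.last k) ⊓
      (privateNbrFormula (Fin.last k) i.castSucc).not))).ex

/-- The formula defining `HasTwoNbrs`. -/
def twoNbrsFormula (i : Fin k) : Language.graph.BoundedFormula Empty k :=
  ((eqFormula (Fin.last k).castSucc (Fin.last (k + 1))).not ⊓
    (adjFormula i.castSucc.castSucc (Fin.last k).castSucc ⊓
      adjFormula i.castSucc.castSucc (Fin.last (k + 1)))).ex.ex

section Sat

variable (G : SimpleGraph V) (a : Fin k → V) (i j : Fin k)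
  (φ ψ : Language.graph.BoundedFormula Empty k)

@[simp] theorem sat_adjFormula : Sat G (adjFormula i j) a ↔ G.Adj (a i) (a j) := by
  let := G.structure
  exact BoundedFormula.realize_rel₂

@[simp] theorem sat_eqFormula : Sat G (eqFormula i j) a ↔ a i = a j := Iff.rfl

@[simp] theorem sat_not : Sat G φ.not a ↔ ¬ Sat G φ a := Iff.rfl

@[simp] theorem sat_inf : Sat G (φ ⊓ ψ) a ↔ Sat G φ a ∧ Sat G ψ a := by
  let := G.structure
  exact BoundedFormula.realize_inf

@[simp] theorem sat_ex (φ : Language.graph.BoundedFormula Empty (k + 1)) :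
    Sat G φ.ex a ↔ ∃ x, Sat G φ (Fin.snoc a x) := by
  let := G.structure
  exact BoundedFormula.realize_ex

theorem satisfiesFO_ex_iff (φ : Language.graph.BoundedFormula Empty 1) :
    G.SatisfiesFO φ.ex ↔ ∃ x, Sat G φ ![x] := by
  exact (sat_ex G default φ).trans (by simp only [snoc_default_eq])

@[simp] theorem sat_privateNbrFormula :
    Sat G (privateNbrFormula i j) a ↔ HasPrivateNbr G (a i) (a j) := by
  simp [privateNbrFormula, HasPrivateNbr]

@[simp] theorem sat_commonNbrFormula :
    Sat G (commonNbrFormula i j) a ↔ HasCommonNbr G (a i) (a j) := by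
  simp [commonNbrFormula, HasCommonNbr]

@[simp] theorem sat_nbrFormula : Sat G (nbrFormula i) a ↔ ∃ y, G.Adj (a i) y := by
  simp [nbrFormula]

@[simp] theorem sat_triangleFormula :
    Sat G (triangleFormula i) a ↔ ∃ y, G.Adj (a i) y ∧ HasCommonNbr G (a i) y := by
  simp [triangleFormula]

@[simp] theorem sat_leafNbrFormula : Sat G (leafNbrFormula i) a ↔ HasLeafNbr G (a i) := by
  simp [leafNbrFormula, HasLeafNbr]

@[simp] theorem sat_innerSecondNbrFormula :
    Sat G (innerSecondNbrFormula i) a ↔ HasInnerSecondNbr G (a i) := by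
  simp [innerSecondNbrFormula, HasInnerSecondNbr]

@[simp] theorem sat_leafSecondNbrFormula :
    Sat G (leafSecondNbrFormula i) a ↔ HasLeafSecondNbr G (a i) := by
  simp [leafSecondNbrFormula, HasLeafSecondNbr]

@[simp] theorem sat_twoNbrsFormula : Sat G (twoNbrsFormula i) a ↔ HasTwoNbrs G (a i) := by
  simp [twoNbrsFormula, HasTwoNbrs]

end Sat

section QuantifierDepth

variable (i j : Fin k) (φ ψ : Language.graph.BoundedFormula Empty k)

@[simp] theorem quantifierDepth_not : φ.not.quantifierDepth = φ.quantifierDepth :=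
  Nat.max_zero _

@[simp] theorem quantifierDepth_inf :
    (φ ⊓ ψ).quantifierDepth = max φ.quantifierDepth ψ.quantifierDepth := by
  change max (max φ.quantifierDepth (max ψ.quantifierDepth 0)) 0 = _
  simp

@[simp] theorem quantifierDepth_ex (φ : Language.graph.BoundedFormula Empty (k + 1)) :
    φ.ex.quantifierDepth = φ.quantifierDepth + 1 := by
  change max (max φ.quantifierDepth 0 + 1) 0 = _
  simp

@[simp] theorem quantifierDepth_adjFormula : (adjFormula i j).quantifierDepth = 0 := rfl

@[simp] theorem quantifierDepth_eqFormula : (eqFormula i j).quantifierDepth = 0 := rfl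

@[simp] theorem quantifierDepth_privateNbrFormula :
    (privateNbrFormula i j).quantifierDepth = 1 := by
  simp [privateNbrFormula]

@[simp] theorem quantifierDepth_commonNbrFormula :
    (commonNbrFormula i j).quantifierDepth = 1 := by
  simp [commonNbrFormula]

@[simp] theorem quantifierDepth_nbrFormula : (nbrFormula i).quantifierDepth = 1 := by
  simp [nbrFormula]

@[simp] theorem quantifierDepth_triangleFormula : (triangleFormula i).quantifierDepth = 2 := by
  simp [triangleFormula]

@[simp] theorem quantifierDepth_leafNbrFormula : (leafNbrFormula i).quantifierDepth = 2 := by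
  simp [leafNbrFormula]

@[simp] theorem quantifierDepth_innerSecondNbrFormula :
    (innerSecondNbrFormula i).quantifierDepth = 2 := by
  simp [innerSecondNbrFormula]

@[simp] theorem quantifierDepth_leafSecondNbrFormula :
    (leafSecondNbrFormula i).quantifierDepth = 2 := by
  simp [leafSecondNbrFormula]

@[simp] theorem quantifierDepth_twoNbrsFormula : (twoNbrsFormula i).quantifierDepth = 2 := by
  simp [twoNbrsFormula]

end QuantifierDepth

end Formulas

section LongPaths

open scoped SimpleGraph

variable {G : SimpleGraph V} {x y : V}

theorem pathGraph_two_isContained (h : ∃ y, G.Adj x y) : SimpleGraph.pathGraph 2 ⊑ G :=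
  let ⟨_, hxy⟩ := h
  (startsPath_one hxy).isContained

theorem HasTwoNbrs.pathGraph_isContained (hG : 8 ≤ G.egirth) (h : HasTwoNbrs G x) :
    SimpleGraph.pathGraph 3 ⊑ G := by
  obtain ⟨y, z, hyz, hxy, hxz⟩ := h
  exact ((startsPath_one hxz).cons (hG.trans' (by norm_num)) hxy.symm hyz).isContained

theorem HasInnerSecondNbr.pathGraph_isContained (hG : 8 ≤ G.egirth) (h : HasInnerSecondNbr G x) :
    SimpleGraph.pathGraph 4 ⊑ G := by
  obtain ⟨y, hyx, -, ⟨m, hxm, hym⟩, u, hyu, hxu, -⟩ := h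
  exact (((startsPath_one hxm.symm).cons (hG.trans' (by norm_num)) hym hyx).cons
    (hG.trans' (by norm_num)) hyu.symm fun hum => hxu (hum ▸ hxm)).isContained

theorem HasTwoNbrs.pathGraph_five_isContained (hG : 8 ≤ G.egirth) (h : HasTwoNbrs G x)
    (hleaf : ¬ HasLeafNbr G x) : SimpleGraph.pathGraph 5 ⊑ G := by
  obtain ⟨y, z, hyz, hxy, hxz⟩ := h
  have hinner {v : V} (hv : G.Adj x v) : HasPrivateNbr G v x := by_contra fun h => hleaf ⟨v, hv, h⟩
  obtain ⟨u, hyu, -, hux⟩ := hinner hxy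
  obtain ⟨v, hzv, -, hvx⟩ := hinner hxz
  exact ((((startsPath_one hzv).cons (hG.trans' (by norm_num)) hxz hvx.symm).cons
    (hG.trans' (by norm_num)) hxy.symm hyz).cons (hG.trans' (by norm_num)) hyu.symm hux).isContained

theorem HasTwoNbrs.pathGraph_six_isContained (hG : 8 ≤ G.egirth) (h : HasTwoNbrs G x)
    (hleaf : ¬ HasLeafNbr G x) (hinner : HasInnerSecondNbr G x) :
    SimpleGraph.pathGraph 6 ⊑ G := by
  obtain ⟨y, hyx, -, ⟨m, hxm, hym⟩, w, hyw, hxw, -⟩ := hinner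
  obtain ⟨u, hxu, hum⟩ := h.exists_adj_ne m
  obtain ⟨z, huz, -, hzx⟩ : HasPrivateNbr G u x := by_contra fun h => hleaf ⟨u, hxu, h⟩
  have hpath := (startsPath_one hyw).cons (hG.trans' (by norm_num)) hym.symm
    fun hmw => hxw (hmw ▸ hxm)
  exact (((hpath.cons (hG.trans' (by norm_num)) hxm hyx.symm).cons (hG.trans' (by norm_num))
    hxu.symm hum).cons (hG.trans' (by norm_num)) huz.symm hzx).isContained

theorem HasTwoNbrs.pathGraph_seven_isContained (hG : 8 ≤ G.egirth) (h : HasTwoNbrs G x)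
    (hleaf : ¬ HasLeafNbr G x) (hleaf' : ¬ HasLeafSecondNbr G x) :
    SimpleGraph.pathGraph 7 ⊑ G := by
  have harm {v : V} (hxv : G.Adj x v) : ∃ u w, G.Adj v u ∧ u ≠ x ∧ G.Adj u w ∧ v ≠ w := by
    obtain ⟨u, hvu, hxu, hux⟩ : HasPrivateNbr G v x := by_contra fun h => hleaf ⟨v, hxv, h⟩
    obtain ⟨w, huw, hxw, -⟩ : HasPrivateNbr G u x :=
      by_contra fun h => hleaf' ⟨u, hux, hxu, ⟨v, hxv, hvu.symm⟩, h⟩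
    exact ⟨u, w, hvu, hux, huw, fun hvw => hxw (hvw ▸ hxv)⟩
  obtain ⟨y, y', hyy', hxy, hxy'⟩ := h
  obtain ⟨z, w, hyz, hzx, hzw, hyw⟩ := harm hxy
  obtain ⟨z', w', hyz', hzx', hzw', hyw'⟩ := harm hxy'
  have hpath := (((startsPath_one hzw').cons (hG.trans' (by norm_num)) hyz' hyw').cons
    (hG.trans' (by norm_num)) hxy' hzx'.symm)
  exact (((hpath.cons (hG.trans' (by norm_num)) hxy.symm hyy').cons (hG.trans' (by norm_num))
    hyz.symm hzx).cons (hG.trans' (by norm_num)) hzw.symm hyw.symm).isContained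

end LongPaths

section Thresholds

open unitInterval
open scoped SimpleGraph

variable {α : ℝ}

/-- The reversal of a path. -/
def pathGraphRevIso (m : ℕ) : SimpleGraph.pathGraph m ≃g SimpleGraph.pathGraph m where
  toEquiv := Fin.revPerm
  map_rel_iff' := by
    simp only [SimpleGraph.pathGraph_adj, Fin.revPerm_apply, Fin.val_rev]
    lia

theorem eventually_measureReal_isContained_pathGraph_le {m : ℕ} (hm : 0 < m) (hα : 0 < α)
    (h : α * m = (m + 1 : ℕ)) :
    ∀ᶠ n in atTop, G(Fin n, powEdgeProb α hα n).real
      {G | SimpleGraph.pathGraph (m + 1) ⊑ G} ≤ 1 / 2 := by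
  filter_upwards [eventually_gt_atTop 0] with n hn
  have hrev : pathGraphRevIso (m + 1) 0 ≠ 0 := by simp [pathGraphRevIso, Fin.ext_iff, hm.ne']
  have htwo := two_mul_measureReal_isContained_le (V := Fin n) (p := powEdgeProb α hα n)
    (pathGraphRevIso (m + 1)) hrev
  rw [ncard_edgeSet_pathGraph, Fintype.card_fin, Fintype.card_fin] at htwo
  linarith [htwo.trans_eq (natCast_pow_mul_rpow_pow_eq_one h hn)]

/-- If the path with `m` edges is at the threshold, then with probability bounded away from zero
and one it occurs, and it does so as a component. -/
theorem not_obeysFOZeroOneLaw_of_pathGraph {m : ℕ} (hm : 0 < m) (h : α * m = (m + 1 : ℕ))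
    (hα : 0 < α) {φ : Language.graph.BoundedFormula Empty 1} (hφ : φ.quantifierDepth ≤ 2)
    {Q : Prop × Prop × Prop × Prop × Prop → Prop}
    (hQ : ∀ n (G : SimpleGraph (Fin n)) x, Sat G φ ![x] ↔ Q (localType G x))
    (i : Fin (m + 1)) (hi : Q (localType (SimpleGraph.pathGraph (m + 1)) i))
    (hpath : ∀ n (G : SimpleGraph (Fin n)) x, 8 ≤ G.egirth → Q (localType G x) →
      SimpleGraph.pathGraph (m + 1) ⊑ G) :
    ¬ ObeysFOZeroOneLaw (powEdgeProb α hα) 3 := by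
  have hα' : 1 < α := by
    push_cast at h
    by_contra! hle
    nlinarith [(Nat.cast_pos.2 hm : (0 : ℝ) < m)]
  obtain ⟨c, hc, hlower⟩ := exists_eventually_le_measureReal_isIsolatedCopy hα'
    (SimpleGraph.pathGraph_preconnected (m + 1)) (by rwa [ncard_edgeSet_pathGraph])
  refine not_obeysFOZeroOneLaw_of_bounds (φ := φ.ex)
    ((quantifierDepth_ex φ).trans_le (Nat.add_le_add_right hφ 1)) hc
    (by norm_num : (3 / 4 : ℝ) < 1) (hlower.mono fun n hn => hn.trans (measureReal_mono ?_)) ?_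
  · rintro G ⟨f, hf⟩
    exact (satisfiesFO_ex_iff G φ).2 ⟨f i, (hQ n G _).2 (hf.localType_eq i ▸ hi)⟩
  · have hgirth : AAS (powEdgeProb α hα) fun _ G => 8 ≤ G.egirth :=
      (aas_sparseTypical hα').mono (.of_forall fun _ G hG => hG.le_egirth hα')
    filter_upwards [eventually_measureReal_isContained_pathGraph_le hm hα h,
      hgirth.eventually_le_const (by norm_num : (0 : ℝ) < 1 / 4)] with n hn hn'
    have hsub : {G : SimpleGraph (Fin n) | G.SatisfiesFO φ.ex} ⊆
        {G | SimpleGraph.pathGraph (m + 1) ⊑ G} ∪ {G | ¬ 8 ≤ G.egirth} := by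
      intro G hG
      obtain ⟨x, hx⟩ := (satisfiesFO_ex_iff G φ).1 hG
      exact or_iff_not_imp_right.2 fun hG => hpath n G x (not_not.1 hG) ((hQ n G x).1 hx)
    exact ((measureReal_mono hsub).trans (measureReal_union_le _ _)).trans (by linarith)

theorem not_obeysFOZeroOneLaw_two (hα : (0 : ℝ) < 2) :
    ¬ ObeysFOZeroOneLaw (powEdgeProb 2 hα) 3 :=
  not_obeysFOZeroOneLaw_of_pathGraph one_pos (by norm_num) hα (φ := nbrFormula 0) (by simp)
    (Q := fun t => t.1 ∨ t.2.1) (fun _ _ _ => (sat_nbrFormula ..).trans exists_adj_iff) 0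
    (by rw [pathGraph_eq_parentGraph]; simp only [localType]; decide)
    fun _ _ _ _ h => pathGraph_two_isContained (exists_adj_iff.2 h)

theorem not_obeysFOZeroOneLaw_three_halves (hα : (0 : ℝ) < 3 / 2) :
    ¬ ObeysFOZeroOneLaw (powEdgeProb (3 / 2) hα) 3 :=
  not_obeysFOZeroOneLaw_of_pathGraph two_pos (by norm_num) hα (φ := twoNbrsFormula 0) (by simp)
    (Q := fun t => t.2.2.2.2) (fun _ _ _ => by simp [localType]) 1
    (by rw [pathGraph_eq_parentGraph]; simp only [localType]; decide)
    fun _ _ _ hG h => HasTwoNbrs.pathGraph_isContained hG h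

theorem not_obeysFOZeroOneLaw_four_thirds (hα : (0 : ℝ) < 4 / 3) :
    ¬ ObeysFOZeroOneLaw (powEdgeProb (4 / 3) hα) 3 :=
  not_obeysFOZeroOneLaw_of_pathGraph three_pos (by norm_num) hα (φ := innerSecondNbrFormula 0)
    (by simp) (Q := fun t => t.2.2.1) (fun _ _ _ => by simp [localType]) 0
    (by rw [pathGraph_eq_parentGraph]; simp only [localType]; decide)
    fun _ _ _ hG h => HasInnerSecondNbr.pathGraph_isContained hG h

theorem not_obeysFOZeroOneLaw_five_fourths (hα : (0 : ℝ) < 5 / 4) :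
    ¬ ObeysFOZeroOneLaw (powEdgeProb (5 / 4) hα) 3 :=
  not_obeysFOZeroOneLaw_of_pathGraph four_pos (by norm_num) hα
    (φ := twoNbrsFormula 0 ⊓ (leafNbrFormula 0).not) (by simp)
    (Q := fun t => t.2.2.2.2 ∧ ¬ t.2.1) (fun _ _ _ => by simp [localType]) 2
    (by rw [pathGraph_eq_parentGraph]; simp only [localType]; decide)
    fun _ _ _ hG h => HasTwoNbrs.pathGraph_five_isContained hG h.1 h.2

theorem not_obeysFOZeroOneLaw_six_fifths (hα : (0 : ℝ) < 6 / 5) :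
    ¬ ObeysFOZeroOneLaw (powEdgeProb (6 / 5) hα) 3 :=
  not_obeysFOZeroOneLaw_of_pathGraph (Nat.succ_pos 4) (by norm_num) hα
    (φ := twoNbrsFormula 0 ⊓ ((leafNbrFormula 0).not ⊓ innerSecondNbrFormula 0)) (by simp)
    (Q := fun t => t.2.2.2.2 ∧ ¬ t.2.1 ∧ t.2.2.1) (fun _ _ _ => by simp [localType]) 2
    (by rw [pathGraph_eq_parentGraph]; simp only [localType]; decide)
    fun _ _ _ hG h => HasTwoNbrs.pathGraph_six_isContained hG h.1 h.2.1 h.2.2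

theorem not_obeysFOZeroOneLaw_seven_sixths (hα : (0 : ℝ) < 7 / 6) :
    ¬ ObeysFOZeroOneLaw (powEdgeProb (7 / 6) hα) 3 :=
  not_obeysFOZeroOneLaw_of_pathGraph (Nat.succ_pos 5) (by norm_num) hα
    (φ := twoNbrsFormula 0 ⊓ ((leafNbrFormula 0).not ⊓ (leafSecondNbrFormula 0).not)) (by simp)
    (Q := fun t => t.2.2.2.2 ∧ ¬ t.2.1 ∧ ¬ t.2.2.2.1) (fun _ _ _ => by simp [localType]) 3
    (by rw [pathGraph_eq_parentGraph]; simp only [localType]; decide)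
    fun _ _ _ hG h => HasTwoNbrs.pathGraph_seven_isContained hG h.1 h.2.1 h.2.2

theorem satisfiesFO_ex_triangleFormula_iff (G : SimpleGraph V) :
    G.SatisfiesFO (triangleFormula 0).ex ↔ ∃ s, G.IsNClique 3 s := by
  classical
  simp only [satisfiesFO_ex_iff, sat_triangleFormula, SimpleGraph.is3Clique_iff]
  constructor
  · rintro ⟨x, y, hxy, z, hxz, hyz⟩
    exact ⟨_, x, y, z, hxy, hxz, hyz, rfl⟩
  · rintro ⟨_, x, y, z, hxy, hxz, hyz, -⟩
    exact ⟨x, y, hxy, z, hxz, hyz⟩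

theorem satisfiesFO_ex_triangleFormula_iff_isContained (G : SimpleGraph V) :
    G.SatisfiesFO (triangleFormula 0).ex ↔ (⊤ : SimpleGraph (Fin 3)) ⊑ G := by
  rw [satisfiesFO_ex_triangleFormula_iff, ← SimpleGraph.not_cliqueFree_iff_top_isContained]
  simp [SimpleGraph.CliqueFree]

theorem eventually_le_probSatisfiesFO_triangle :
    ∀ᶠ n in atTop, 1 / 50 ≤
      probSatisfiesFO n (powEdgeProb 1 one_pos n) (triangleFormula 0).ex := by
  filter_upwards [(tendsto_choose_div_pow 3).eventually_const_lt
    (by norm_num [Nat.factorial] : (1 / 12 : ℝ) < 1 / Nat.factorial 3),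
    eventually_gt_atTop 0] with n hlarge hn
  have hp : (powEdgeProb 1 one_pos n : ℝ) = (n : ℝ)⁻¹ := Real.rpow_neg_one _
  have hmean := integral_cliqueCount (V := Fin n) (p := powEdgeProb 1 one_pos n) 3
  have hsq := integral_cliqueCount_three_sq_le (V := Fin n) (p := powEdgeProb 1 one_pos n)
  simp only [Fintype.card_fin, hp, inv_pow,
    (by decide : Nat.choose 3 2 = 3), ← div_eq_mul_inv] at hmean hsq
  set M : ℝ := n.choose 3 / (n : ℝ) ^ 3
  have hnp : 3 * (n : ℝ) / (n : ℝ) ^ 2 ≤ 3 := by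
    rw [div_le_iff₀ (by positivity)]
    gcongr
    exact_mod_cast Nat.le_self_pow two_ne_zero n
  have hmoment := sq_integral_le_measureReal_mul_integral_sq
    (μ := G(Fin n, powEdgeProb 1 one_pos n)) (A := {G | G.SatisfiesFO (triangleFormula 0).ex})
    (X := cliqueCount 3) .of_discrete .of_discrete fun G hG => cliqueCount_eq_zero fun s hs =>
      hG (Set.mem_ofPred.2 ((satisfiesFO_ex_triangleFormula_iff G).2 ⟨s, hs⟩))
  rw [hmean] at hmoment
  change 1 / 50 ≤ Measure.real _ _
  by_contra! hlt
  have hbound : M ^ 2 ≤ 1 / 50 * (M ^ 2 + (3 + 1) * M) :=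
    hmoment.trans (mul_le_mul hlt.le (hsq.trans (by gcongr)) (by positivity) (by norm_num))
  nlinarith

theorem not_obeysFOZeroOneLaw_one (hα : (0 : ℝ) < 1) :
    ¬ ObeysFOZeroOneLaw (powEdgeProb 1 hα) 3 := by
  refine not_obeysFOZeroOneLaw_of_bounds (φ := (triangleFormula 0).ex) (by simp)
    (by norm_num : (0 : ℝ) < 1 / 50) (by norm_num : (1 / 2 : ℝ) < 1)
    eventually_le_probSatisfiesFO_triangle ?_
  filter_upwards [eventually_gt_atTop 0] with n hn
  have htwo := two_mul_measureReal_isContained_le (V := Fin n) (p := powEdgeProb 1 hα n)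
    (SimpleGraph.Iso.completeGraph (finRotate 3)) (i := 0) (by decide)
  have hedges : (SimpleGraph.completeGraph (Fin 3)).edgeSet.ncard = 3 := by
    rw [Set.ncard_eq_toFinset_card']
    decide
  rw [hedges, Fintype.card_fin, Fintype.card_fin] at htwo
  have h1 : (1 : ℝ) * (3 : ℕ) = (3 : ℕ) := one_mul _
  simp only [probSatisfiesFO, satisfiesFO_ex_triangleFormula_iff_isContained]
  linarith [htwo.trans_eq (natCast_pow_mul_rpow_pow_eq_one h1 hn)]

end Thresholds

section RichGraphs

/-- A graph is rich if for distinct vertices `x` and `y` there is a vertex adjacent to `x` but not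
to `y`, and one adjacent to neither. In such a graph the type of a pair of vertices is determined
by whether they are adjacent and whether they have a common neighbour. -/
structure Rich (G : SimpleGraph V) : Prop where
  nontrivial : Nontrivial V
  hasPrivateNbr : ∀ x y, x ≠ y → HasPrivateNbr G x y
  hasCommonNonNbr : ∀ x y, x ≠ y → HasCommonNonNbr G x y

/-- The vertex `x` has a neighbour and a non-neighbour with neither of which it has a common
neighbour. -/
def HasSparsePairs (G : SimpleGraph V) (x : V) : Prop :=
  (∃ z, G.Adj x z ∧ ¬ HasCommonNbr G x z) ∧ ∃ z, z ≠ x ∧ ¬ G.Adj x z ∧ ¬ HasCommonNbr G x z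

/-- The vertex `x` lies in a triangle. -/
def InTriangle (G : SimpleGraph V) (x : V) : Prop :=
  ∃ z, G.Adj x z ∧ HasCommonNbr G x z

variable {G : SimpleGraph V} {H : SimpleGraph W}

theorem Rich.pairType_eq (hG : Rich G) {x y : V} (h : y ≠ x) :
    pairType G x y = (G.Adj x y, HasCommonNbr G x y, True, True, True) := by
  simp [pairType, hG.hasPrivateNbr x y h.symm, hG.hasPrivateNbr y x h,
    hG.hasCommonNonNbr x y h.symm]

theorem Rich.exists_adj (hG : Rich G) (x : V) : ∃ y, G.Adj x y := by
  have := hG.nontrivial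
  obtain ⟨y, hy⟩ := exists_ne x
  obtain ⟨z, hz, -⟩ := hG.hasPrivateNbr x y hy.symm
  exact ⟨z, hz⟩

theorem Rich.exists_not_adj_and_hasCommonNbr (hG : Rich G) (x : V) :
    ∃ y, y ≠ x ∧ ¬ G.Adj x y ∧ HasCommonNbr G x y := by
  obtain ⟨m, hm⟩ := hG.exists_adj x
  obtain ⟨z, hz, hxz, hzx⟩ := hG.hasPrivateNbr m x hm.ne'
  exact ⟨z, hzx, hxz, m, hm, hz.symm⟩

theorem Rich.vertexType_subset (hG : Rich G) (hH : Rich H) {x : V} {y : W}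
    (h : ∀ z, z ≠ x → ∃ w, w ≠ y ∧ (G.Adj x z ↔ H.Adj y w) ∧
      (HasCommonNbr G x z ↔ HasCommonNbr H y w)) : vertexType G x ⊆ vertexType H y := by
  rintro _ ⟨z, hz, rfl⟩
  obtain ⟨w, hw, hadj, hcommon⟩ := h z hz
  exact ⟨w, hw, by rw [hG.pairType_eq hz, hH.pairType_eq hw, hadj, hcommon]⟩

theorem graphType_subset_of_forall_exists (h : ∀ x, ∃ y, vertexType G x = vertexType H y) :
    graphType G ⊆ graphType H :=
  Set.range_subset_iff.2 fun x => (h x).imp fun _ => Eq.symm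

theorem Rich.vertexType_subset_of_forall_hasCommonNbr (hG : Rich G) (hH : Rich H)
    (hG' : ∀ x y, x ≠ y → HasCommonNbr G x y) (hH' : ∀ x y, x ≠ y → HasCommonNbr H x y)
    (x : V) (y : W) : vertexType G x ⊆ vertexType H y := by
  refine hG.vertexType_subset hH fun z hz => ?_
  by_cases hadj : G.Adj x z
  · obtain ⟨w, hw⟩ := hH.exists_adj y
    exact ⟨w, hw.ne', iff_of_true hadj hw, iff_of_true (hG' x z hz.symm) (hH' y w hw.ne)⟩
  · obtain ⟨w, hne, hw, hcommon⟩ := hH.exists_not_adj_and_hasCommonNbr y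
    exact ⟨w, hne, iff_of_false hadj hw, iff_of_true (hG' x z hz.symm) hcommon⟩

theorem Rich.graphType_subset_of_forall_hasCommonNbr (hG : Rich G) (hH : Rich H)
    (hG' : ∀ x y, x ≠ y → HasCommonNbr G x y) (hH' : ∀ x y, x ≠ y → HasCommonNbr H x y) :
    graphType G ⊆ graphType H := by
  obtain ⟨y⟩ := hH.nontrivial.to_nonempty
  exact graphType_subset_of_forall_exists fun x =>
    ⟨y, (hG.vertexType_subset_of_forall_hasCommonNbr hH hG' hH' x y).antisymm
      (hH.vertexType_subset_of_forall_hasCommonNbr hG hH' hG' y x)⟩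

theorem Rich.vertexType_subset_of_hasSparsePairs (hG : Rich G) (hH : Rich H) {x : V} {y : W}
    (hy : HasSparsePairs H y) (h : InTriangle G x → InTriangle H y) :
    vertexType G x ⊆ vertexType H y := by
  refine hG.vertexType_subset hH fun z _ => ?_
  by_cases hadj : G.Adj x z <;> by_cases hcommon : HasCommonNbr G x z
  · obtain ⟨w, hw, hwcommon⟩ := h ⟨z, hadj, hcommon⟩
    exact ⟨w, hw.ne', iff_of_true hadj hw, iff_of_true hcommon hwcommon⟩
  · obtain ⟨w, hw, hwcommon⟩ := hy.1
    exact ⟨w, hw.ne', iff_of_true hadj hw, iff_of_false hcommon hwcommon⟩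
  · obtain ⟨w, hne, hw, hwcommon⟩ := hH.exists_not_adj_and_hasCommonNbr y
    exact ⟨w, hne, iff_of_false hadj hw, iff_of_true hcommon hwcommon⟩
  · obtain ⟨w, hne, hw, hwcommon⟩ := hy.2
    exact ⟨w, hne, iff_of_false hadj hw, iff_of_false hcommon hwcommon⟩

theorem Rich.graphType_subset_of_hasSparsePairs (hG : Rich G) (hH : Rich H)
    (hG' : ∀ x, HasSparsePairs G x) (hH' : ∀ y, HasSparsePairs H y)
    (h : ∀ x, ∃ y, InTriangle G x ↔ InTriangle H y) : graphType G ⊆ graphType H :=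
  graphType_subset_of_forall_exists fun x => (h x).imp fun y hxy =>
    (hG.vertexType_subset_of_hasSparsePairs hH (hH' y) hxy.1).antisymm
      (hH.vertexType_subset_of_hasSparsePairs hG (hG' x) hxy.2)

theorem Rich.graphType_subset_of_forall_inTriangle (hG : Rich G) (hH : Rich H)
    (hG' : ∀ x, HasSparsePairs G x) (hH' : ∀ y, HasSparsePairs H y)
    (hGt : ∀ x, InTriangle G x) (hHt : ∀ y, InTriangle H y) : graphType G ⊆ graphType H := by
  obtain ⟨y⟩ := hH.nontrivial.to_nonempty
  exact hG.graphType_subset_of_hasSparsePairs hH hG' hH' fun x =>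
    ⟨y, iff_of_true (hGt x) (hHt y)⟩

theorem Rich.graphType_subset_of_exists_inTriangle (hG : Rich G) (hH : Rich H)
    (hG' : ∀ x, HasSparsePairs G x) (hH' : ∀ y, HasSparsePairs H y)
    (hin : ∃ y, InTriangle H y) (hout : ∃ y, ¬ InTriangle H y) : graphType G ⊆ graphType H := by
  refine hG.graphType_subset_of_hasSparsePairs hH hG' hH' fun x => ?_
  by_cases hx : InTriangle G x
  · exact hin.imp fun _ => iff_of_true hx
  · exact hout.imp fun _ => iff_of_false hx

end RichGraphs

section CommonNeighbours

open unitInterval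
open scoped SimpleGraph

theorem half_le_natCast_sub_two {n : ℕ} (hn : 4 ≤ n) : (n : ℝ) / 2 ≤ (n - 2 : ℕ) := by
  rw [Nat.cast_sub (by lia)]
  have : (4 : ℝ) ≤ n := by exact_mod_cast hn
  push_cast
  linarith

theorem dependsOnEdges_adj_adj (x y z : V) (F : Prop → Prop → Prop) :
    DependsOnEdges (fun G => F (G.Adj x z) (G.Adj y z)) {s(x, z), s(y, z)} := by
  intro G H h
  have hx : G.Adj x z = H.Adj x z := propext (h s(x, z) (by simp))
  have hy : G.Adj y z = H.Adj y z := propext (h s(y, z) (by simp))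
  simp only [hx, hy]

variable {p : I} [Fintype V] {x y : V}

theorem measureReal_forall_not_le_exp (hxy : x ≠ y) (hV : 4 ≤ Fintype.card V)
    {F : Prop → Prop → Prop} {c : ℝ} (hc : 0 ≤ c)
    (hF : ∀ z, z ≠ x → z ≠ y → c ≤ G(V, p).real {G | F (G.Adj x z) (G.Adj y z)}) :
    G(V, p).real {G | ∀ z, z ≠ x → z ≠ y → ¬ F (G.Adj x z) (G.Adj y z)} ≤
      Real.exp (-(c / 2 * Fintype.card V)) := by
  classical
  have hmem (z : V) : z ∈ ({x, y}ᶜ : Finset V) ↔ z ≠ x ∧ z ≠ y := by simp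
  have hdisj : (({x, y}ᶜ : Finset V) : Set V).PairwiseDisjoint
      fun z => ({s(x, z), s(y, z)} : Set (Sym2 V)) := by
    intro z hz w hw hzw
    have := (hmem z).1 hz
    have := (hmem w).1 hw
    simp only [Function.onFun, Set.disjoint_left, Set.mem_insert_iff, Set.mem_singleton_iff]
    grind
  have hcard : ({x, y}ᶜ : Finset V).card = Fintype.card V - 2 := by
    rw [Finset.card_compl, Finset.card_pair hxy]
  calc _ = ∏ z ∈ {x, y}ᶜ, G(V, p).real {G | ¬ F (G.Adj x z) (G.Adj y z)} := by
        rw [← measureReal_forall_mem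
          (fun z _ => dependsOnEdges_adj_adj x y z fun a b => ¬ F a b) hdisj]
        simp only [hmem, and_imp]
    _ ≤ ∏ _z ∈ ({x, y}ᶜ : Finset V), Real.exp (-c) := by
        refine Finset.prod_le_prod (fun _ _ => measureReal_nonneg) fun z hz => ?_
        rw [probReal_not .of_discrete]
        linarith [hF z ((hmem z).1 hz).1 ((hmem z).1 hz).2, Real.one_sub_le_exp_neg c]
    _ = Real.exp (-(c * (Fintype.card V - 2 : ℕ))) := by
        rw [Finset.prod_const, hcard, ← Real.exp_nat_mul]
        ring_nf
    _ ≤ _ := by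
        rw [div_mul_comm, mul_comm _ c]
        gcongr
        exact half_le_natCast_sub_two hV

omit [Fintype V] in
theorem measureReal_adj_and_not_adj [Finite V] {z : V} (hxy : x ≠ y) (hx : z ≠ x) (hy : z ≠ y) :
    G(V, p).real {G | G.Adj x z ∧ ¬ G.Adj y z} = p * (1 - p) := by
  have := measureReal_forall_mem_edgeSet_and_forall_notMem (p := p) (E := {s(x, z)})
    (F := {s(y, z)}) (by simpa using hx.symm) (by simpa using hy.symm) (by simp; grind)
  simpa using this

omit [Fintype V] in
theorem measureReal_not_adj_and_not_adj [Finite V] {z : V} (hxy : x ≠ y) (hx : z ≠ x) (hy : z ≠ y) :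
    G(V, p).real {G | ¬ G.Adj x z ∧ ¬ G.Adj y z} = (1 - p) ^ 2 := by
  classical
  have := measureReal_forall_mem_edgeSet_and_forall_notMem (p := p) (E := ∅)
    (F := {s(x, z), s(y, z)}) (by simp) (by simpa using ⟨hx.symm, hy.symm⟩) (by simp)
  rw [Finset.card_pair (by grind)] at this
  simpa using this

omit [Fintype V] in
theorem measureReal_adj_and_adj [Finite V] {z : V} (hxy : x ≠ y) (hx : z ≠ x) (hy : z ≠ y) :
    G(V, p).real {G | G.Adj x z ∧ G.Adj y z} = p ^ 2 := by
  classical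
  have := measureReal_forall_mem_edgeSet_and_forall_notMem (p := p) (E := {s(x, z), s(y, z)})
    (F := ∅) (by simpa using ⟨hx.symm, hy.symm⟩) (by simp) (by simp)
  rw [Finset.card_pair (by grind)] at this
  simpa using this

theorem measureReal_not_hasPrivateNbr_le (hp : (p : ℝ) ≤ 1 / 2) (hxy : x ≠ y)
    (hV : 4 ≤ Fintype.card V) :
    G(V, p).real {G | ¬ HasPrivateNbr G x y} ≤ Real.exp (-(p / 2 / 2 * Fintype.card V)) := by
  refine le_trans (measureReal_mono fun G hG => ?_)
    (measureReal_forall_not_le_exp (F := fun a b => a ∧ ¬ b) hxy hV (div_nonneg p.2.1 zero_le_two)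
      fun z hx hy => ?_)
  · exact fun z _ hzy h => hG ⟨z, h.1, h.2, hzy⟩
  · rw [measureReal_adj_and_not_adj hxy hx hy]
    nlinarith [p.2.1]

theorem measureReal_not_hasCommonNonNbr_le (hp : (p : ℝ) ≤ 1 / 2) (hxy : x ≠ y)
    (hV : 4 ≤ Fintype.card V) :
    G(V, p).real {G | ¬ HasCommonNonNbr G x y} ≤ Real.exp (-(p / 2 / 2 * Fintype.card V)) := by
  refine le_trans (measureReal_mono fun G hG => ?_)
    (measureReal_forall_not_le_exp (F := fun a b => ¬ a ∧ ¬ b) hxy hV (div_nonneg p.2.1 zero_le_two)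
      fun z hx hy => ?_)
  · exact fun z hzx hzy h => hG ⟨z, h.1, h.2, hzx, hzy⟩
  · rw [measureReal_not_adj_and_not_adj hxy hx hy]
    nlinarith [p.2.1]

theorem measureReal_not_hasCommonNbr_le (hxy : x ≠ y) (hV : 4 ≤ Fintype.card V) :
    G(V, p).real {G | ¬ HasCommonNbr G x y} ≤ Real.exp (-(p ^ 2 / 2 * Fintype.card V)) := by
  refine le_trans (measureReal_mono fun G hG => ?_)
    (measureReal_forall_not_le_exp (F := fun a b => a ∧ b) hxy hV (sq_nonneg (p : ℝ))
      fun z hx hy => (measureReal_adj_and_adj hxy hx hy).ge)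
  exact fun z _ _ h => hG ⟨z, h⟩

end CommonNeighbours

section DenseRegime

open unitInterval
open scoped SimpleGraph

theorem tendsto_natCast_pow_mul_exp_neg {β c : ℝ} (hβ : 0 < β) (hc : 0 < c) (k : ℕ) :
    Tendsto (fun n : ℕ => (n : ℝ) ^ k * Real.exp (-(c * (n : ℝ) ^ β))) atTop (𝓝 0) := by
  refine ((tendsto_rpow_mul_exp_neg_mul_atTop_nhds_zero (k / β) c hc).comp
    ((tendsto_rpow_atTop hβ).comp tendsto_natCast_atTop_atTop)).congr fun n => ?_
  simp only [Function.comp_apply]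
  rw [← Real.rpow_mul n.cast_nonneg, mul_div_cancel₀ _ hβ.ne', Real.rpow_natCast, neg_mul]

theorem AAS.forall_of_le {p : ℕ → I} {J : ℕ → Type*} [∀ n, Fintype (J n)]
    {A : ∀ n, J n → SimpleGraph (Fin n) → Prop} {b : ℕ → ℝ}
    (h : ∀ᶠ n in atTop, ∀ j, G(Fin n, p n).real {G | ¬ A n j G} ≤ b n)
    (hb : Tendsto (fun n => Fintype.card (J n) * b n) atTop (𝓝 0)) :
    AAS p fun n G => ∀ j, A n j G := by
  refine .of_le (h.mono fun n hn => ?_) hb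
  have hunion : {G | ¬ ∀ j, A n j G} = ⋃ j, {G | ¬ A n j G} := by
    ext
    simp
  calc _ ≤ ∑ j, G(Fin n, p n).real {G | ¬ A n j G} := hunion ▸ measureReal_iUnion_fintype_le _
    _ ≤ ∑ _ : J n, b n := Finset.sum_le_sum fun j _ => hn j
    _ = _ := by rw [Finset.sum_const, Finset.card_univ, nsmul_eq_mul]

theorem aas_forall_ne {p : ℕ → I} {A : ∀ n, Fin n → Fin n → SimpleGraph (Fin n) → Prop}
    {β c : ℝ} (hβ : 0 < β) (hc : 0 < c)
    (h : ∀ᶠ n : ℕ in atTop, ∀ x y : Fin n, x ≠ y →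
      G(Fin n, p n).real {G | ¬ A n x y G} ≤ Real.exp (-(c * (n : ℝ) ^ β))) :
    AAS p fun n G => ∀ x y, x ≠ y → A n x y G := by
  refine (AAS.forall_of_le (J := fun n => Fin n × Fin n)
    (A := fun n xy G => xy.1 ≠ xy.2 → A n xy.1 xy.2 G)
    (b := fun n => Real.exp (-(c * (n : ℝ) ^ β))) (h.mono fun n hn xy => ?_) ?_).mono
    (.of_forall fun n G hG x y => hG (x, y))
  · by_cases hxy : xy.1 = xy.2
    · simpa [hxy] using Real.exp_nonneg _
    · simpa [hxy] using hn xy.1 xy.2 hxy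
  · simpa [sq] using tendsto_natCast_pow_mul_exp_neg hβ hc 2

theorem coe_powEdgeProb {α : ℝ} (hα : 0 < α) (n : ℕ) :
    (powEdgeProb α hα n : ℝ) = (n : ℝ) ^ (-α) :=
  rfl

theorem natCast_mul_rpow_neg_pow {α : ℝ} (k : ℕ) {n : ℕ} (hn : 0 < n) :
    ((n : ℝ) ^ (-α)) ^ k * n = (n : ℝ) ^ (1 - α * k) := by
  simpa [mul_comm] using natCast_pow_mul_rpow_pow (α := α) 1 k hn

theorem eventually_rpow_neg_le {α : ℝ} (hα : 0 < α) {ε : ℝ} (hε : 0 < ε) :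
    ∀ᶠ n : ℕ in atTop, (n : ℝ) ^ (-α) ≤ ε :=
  ((tendsto_rpow_neg_atTop hα).comp tendsto_natCast_atTop_atTop).eventually_le_const hε

theorem aas_rich {α : ℝ} (hα : 0 < α) (hα1 : α < 1) : AAS (powEdgeProb α hα) fun _ G => Rich G := by
  have hrate {n : ℕ} (hn : 4 ≤ n) : Real.exp (-(powEdgeProb α hα n / 2 / 2 * Fintype.card (Fin n)))
      = Real.exp (-(1 / 4 * (n : ℝ) ^ (1 - α))) := by
    have := natCast_mul_rpow_neg_pow (α := α) 1 (show 0 < n by lia)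
    simp only [pow_one, Nat.cast_one, mul_one] at this
    rw [Fintype.card_fin, coe_powEdgeProb, ← this]
    ring_nf
  have hsmall := eventually_rpow_neg_le hα one_half_pos
  have hprivate := aas_forall_ne (p := powEdgeProb α hα) (A := fun n x y G => HasPrivateNbr G x y)
    (sub_pos.2 hα1) (show (0 : ℝ) < 1 / 4 by norm_num) <| by
      filter_upwards [eventually_ge_atTop 4, hsmall] with n hn hp x y hxy
      exact (measureReal_not_hasPrivateNbr_le hp hxy (by simpa)).trans_eq (hrate hn)
  have hnon := aas_forall_ne (p := powEdgeProb α hα) (A := fun n x y G => HasCommonNonNbr G x y)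
    (sub_pos.2 hα1) (show (0 : ℝ) < 1 / 4 by norm_num) <| by
      filter_upwards [eventually_ge_atTop 4, hsmall] with n hn hp x y hxy
      exact (measureReal_not_hasCommonNonNbr_le hp hxy (by simpa)).trans_eq (hrate hn)
  refine (hprivate.and hnon).mono ((eventually_ge_atTop 4).mono fun n hn G hG => ?_)
  exact ⟨Fin.nontrivial_iff_two_le.2 (by lia), hG.1, hG.2⟩

theorem obeysFOZeroOneLaw_of_lt_half {α : ℝ} (hα : 0 < α) (hα1 : α < 1 / 2) :
    ObeysFOZeroOneLaw (powEdgeProb α hα) 3 := by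
  have hcommon := aas_forall_ne (p := powEdgeProb α hα) (A := fun n x y G => HasCommonNbr G x y)
    (show 0 < 1 - α * 2 by linarith) one_half_pos <| by
      filter_upwards [eventually_ge_atTop 4] with n hn x y hxy
      refine (measureReal_not_hasCommonNbr_le hxy (by simpa)).trans_eq ?_
      have := natCast_mul_rpow_neg_pow (α := α) 2 (show 0 < n by lia)
      rw [Fintype.card_fin, coe_powEdgeProb, div_mul_eq_mul_div, this]
      ring_nf
  refine obeysFOZeroOneLaw_of_aas ((aas_rich hα (by linarith)).and hcommon) ?_
  exact fun n m G H hG hH => hG.1.graphType_subset_of_forall_hasCommonNbr hH.1 hG.2 hH.2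

end DenseRegime

section Neighbourhood

open ProbabilityTheory unitInterval
open scoped SimpleGraph

variable [Fintype V] {p : I} {x : V}

open Classical in
theorem dependsOnEdges_neighborFinset (x : V) :
    DependsOnEdges (fun G : SimpleGraph V => G.neighborFinset x) {e | x ∈ e} := by
  intro G H h
  ext y
  simpa using h s(x, y) (Sym2.mem_mk_left x y)

-- Edges at `x` and edges avoiding `x` are independent, so we may condition on the neighbourhood.
open Classical in
theorem measureReal_neighborFinset_le {R : Finset V → Prop}
    {B : Finset V → SimpleGraph V → Prop} {β : ℝ} (hβ : 0 ≤ β)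
    (hdep : ∀ S, x ∉ S → DependsOnEdges (B S) {e | x ∉ e})
    (hB : ∀ S, x ∉ S → R S → G(V, p).real {G | B S G} ≤ β) :
    G(V, p).real {G | B (G.neighborFinset x) G} ≤
      G(V, p).real {G | ¬ R (G.neighborFinset x)} + β := by
  set J : Finset (Finset V) := {S | x ∉ S ∧ R S}
  have hsub : {G | B (G.neighborFinset x) G} ⊆
      {G | ¬ R (G.neighborFinset x)} ∪ ⋃ S ∈ J, {G | G.neighborFinset x = S ∧ B S G} := by
    intro G hG
    by_cases hR : R (G.neighborFinset x)
    · exact .inr (Set.mem_biUnion (x := G.neighborFinset x) (by simp [J, hR]) ⟨rfl, hG⟩)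
    · exact .inl hR
  have hcond : ∀ S ∈ J, G(V, p).real {G | G.neighborFinset x = S ∧ B S G} ≤
      G(V, p).real ((fun G => G.neighborFinset x) ⁻¹' {S}) * β := by
    intro S hS
    obtain ⟨hxS, hR⟩ : x ∉ S ∧ R S := by simpa [J] using hS
    have hindep := measureReal_and_of_disjoint (p := p)
      ((dependsOnEdges_neighborFinset x).comp (· = S)) (hdep S hxS)
      (Set.disjoint_left.2 fun _ h h' => h' h)
    refine hindep.trans_le ?_
    exact mul_le_mul_of_nonneg_left (hB S hxS hR) measureReal_nonneg
  calc _ ≤ _ := (measureReal_mono hsub).trans (measureReal_union_le _ _)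
    _ ≤ _ := by
      gcongr
      calc _ ≤ ∑ S ∈ J, G(V, p).real {G | G.neighborFinset x = S ∧ B S G} :=
            measureReal_biUnion_finset_le _ _
        _ ≤ ∑ S ∈ J, G(V, p).real ((fun G => G.neighborFinset x) ⁻¹' {S}) * β :=
            Finset.sum_le_sum hcond
        _ ≤ 1 * β := by
            rw [← Finset.sum_mul, sum_measureReal_preimage_singleton J fun _ _ => .of_discrete]
            gcongr
            exact measureReal_le_one
        _ = β := one_mul β

omit [Fintype V] in
theorem integral_pow_card_filter [Finite V] {J : Type*} {A : J → SimpleGraph V → Prop}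
    [∀ G, DecidablePred (A · G)] {D : J → Set (Sym2 V)} {s : Finset J} {q : ℝ}
    (hA : ∀ j ∈ s, DependsOnEdges (A j) (D j)) (hD : (s : Set J).PairwiseDisjoint D)
    (hq : ∀ j ∈ s, G(V, p).real {G | A j G} = q) (a : ℝ) :
    ∫ G, a ^ (s.filter (A · G)).card ∂G(V, p) = (1 + q * (a - 1)) ^ s.card := by
  have hprod (G : SimpleGraph V) :
      a ^ (s.filter (A · G)).card = ∏ j ∈ s, ({G | A j G}.indicator (fun _ => a - 1) G + 1) := by
    rw [← Finset.prod_const, Finset.prod_filter]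
    exact Finset.prod_congr rfl fun j _ => by by_cases h : A j G <;> simp [h]
  have hdep : ∀ j ∈ s, DependsOnEdges
      (fun G => {G | A j G}.indicator (fun _ => a - 1) G + 1) (D j) := fun j hj G G' h => by
    simp only [Set.indicator_apply, Set.mem_ofPred_eq, hA j hj h]
  simp only [hprod]
  rw [integral_prod_of_pairwiseDisjoint hdep hD]
  refine Finset.prod_eq_pow_card fun j hj => ?_
  rw [integral_add .of_finite .of_finite, integral_indicator_const _ .of_discrete, hq j hj,
    integral_const, probReal_univ, smul_eq_mul, one_smul, add_comm]

open Classical in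
theorem mgf_card_neighborFinset (x : V) (t : ℝ) :
    mgf (fun G => ((G.neighborFinset x).card : ℝ)) G(V, p) t =
      (1 + p * (Real.exp t - 1)) ^ (Fintype.card V - 1) := by
  have hpow (G : SimpleGraph V) : Real.exp (t * (G.neighborFinset x).card) =
      Real.exp t ^ ((Finset.univ.erase x).filter fun y => s(x, y) ∈ G.edgeSet).card := by
    rw [mul_comm, Real.exp_nat_mul]
    congr 2
    ext y
    simpa using SimpleGraph.Adj.ne' (G := G)
  simp only [mgf, hpow]
  rw [integral_pow_card_filter (D := fun y => {s(x, y)}) (fun y _ => dependsOnEdges_mem s(x, y))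
      (fun y _ z _ hyz => Set.disjoint_singleton.2 fun h => hyz (Sym2.congr_right.1 h))
      fun y hy => measureReal_mem_edgeSet (Finset.ne_of_mem_erase hy).symm,
    Finset.card_erase_of_mem (Finset.mem_univ x), Finset.card_univ]

open Classical in
theorem mgf_card_neighborFinset_le (x : V) (t : ℝ) :
    mgf (fun G => ((G.neighborFinset x).card : ℝ)) G(V, p) t ≤
      Real.exp (p * (Real.exp t - 1) * (Fintype.card V - 1 : ℕ)) := by
  rw [mgf_card_neighborFinset, mul_comm _ ((_ : ℕ) : ℝ), Real.exp_nat_mul, add_comm]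
  gcongr
  · nlinarith [p.2.1, p.2.2, Real.exp_pos t]
  · exact Real.add_one_le_exp _

open Classical in
theorem measureReal_three_mul_le_card_neighborFinset_le (x : V) :
    G(V, p).real {G | 3 * ((Fintype.card V : ℝ) * p) ≤ ((G.neighborFinset x).card : ℝ)} ≤
      Real.exp (-(Fintype.card V * p / 8)) := by
  refine (measure_ge_le_exp_mul_mgf _ zero_le_one (.of_finite)).trans ?_
  refine (mul_le_mul_of_nonneg_left (mgf_card_neighborFinset_le x 1) (Real.exp_nonneg _)).trans ?_
  rw [← Real.exp_add, Real.exp_le_exp]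
  have hp := p.2.1
  have hcard : ((Fintype.card V - 1 : ℕ) : ℝ) ≤ Fintype.card V := by
    exact_mod_cast Nat.sub_le _ 1
  have hmain : (p : ℝ) * (Real.exp 1 - 1) * (Fintype.card V - 1 : ℕ) ≤ p * 2 * Fintype.card V := by
    gcongr
    linarith [Real.exp_one_lt_d9]
  linarith [mul_nonneg (Fintype.card V).cast_nonneg hp]

open Classical in
theorem measureReal_card_neighborFinset_le_div_four_le (hV : 4 ≤ Fintype.card V) (x : V) :
    G(V, p).real {G | ((G.neighborFinset x).card : ℝ) ≤ Fintype.card V * p / 4} ≤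
      Real.exp (-(Fintype.card V * p / 8)) := by
  refine (measure_le_le_exp_mul_mgf _ (show (-1 : ℝ) ≤ 0 by norm_num) (.of_finite)).trans ?_
  refine (mul_le_mul_of_nonneg_left (mgf_card_neighborFinset_le x (-1))
    (Real.exp_nonneg _)).trans ?_
  rw [← Real.exp_add, Real.exp_le_exp]
  have hp := p.2.1
  have hexp : Real.exp (-1) ≤ 2 / 5 := by
    rw [Real.exp_neg, inv_le_comm₀ (Real.exp_pos _) (by norm_num)]
    linarith [Real.exp_one_gt_d9]
  have hcard : 3 / 4 * (Fintype.card V : ℝ) ≤ (Fintype.card V - 1 : ℕ) := by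
    have : (4 : ℝ) ≤ Fintype.card V := by exact_mod_cast hV
    push_cast [Nat.cast_sub (show 1 ≤ Fintype.card V by lia)]
    linarith
  have hmain : (p : ℝ) * (3 / 5) * (3 / 4 * Fintype.card V) ≤
      p * (1 - Real.exp (-1)) * (Fintype.card V - 1 : ℕ) := by
    gcongr
    · exact mul_nonneg hp (by linarith)
    · linarith
  linarith [mul_nonneg (Fintype.card V).cast_nonneg hp]

open Classical in
theorem measureReal_card_neighborFinset_notMem_Icc_le (hV : 4 ≤ Fintype.card V) (x : V) :
    G(V, p).real {G | ((G.neighborFinset x).card : ℝ) ∉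
      Set.Icc (Fintype.card V * p / 4 : ℝ) (3 * (Fintype.card V * p))} ≤
      2 * Real.exp (-(Fintype.card V * p / 8)) := by
  refine (measureReal_mono fun G hG => ?_).trans ((measureReal_union_le _ _).trans
    ((add_le_add (measureReal_card_neighborFinset_le_div_four_le hV x)
      (measureReal_three_mul_le_card_neighborFinset_le x)).trans_eq (two_mul _).symm))
  rcases not_and_or.1 hG with h | h
  · exact .inl (not_le.1 h).le
  · exact .inr (not_le.1 h).le

end Neighbourhood

section VertexSets

open ProbabilityTheory unitInterval
open scoped SimpleGraph

theorem DependsOnEdges.filter {J : Type*} {A : J → SimpleGraph V → Prop}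
    [∀ G, DecidablePred (A · G)] {D : J → Set (Sym2 V)} {s : Finset J}
    (hA : ∀ j ∈ s, DependsOnEdges (A j) (D j)) :
    DependsOnEdges (fun G => s.filter (A · G)) (⋃ j ∈ s, D j) := fun _ _ h =>
  Finset.filter_congr fun j hj => iff_of_eq (hA j hj fun e he => h e (Set.mem_biUnion hj he))

theorem dependsOnEdges_forall_not_adj (y : V) (S : Finset V) :
    DependsOnEdges (fun G => ∀ z ∈ S, ¬ G.Adj y z) ((s(y, ·)) '' (S : Set V)) := fun _ _ h =>
  propext (forall₂_congr fun _ hz => not_congr (h _ (Set.mem_image_of_mem _ hz)))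

theorem pairwiseDisjoint_image_mk {T R : Finset V} (hTR : Disjoint T R) :
    (T : Set V).PairwiseDisjoint fun y => (s(y, ·)) '' (R : Set V) := by
  intro y hy y' _ hne
  rw [Function.onFun, Set.disjoint_left]
  rintro _ ⟨z, -, rfl⟩ ⟨z', hz', h⟩
  rcases Sym2.eq_iff.1 h with ⟨rfl, -⟩ | ⟨-, rfl⟩
  · exact hne rfl
  · exact Finset.disjoint_left.1 hTR hy hz'

theorem card_filter_forall_not_adj_le [DecidableEq V] {G : SimpleGraph V} {T R : Finset V}
    [DecidablePred fun y => ∀ z ∈ R, ¬ G.Adj y z] [DecidablePred (· ∈ G.edgeSet)]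
    (h : ∀ y ∈ T, ∃ z ∈ T ∪ R, G.Adj y z) :
    (T.filter fun y => ∀ z ∈ R, ¬ G.Adj y z).card ≤
      ((cliqueEdges T).filter (· ∈ G.edgeSet)).card * 2 := by
  refine (Finset.card_le_card (t := ((cliqueEdges T).filter (· ∈ G.edgeSet)).biUnion Sym2.toFinset)
    fun y hy => ?_).trans (Finset.card_biUnion_le_card_mul _ _ _ fun e _ => ?_)
  · obtain ⟨hyT, hyR⟩ := Finset.mem_filter.1 hy
    obtain ⟨z, hz, hyz⟩ := h y hyT
    have hzT : z ∈ T := (Finset.mem_union.1 hz).resolve_right fun hzR => hyR z hzR hyz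
    refine Finset.mem_biUnion.2 ⟨s(y, z), Finset.mem_filter.2 ⟨?_, hyz⟩, by simp⟩
    exact mem_cliqueEdges.2 ⟨hyT, hzT, hyz.ne⟩
  · rw [Sym2.card_toFinset]
    split_ifs <;> norm_num

theorem exp_neg_six_le_one_sub_pow {q : ℝ} (hq : q ≤ 1 / 2) {s : ℕ} (hq0 : 0 ≤ q)
    (hs : s * q ≤ 3) : Real.exp (-6) ≤ (1 - q) ^ s := by
  have hbase : Real.exp (-(2 * q)) ≤ 1 - q := by
    rw [Real.exp_neg, inv_le_comm₀ (Real.exp_pos _) (by linarith)]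
    refine le_trans ?_ (Real.add_one_le_exp _)
    rw [inv_le_iff_one_le_mul₀ (by linarith)]
    nlinarith
  calc Real.exp (-6) ≤ Real.exp (s * -(2 * q)) := Real.exp_le_exp.2 (by linarith)
    _ = Real.exp (-(2 * q)) ^ s := Real.exp_nat_mul _ _
    _ ≤ (1 - q) ^ s := by gcongr

theorem not_isDiag_of_mem_cliqueEdges [DecidableEq V] {T : Finset V} {e : Sym2 V}
    (he : e ∈ cliqueEdges T) : ¬ e.IsDiag := by
  induction e with | _ y z => exact (mem_cliqueEdges.1 he).2.2

variable [Finite V] {p : I}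

theorem measureReal_forall_not_adj {y : V} {S : Finset V} (hy : y ∉ S) :
    G(V, p).real {G | ∀ z ∈ S, ¬ G.Adj y z} = (1 - p) ^ S.card := by
  classical
  have := measureReal_forall_mem_edgeSet_and_forall_notMem (p := p) (E := ∅)
    (F := S.image fun z => s(y, z)) (by simp) (by simpa using fun h => hy h) (by simp)
  rw [Finset.card_image_of_injective _ fun _ _ => Sym2.congr_right.1] at this
  simpa using this

-- Markov's inequality for the weight with a factor `1 / 2` for each vertex of `T` without a
-- neighbour in `R` and a factor `4` for each edge within `T`: it is at least `1` on the event, as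
-- each edge serves at most two vertices, and its factors are independent.
theorem measureReal_forall_exists_adj_union_le [DecidableEq V] {T R : Finset V}
    (hTR : Disjoint T R) :
    G(V, p).real {G | ∀ y ∈ T, ∃ z ∈ T ∪ R, G.Adj y z} ≤
      (1 - (1 - p) ^ R.card / 2) ^ T.card * (1 + 3 * p) ^ T.card.choose 2 := by
  classical
  let f (G : SimpleGraph V) : ℝ := (1 / 2) ^ (T.filter fun y => ∀ z ∈ R, ¬ G.Adj y z).card
  let g (G : SimpleGraph V) : ℝ := 4 ^ ((cliqueEdges T).filter (· ∈ G.edgeSet)).card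
  have hf : ∫ G, f G ∂G(V, p) = (1 - (1 - p) ^ R.card / 2) ^ T.card := by
    refine (integral_pow_card_filter (fun y _ => dependsOnEdges_forall_not_adj y R)
      (pairwiseDisjoint_image_mk hTR) (fun y hy =>
        measureReal_forall_not_adj (Finset.disjoint_left.1 hTR hy)) (1 / 2)).trans ?_
    ring_nf
  have hg : ∫ G, g G ∂G(V, p) = (1 + 3 * p) ^ T.card.choose 2 := by
    refine (integral_pow_card_filter (fun e _ => dependsOnEdges_mem e)
      (fun _ _ _ _ => Set.disjoint_singleton.2)
      (fun e he => measureReal_mem_edgeSet (not_isDiag_of_mem_cliqueEdges he)) 4).trans ?_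
    rw [card_cliqueEdges]
    ring_nf
  have hfdep : DependsOnEdges f (⋃ y ∈ T, (s(y, ·)) '' (R : Set V)) := fun _ _ h =>
    congrArg (fun S : Finset V => (1 / 2 : ℝ) ^ S.card)
      (DependsOnEdges.filter (fun y _ => dependsOnEdges_forall_not_adj y R) h)
  have hgdep : DependsOnEdges g (⋃ e ∈ cliqueEdges T, {e}) := fun _ _ h =>
    congrArg (fun E : Finset (Sym2 V) => (4 : ℝ) ^ E.card)
      (DependsOnEdges.filter (fun e _ => dependsOnEdges_mem e) h)
  have hindep : IndepFun f g G(V, p) := by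
    refine hfdep.indepFun hgdep ?_
    simp only [Set.disjoint_iUnion_right, Set.disjoint_singleton_right, Set.mem_iUnion₂]
    rintro _ he ⟨y, -, z, hz, rfl⟩
    exact Finset.disjoint_left.1 hTR (mem_cliqueEdges.1 he).2.1 hz
  have hweight (G : SimpleGraph V) (hG : ∀ y ∈ T, ∃ z ∈ T ∪ R, G.Adj y z) : 1 ≤ f G * g G := by
    calc (1 : ℝ) = (1 / 2) ^ (((cliqueEdges T).filter (· ∈ G.edgeSet)).card * 2) * g G := by
          rw [mul_comm _ 2, pow_mul, ← mul_pow]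
          norm_num
      _ ≤ f G * g G := mul_le_mul_of_nonneg_right (pow_le_pow_of_le_one (by norm_num) (by norm_num)
          (card_filter_forall_not_adj_le hG)) (by positivity)
  rw [← hf, ← hg, ← hindep.integral_fun_mul_eq_mul_integral
    Measurable.of_discrete.aestronglyMeasurable Measurable.of_discrete.aestronglyMeasurable]
  exact (measureReal_mono hweight).trans ((one_mul _).symm.trans_le
    (mul_meas_ge_le_integral_of_nonneg (.of_forall fun G => by positivity) .of_finite 1))

theorem measureReal_forall_exists_adj_le {S S' : Finset V} {t : ℕ} (hp : (p : ℝ) ≤ 1 / 2)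
    (hS : S.card * (p : ℝ) ≤ 3) (ht : t ≤ S'.card) (htp : t * (p : ℝ) ≤ Real.exp (-6) / 6) :
    G(V, p).real {G | ∀ y ∈ S', ∃ z ∈ S, G.Adj y z} ≤ Real.exp (-(Real.exp (-6) / 4 * t)) := by
  classical
  obtain ⟨T, hT, rfl⟩ := Finset.exists_subset_card_eq ht
  have hp0 := p.2.1
  have hR : Real.exp (-6) ≤ (1 - p : ℝ) ^ (S \ T).card :=
    exp_neg_six_le_one_sub_pow hp hp0 <|
      (mul_le_mul_of_nonneg_right (by gcongr; exact Finset.sdiff_subset) hp0).trans hS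
  have hpow : (1 - p : ℝ) ^ (S \ T).card ≤ 1 := pow_le_one₀ (by linarith [p.2.2]) (by linarith)
  have hchoose : (T.card.choose 2 : ℝ) ≤ T.card ^ 2 / 2 := by
    simpa using Nat.choose_le_pow_div (α := ℝ) 2 T.card
  calc _ ≤ G(V, p).real {G | ∀ y ∈ T, ∃ z ∈ T ∪ S \ T, G.Adj y z} :=
        measureReal_mono fun G hG y hy => (hG y (hT hy)).imp fun z hz => by grind
    _ ≤ _ := measureReal_forall_exists_adj_union_le Finset.disjoint_sdiff
    _ ≤ Real.exp (-(Real.exp (-6) / 2)) ^ T.card * Real.exp (3 * p) ^ T.card.choose 2 := by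
        gcongr
        · linarith
        · linarith [Real.one_sub_le_exp_neg (Real.exp (-6) / 2)]
        · linarith [Real.add_one_le_exp (3 * p : ℝ)]
    _ = Real.exp (T.card * -(Real.exp (-6) / 2) + T.card.choose 2 * (3 * p)) := by
        rw [Real.exp_add, Real.exp_nat_mul, Real.exp_nat_mul]
    _ ≤ _ := by
        rw [Real.exp_le_exp]
        nlinarith [mul_le_mul_of_nonneg_left htp (T.card).cast_nonneg (α := ℝ)]

theorem measureReal_forall_forall_not_adj_le {S : Finset V} (hS : 2 ≤ S.card) :
    G(V, p).real {G | ∀ y ∈ S, ∀ z ∈ S, ¬ G.Adj y z} ≤ Real.exp (-(p * (S.card ^ 2 / 4))) := by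
  classical
  have hprob := measureReal_forall_mem_edgeSet_and_forall_notMem (p := p) (E := ∅)
    (F := cliqueEdges S) (by simp) (fun _ => not_isDiag_of_mem_cliqueEdges) (by simp)
  have hsub : {G : SimpleGraph V | ∀ y ∈ S, ∀ z ∈ S, ¬ G.Adj y z} ⊆
      {G | (∀ e ∈ (∅ : Finset (Sym2 V)), e ∈ G.edgeSet) ∧ ∀ e ∈ cliqueEdges S, e ∉ G.edgeSet} := by
    refine fun G hG => ⟨by simp, fun e he => ?_⟩
    induction e with | _ y z =>
      obtain ⟨hy, hz, -⟩ := mem_cliqueEdges.1 he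
      exact hG y hy z hz
  have hchoose : (S.card : ℝ) ^ 2 / 4 ≤ S.card.choose 2 := by
    have : (2 : ℝ) ≤ S.card := by exact_mod_cast hS
    rw [Nat.cast_choose_two]
    nlinarith
  calc _ ≤ _ := measureReal_mono hsub
    _ = (1 - p : ℝ) ^ S.card.choose 2 := by
        rw [hprob, card_cliqueEdges, Finset.card_empty, pow_zero, one_mul]
    _ ≤ Real.exp (-p) ^ S.card.choose 2 := by
        gcongr
        · linarith [p.2.2]
        · exact Real.one_sub_le_exp_neg _
    _ = Real.exp (-(p * S.card.choose 2)) := by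
        rw [← Real.exp_nat_mul]
        ring_nf
    _ ≤ _ := by
        gcongr
        exact p.2.1

end VertexSets

section VertexPairs

open ProbabilityTheory unitInterval
open scoped SimpleGraph

variable [Fintype V] {p : I} {x : V}

open Classical in
theorem measureReal_neighborFinset_le_of_card_mem_Icc (hV : 4 ≤ Fintype.card V)
    {B : Finset V → SimpleGraph V → Prop} {β : ℝ} (hβ : 0 ≤ β)
    (hdep : ∀ S, x ∉ S → DependsOnEdges (B S) {e | x ∉ e})
    (hB : ∀ S, x ∉ S → (S.card : ℝ) ∈
      Set.Icc (Fintype.card V * p / 4 : ℝ) (3 * (Fintype.card V * p)) →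
      G(V, p).real {G | B S G} ≤ β) :
    G(V, p).real {G | B (G.neighborFinset x) G} ≤
      2 * Real.exp (-(Fintype.card V * p / 8)) + β :=
  (measureReal_neighborFinset_le hβ hdep hB).trans
    (add_le_add_left (measureReal_card_neighborFinset_notMem_Icc_le hV x) β)

open Classical in
theorem measureReal_forall_exists_adj_neighborFinset_le (hV : 4 ≤ Fintype.card V)
    (hp : (p : ℝ) ≤ 1 / 2) (hVp : (Fintype.card V : ℝ) * p ^ 2 ≤ 1) {F : Finset V → Finset V}
    {t : ℕ} (hF : ∀ S, x ∉ S → x ∉ F S)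
    (ht : ∀ S, x ∉ S → (S.card : ℝ) ∈
      Set.Icc (Fintype.card V * p / 4 : ℝ) (3 * (Fintype.card V * p)) → t ≤ (F S).card)
    (htp : t * (p : ℝ) ≤ Real.exp (-6) / 6) :
    G(V, p).real {G | ∀ y ∈ F (G.neighborFinset x), ∃ z ∈ G.neighborFinset x, G.Adj y z} ≤
      2 * Real.exp (-(Fintype.card V * p / 8)) + Real.exp (-(Real.exp (-6) / 4 * t)) := by
  refine measureReal_neighborFinset_le_of_card_mem_Icc hV
    (B := fun S G => ∀ y ∈ F S, ∃ z ∈ S, G.Adj y z) (Real.exp_pos _).le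
    (fun S hxS => ?_) fun S hxS hS => ?_
  · refine fun G H h => propext (forall₂_congr fun y hy => exists_congr fun z =>
      and_congr_right fun hz => h s(y, z) fun hx => ?_)
    rcases Sym2.mem_iff.1 hx with rfl | rfl
    · exact hF S hxS hy
    · exact hxS hz
  · refine measureReal_forall_exists_adj_le hp ?_ (ht S hxS hS) htp
    nlinarith [mul_le_mul_of_nonneg_right hS.2 p.2.1]

open Classical in
theorem forall_exists_adj_of_not_hasSparsePairs {G : SimpleGraph V} (h : ¬ HasSparsePairs G x) :
    (∀ y ∈ G.neighborFinset x, ∃ z ∈ G.neighborFinset x, G.Adj y z) ∨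
      ∀ y ∈ (insert x (G.neighborFinset x))ᶜ, ∃ z ∈ G.neighborFinset x, G.Adj y z := by
  simp only [Finset.mem_compl, Finset.mem_insert, SimpleGraph.mem_neighborFinset, not_or]
  refine (not_and_or.1 h).imp (fun h y hy => ?_) fun h y hy => ?_ <;> by_contra hcon
  · exact h ⟨y, hy, hcon⟩
  · exact h ⟨y, hy.1, hy.2, hcon⟩

theorem measureReal_not_hasSparsePairs_le_add (hV : 4 ≤ Fintype.card V) (hp : (p : ℝ) ≤ 1 / 12)
    (hVp : (Fintype.card V : ℝ) * p ^ 2 ≤ 1) {t : ℕ} (ht : (t : ℝ) ≤ Fintype.card V * p / 4)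
    (htp : t * (p : ℝ) ≤ Real.exp (-6) / 6) :
    G(V, p).real {G | ¬ HasSparsePairs G x} ≤
      4 * Real.exp (-(Fintype.card V * p / 8)) + 2 * Real.exp (-(Real.exp (-6) / 4 * t)) := by
  classical
  have hV' : (4 : ℝ) ≤ Fintype.card V := by exact_mod_cast hV
  have hadj := measureReal_forall_exists_adj_neighborFinset_le (x := x) hV (by linarith) hVp
    (F := id) (t := t) (fun _ h => h) (fun S _ hS => by exact_mod_cast ht.trans hS.1) htp
  have hnotAdj := measureReal_forall_exists_adj_neighborFinset_le (x := x) hV (by linarith) hVp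
    (F := fun S => (insert x S)ᶜ) (t := t) (fun S _ => by simp) (fun S hxS hS => by
      suffices (t : ℝ) + (S.card + 1) ≤ Fintype.card V by
        rw [Finset.card_compl, Finset.card_insert_of_notMem hxS]
        exact Nat.le_sub_of_add_le (by exact_mod_cast this)
      nlinarith [hS.2]) htp
  exact (measureReal_mono fun G hG => forall_exists_adj_of_not_hasSparsePairs hG).trans
    ((measureReal_union_le _ _).trans ((add_le_add hadj hnotAdj).trans (by linarith)))

theorem measureReal_not_hasSparsePairs_le (hV : 4 ≤ Fintype.card V) (hp : (p : ℝ) ≤ 1 / 12)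
    (hVp : (Fintype.card V : ℝ) * p ^ 2 ≤ 1)
    (hVp' : 2 ≤ Real.exp (-6) / 6 * ((Fintype.card V : ℝ) * p)) :
    G(V, p).real {G | ¬ HasSparsePairs G x} ≤
      6 * Real.exp (-(Real.exp (-6) ^ 2 / 48 * (Fintype.card V * p))) := by
  set m : ℝ := (Fintype.card V : ℝ) * p
  set c := Real.exp (-6)
  have hc0 : 0 < c := Real.exp_pos _
  have hc1 : c ≤ 1 := Real.exp_le_one_iff.2 (by norm_num)
  have hm0 : 0 ≤ m := mul_nonneg (Nat.cast_nonneg _) p.2.1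
  set t := ⌊c / 6 * m⌋₊
  have htm : (t : ℝ) ≤ c / 6 * m := Nat.floor_le (by positivity)
  have hmt : c / 6 * m / 2 ≤ t := by linarith [Nat.lt_floor_add_one (c / 6 * m)]
  have htp : t * (p : ℝ) ≤ c / 6 :=
    calc t * (p : ℝ) ≤ c / 6 * m * p := mul_le_mul_of_nonneg_right htm p.2.1
      _ = c / 6 * (Fintype.card V * p ^ 2) := by ring
      _ ≤ c / 6 := mul_le_of_le_one_right (by positivity) hVp
  have hdeg : Real.exp (-(m / 8)) ≤ Real.exp (-(c ^ 2 / 48 * m)) := by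
    rw [Real.exp_le_exp]
    nlinarith
  have hpair : Real.exp (-(c / 4 * t)) ≤ Real.exp (-(c ^ 2 / 48 * m)) := by
    rw [Real.exp_le_exp]
    nlinarith
  exact (measureReal_not_hasSparsePairs_le_add hV hp hVp (by nlinarith) htp).trans (by linarith)

theorem measureReal_not_inTriangle_le (hV : 4 ≤ Fintype.card V)
    (hVp : 8 ≤ (Fintype.card V : ℝ) * p) :
    G(V, p).real {G | ¬ InTriangle G x} ≤ 2 * Real.exp (-(Fintype.card V * p / 8)) +
      Real.exp (-(Fintype.card V ^ 2 * p ^ 3 / 64)) := by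
  refine (measureReal_mono fun G hG y hy z hz hyz => ?_).trans
    (measureReal_neighborFinset_le_of_card_mem_Icc hV (x := x)
      (B := fun S G => ∀ y ∈ S, ∀ z ∈ S, ¬ G.Adj y z) (Real.exp_pos _).le
      (fun S hxS => ?_) fun S _ hS => ?_)
  · rw [SimpleGraph.mem_neighborFinset] at hy hz
    exact hG ⟨y, hy, z, hz, hyz⟩
  · refine fun G H h => propext (forall₂_congr fun y hy => forall₂_congr fun z hz =>
      not_congr (h s(y, z) fun hx => ?_))
    rcases Sym2.mem_iff.1 hx with rfl | rfl
    · exact hxS hy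
    · exact hxS hz
  · have hcard : (2 : ℝ) ≤ S.card := by linarith [hS.1]
    refine (measureReal_forall_forall_not_adj_le (by exact_mod_cast hcard)).trans ?_
    rw [Real.exp_le_exp, neg_le_neg_iff]
    calc (Fintype.card V ^ 2 * p ^ 3 / 64 : ℝ) = p * ((Fintype.card V * p / 4) ^ 2 / 4) := by ring
      _ ≤ p * (S.card ^ 2 / 4) := by
        gcongr
        · exact p.2.1
        exact hS.1

end VertexPairs

section MiddleRegime

open unitInterval
open scoped SimpleGraph

theorem card_le_three_mul_cliqueCount_three [Fintype V] {G : SimpleGraph V}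
    (hG : ∀ x, InTriangle G x) : (Fintype.card V : ℝ) ≤ 3 * cliqueCount 3 G := by
  classical
  have hcover : (Finset.univ : Finset V) ⊆ (G.cliqueFinset 3).biUnion id := by
    intro x _
    obtain ⟨y, hxy, z, hxz, hyz⟩ := hG x
    exact Finset.mem_biUnion.2 ⟨{x, y, z}, SimpleGraph.mem_cliqueFinset_iff.2
      (SimpleGraph.is3Clique_triple_iff.2 ⟨hxy, hxz, hyz⟩), by simp⟩
  have hcard : Fintype.card V ≤ (G.cliqueFinset 3).card * 3 :=
    (Finset.card_le_card hcover).trans <| Finset.card_biUnion_le_card_mul _ _ _ fun s hs =>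
      (SimpleGraph.mem_cliqueFinset_iff.1 hs).card_eq.le
  have hcount : (G.cliqueFinset 3).card ≤ Nat.card {s : {s : Finset V // s.card = 3} //
      s ∈ {s | G ∈ {G : SimpleGraph V | G.IsClique s.1}}} := by
    rw [← Nat.card_eq_finsetCard]
    refine Nat.card_le_card_of_injective (fun s => ⟨⟨s.1, ?_⟩, ?_⟩) fun s t h => ?_
    · exact (SimpleGraph.mem_cliqueFinset_iff.1 s.2).card_eq
    · exact (SimpleGraph.mem_cliqueFinset_iff.1 s.2).isClique
    · exact Subtype.ext (congrArg (·.1.1) h)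
  rw [cliqueCount, eventCount_eq_card]
  exact_mod_cast hcard.trans ((Nat.mul_le_mul_right 3 hcount).trans_eq (mul_comm _ _))

theorem exists_inTriangle_of_cliqueCount_three_ne_zero [Fintype V] {G : SimpleGraph V}
    (hG : cliqueCount 3 G ≠ 0) : ∃ x, InTriangle G x := by
  classical
  contrapose! hG
  refine cliqueCount_eq_zero fun s hs => ?_
  obtain ⟨x, y, z, hxy, hxz, hyz, -⟩ := SimpleGraph.is3Clique_iff.1 hs
  exact hG x ⟨y, hxy, z, hxz, hyz⟩

theorem natCast_mul_rpow_neg_sq_le_one {α : ℝ} (hα : 1 / 2 ≤ α) {n : ℕ} (hn : 0 < n) :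
    (n : ℝ) * ((n : ℝ) ^ (-α)) ^ 2 ≤ 1 := by
  rw [mul_comm, natCast_mul_rpow_neg_pow 2 hn]
  refine Real.rpow_le_one_of_one_le_of_nonpos (by exact_mod_cast hn) ?_
  push_cast
  linarith

theorem choose_three_mul_rpow_neg_pow_le {α : ℝ} (hα : 2 / 3 ≤ α) {n : ℕ} (hn : 0 < n) :
    (n.choose 3 : ℝ) * ((n : ℝ) ^ (-α)) ^ 3 ≤ n / 6 :=
  calc (n.choose 3 : ℝ) * ((n : ℝ) ^ (-α)) ^ 3
      ≤ n ^ 3 / (Nat.factorial 3 : ℕ) * ((n : ℝ) ^ (-α)) ^ 3 := by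
        gcongr
        exact Nat.choose_le_pow_div 3 n
    _ = (n : ℝ) ^ (((3 : ℕ) : ℝ) - α * (3 : ℕ)) / 6 := by
        rw [← natCast_pow_mul_rpow_pow 3 3 hn]
        norm_num [Nat.factorial]
        ring
    _ ≤ (n : ℝ) ^ (1 : ℝ) / 6 := by
        gcongr
        · exact_mod_cast hn
        · push_cast
          linarith
    _ = n / 6 := by rw [Real.rpow_one]

variable {α : ℝ} (hα : 0 < α)

theorem tendsto_natCast_mul_rpow_neg_atTop (hα1 : α < 1) :
    Tendsto (fun n : ℕ => (n : ℝ) * (n : ℝ) ^ (-α)) atTop atTop := by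
  simpa using tendsto_natCast_pow_mul_rpow_pow_atTop (α := α) (m := 1) (e := 1) (by simpa)

theorem aas_exists_inTriangle_and_exists_not_inTriangle (h1 : 2 / 3 ≤ α) (h2 : α < 1) :
    AAS (powEdgeProb α hα) fun _ G => (∃ x, InTriangle G x) ∧ ∃ x, ¬ InTriangle G x := by
  set M : ℕ → ℝ := fun n => n.choose 3 * ((n : ℝ) ^ (-α)) ^ 3
  have hmean (n : ℕ) : ∫ G, cliqueCount 3 G ∂G(Fin n, powEdgeProb α hα n) = M n := by
    rw [integral_cliqueCount, Fintype.card_fin]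
    rfl
  have hM : Tendsto M atTop atTop := by
    have hpow := tendsto_natCast_pow_mul_rpow_pow_atTop (α := α) (m := 3) (e := 3)
      (by push_cast; linarith)
    refine ((tendsto_choose_div_pow 3).pos_mul_atTop (by positivity) hpow).congr' ?_
    filter_upwards [eventually_gt_atTop 0] with n hn
    field_simp
    rfl
  have hMpos := hM.eventually_gt_atTop 0
  have hconc := aas_abs_sub_integral_lt (p := powEdgeProb α hα) (X := fun _ => cliqueCount 3)
    (b := fun n => 1 + 4 / M n) (by simpa only [hmean] using hMpos) ?_
    (by simpa using (hM.const_div_atTop 4).const_add 1)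
  · refine hconc.mono ?_
    filter_upwards [hMpos, eventually_gt_atTop 0] with n hMn hn G hG
    have hn' : (0 : ℝ) < n := by exact_mod_cast hn
    have hMle := choose_three_mul_rpow_neg_pow_le h1 hn
    rw [hmean, abs_lt] at hG
    refine ⟨exists_inTriangle_of_cliqueCount_three_ne_zero (by linarith), ?_⟩
    by_contra! hall
    have := card_le_three_mul_cliqueCount_three hall
    rw [Fintype.card_fin] at this
    linarith
  · filter_upwards [hMpos, eventually_gt_atTop 0] with n hMn hn
    have hq := natCast_mul_rpow_neg_sq_le_one (by linarith : 1 / 2 ≤ α) hn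
    rw [hmean]
    refine integral_cliqueCount_three_sq_le.trans ?_
    rw [Fintype.card_fin, coe_powEdgeProb]
    calc M n ^ 2 + (3 * n * ((n : ℝ) ^ (-α)) ^ 2 + 1) * M n ≤ M n ^ 2 + 4 * M n := by
          gcongr
          linarith
      _ = (1 + 4 / M n) * M n ^ 2 := by
          field_simp

theorem aas_forall_hasSparsePairs (h1 : 1 / 2 ≤ α) (h2 : α < 1) :
    AAS (powEdgeProb α hα) fun _ G => ∀ x, HasSparsePairs G x := by
  have hc : 0 < Real.exp (-6) ^ 2 / 48 := by positivity
  refine .forall_of_le (J := fun n => Fin n) (A := fun _ x G => HasSparsePairs G x)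
    (b := fun n => 6 * Real.exp (-(Real.exp (-6) ^ 2 / 48 * (n : ℝ) ^ (1 - α)))) ?_ ?_
  · filter_upwards [eventually_ge_atTop 4, eventually_rpow_neg_le hα (ε := 1 / 12) (by norm_num),
      ((tendsto_natCast_mul_rpow_neg_atTop h2).const_mul_atTop
        (by positivity : 0 < Real.exp (-6) / 6)).eventually_ge_atTop 2] with n hn hsmall hlarge x
    have hn0 : 0 < n := by lia
    refine (measureReal_not_hasSparsePairs_le (by simpa) hsmall ?_ (by simpa)).trans_eq ?_
    · rw [Fintype.card_fin]
      exact natCast_mul_rpow_neg_sq_le_one h1 hn0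
    · have := natCast_mul_rpow_neg_pow (α := α) 1 hn0
      simp only [pow_one, Nat.cast_one, mul_one] at this
      rw [Fintype.card_fin, coe_powEdgeProb, mul_comm (n : ℝ), this]
  · have := (tendsto_natCast_pow_mul_exp_neg (sub_pos.2 h2) hc 1).const_mul 6
    simpa [mul_left_comm] using this

theorem aas_forall_inTriangle (hα2 : α < 2 / 3) :
    AAS (powEdgeProb α hα) fun _ G => ∀ x, InTriangle G x := by
  have hβ : 0 < 2 - 3 * α := by linarith
  refine .forall_of_le (J := fun n => Fin n) (A := fun _ x G => InTriangle G x)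
    (b := fun n => 2 * Real.exp (-(1 / 8 * (n : ℝ) ^ (1 - α))) +
      Real.exp (-(1 / 64 * (n : ℝ) ^ (2 - 3 * α)))) ?_ ?_
  · filter_upwards [eventually_ge_atTop 4,
      (tendsto_natCast_mul_rpow_neg_atTop (by linarith : α < 1)).eventually_ge_atTop 8]
      with n hn hlarge x
    have hn0 : 0 < n := by lia
    refine (measureReal_not_inTriangle_le (by simpa) (by simpa)).trans_eq ?_
    have hedge := natCast_mul_rpow_neg_pow (α := α) 1 hn0
    have htriangle := natCast_pow_mul_rpow_pow (α := α) 2 3 hn0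
    simp only [pow_one, Nat.cast_one, Nat.cast_ofNat, mul_one] at hedge htriangle
    rw [Fintype.card_fin, coe_powEdgeProb, mul_comm (n : ℝ), hedge, htriangle]
    ring_nf
  · have hedge := tendsto_natCast_pow_mul_exp_neg (by linarith : 0 < 1 - α)
      (by norm_num : (0 : ℝ) < 1 / 8) 1
    have htriangle := tendsto_natCast_pow_mul_exp_neg hβ (by norm_num : (0 : ℝ) < 1 / 64) 1
    simpa [mul_add, mul_left_comm] using (hedge.const_mul 2).add htriangle

theorem obeysFOZeroOneLaw_of_half_le (h1 : 1 / 2 ≤ α) (h2 : α < 1) :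
    ObeysFOZeroOneLaw (powEdgeProb α hα) 3 := by
  have hsparse := (aas_rich hα h2).and (aas_forall_hasSparsePairs hα h1 h2)
  rcases lt_or_ge α (2 / 3) with h3 | h3
  · refine obeysFOZeroOneLaw_of_aas (hsparse.and (aas_forall_inTriangle hα h3)) ?_
    exact fun _ _ _ _ hG hH => hG.1.1.graphType_subset_of_forall_inTriangle hH.1.1
      hG.1.2 hH.1.2 hG.2 hH.2
  · refine obeysFOZeroOneLaw_of_aas
      (hsparse.and (aas_exists_inTriangle_and_exists_not_inTriangle hα h3 h2)) ?_
    exact fun _ _ _ _ hG hH => hG.1.1.graphType_subset_of_exists_inTriangle hH.1.1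
      hG.1.2 hH.1.2 hH.2.1 hH.2.2

end MiddleRegime

theorem mul_natCast_ne_of_notMem {α : ℝ}
    (h : α ∉ ({1, 7 / 6, 6 / 5, 5 / 4, 4 / 3, 3 / 2, 2} : Set ℝ)) :
    ∀ m ≤ 6, α * m ≠ (m + 1 : ℕ) := by
  simp only [Set.mem_insert_iff, Set.mem_singleton_iff, not_or] at h
  obtain ⟨-, h6, h5, h4, h3, h2, h1⟩ := h
  intro m hm heq
  interval_cases m <;> norm_num at heq
  exacts [h1 heq, h2 (by linarith), h3 (by linarith), h4 (by linarith), h5 (by linarith),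
    h6 (by linarith)]

end FOZeroOne

open FOZeroOne

/-- For `α > 0`, the random graph `G(n, n ^ (-α))` does not obey the FO zero-one 3-law iff
`α ∈ {1, 7/6, 6/5, 5/4, 4/3, 3/2, 2}`. -/
theorem theorem5 (α : ℝ) (hα : 0 < α) :
    ¬ ObeysFOZeroOneLaw (powEdgeProb α hα) 3 ↔
      α ∈ ({1, 7 / 6, 6 / 5, 5 / 4, 4 / 3, 3 / 2, 2} : Set ℝ) := by
  constructor
  · contrapose!
    intro hne
    rcases lt_or_ge α (1 / 2) with hhalf | hhalf
    · exact obeysFOZeroOneLaw_of_lt_half hα hhalf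
    rcases lt_or_gt_of_ne (show α ≠ 1 from fun h => hne (.inl h)) with hone | hone
    · exact obeysFOZeroOneLaw_of_half_le hα hhalf hone
    · exact obeysFOZeroOneLaw_of_one_lt hone (mul_natCast_ne_of_notMem hne)
  · rintro (rfl | rfl | rfl | rfl | rfl | rfl | rfl)
    · exact not_obeysFOZeroOneLaw_one hα
    · exact not_obeysFOZeroOneLaw_seven_sixths hα
    · exact not_obeysFOZeroOneLaw_six_fifths hα
    · exact not_obeysFOZeroOneLaw_five_fourths hα
    · exact not_obeysFOZeroOneLaw_four_thirds hα
    · exact not_obeysFOZeroOneLaw_three_halves hα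
    · exact not_obeysFOZeroOneLaw_two hα
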